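/- **Setting.** Write $\bar\Delta=\{|x|\le 1\}\times\{0\}\subset\mathbb C^2$, $\bar\Delta^\star=\{0<|x|\le1\}$. For $\lambda>0$ a $\lambda$-adapted region is $U_{A,B}=\{|y||x|^\lambda\le A,\ |x|\le1,\ |y|\le B\}$, $A,B>0$. A *prepared saddle foliation* $(U,\mathcal F)$ of eigenratio $\lambda>0$ is an open $U\subset\mathbb C^2$ whose traces on $\{x=0\}$ and $\{y=0\}$ are simply connected, with the singular foliation $\mathcal F$ of $U$ defined by $x\,dy+\lambda y(1+x^nyK(x,y))\,dx$, where $n\ge\max(1,\lfloor\lambda\rfloor)$, $K$ is holomorphic on $U$, and, for some $A,B,\varepsilon>0$, $U_{A,B}\subset U$, $\sup_U|K|\le\varepsilon$, $\varepsilon B<1$. Let $(\Omega,1)$ be the germ of $\{x=1\}$ at $(1,0)$, and let $(\Sigma,\sigma)$ denote germs of curves $\{y=\alpha(x)\}$, $\alpha$ holomorphic, $\alpha(0)=\sigma\neq0$; $\Sigma^{\rm cut}$ is $\Sigma$ minus $\{x\in\mathbb R_{\le0}\}$. A *regular transition class* $\mathcal R$ is an orbit of the holonomy groupoid of $(U,\mathcal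 F)$, acting by left composition, on the germs of diffeomorphisms $R:(\Omega,1)\to(\Sigma,\sigma)$, $(0,\sigma)\in U$, with $\Sigma$ and $\sigma$ varying. A *loop germ* $(\mathcal F,\mathcal R)$ is represented by such triples $(U,\mathcal F,\mathcal R)$, two of them being identified if they agree on some adapted region. For $|\sigma|\le B$, $U_{A,B}\subset U$, the *corner transition germs* at $\sigma$ are the germs $D_{[m]}:(\Sigma^{\rm cut},\sigma)\to(\Omega,1)$, $m\in\mathbb Z$, sending a point of abscissa $x$ to the endpoint of the leafwise lift (through $\{x=\mathrm{const}\}$) of the path which first follows backwards, from $x$ to $1$, the path $t\mapsto e^{-\xi(t)}$ through $x$, $\xi(t)=t+iC(e^{\beta t}-1)$, $C=\pm1$, $0\le\beta<\lambda$, $t\ge0$, $|\mathrm{Im}\,\xi|<\pi$, and then $-m$ times the positively oriented unit circle. The *Poincaré first return class* $\mathrm{Poinc}(\mathcal F,\mathcal R)$ consists of the germs $P=RD$ on $\Sigma^{\rm cut}$, with $R\in\mathcal R$ of endpoint $\sigma$ and $D$ a corner transition germ at $\sigma$ (in any representative). Two such germs $P$, $\tilde P$ on $\Sigma^{\rm cut}$,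 $\tilde\Sigma^{\rm cut}$ are *analytically conjugate* if $\tilde P\varphi=\varphi P$ for a germ of a holomorphic diffeomorphism $\varphi:(\Sigma,\sigma)\to(\tilde\Sigma,\tilde\sigma)$, as germs at points $x\in\Sigma^{\rm cut}$ with $\varphi(x)\in\tilde\Sigma^{\rm cut}$ arbitrarily close to the base points (hence along their analytic continuation). Let $\Phi$ be a germ along $\bar\Delta$ of a biholomorphism of $\mathbb C^2$ preserving $\bar\Delta$ and each fiber $\{x=\mathrm{const}\}$. Put $\Phi_\star(\tilde R)=(\Phi|_{\tilde\Sigma})\tilde R(\Phi|_\Omega)^{-1}$ and $\Phi_\star(\tilde D)=(\Phi|_\Omega)\tilde D(\Phi|_{\tilde\Sigma})^{-1}$ for regular and corner transition germs with base point in the domain of $\Phi$. Write $(\mathcal F,\mathcal R)=\Phi\cdot(\tilde{\mathcal F},\tilde{\mathcal R})$ if $\Phi$ maps $\tilde{\mathcal F}$ to $\mathcal F$ on an adapted region and $\Phi_\star(\tilde R)\in\mathcal R$ for some $\tilde R\in\tilde{\mathcal R}$ with endpoint in that region. Pairs $R_1,R_2$ and $D_1,D_2$ (with base points $\sigma_1,\sigma_2$)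 are *related by the same transporting path* $\Upsilon\subset\bar\Delta^\star$ if, on realizations $\Sigma_1,\Sigma_2$ of the transversals (simply connected, in $U$, transverse to $\mathcal F$), there are points $z_1,z_2$ such that $\Upsilon$ lifts to a leaf path $\Upsilon_{z_1,z_2}$ from $z_1$ to $z_2$, and as germs at $z_1$ (at $y_0$ for the first identity) $$R_2=\mathrm{hol}_{\Upsilon_{z_1,z_2}}R_1,\qquad D_1=D_2\,\mathrm{hol}_{\Upsilon_{z_1,z_2}}.$$ Here $R_1,R_2$ are realized as injective maps into $\Sigma_1,\Sigma_2$ on a common connected neighborhood $W$ of $1$ in $\Omega$, $z_i=R_i(y_0)$, and there is a connected open $G\subset W$ containing $y_0$ and adherent to $1$ such that $R_i(G)\subset\Sigma_i^{\rm cut}$ and $D_i$ is holomorphic on $R_i(G)$, $i=1,2$. **Theorem A.** Let $(\mathcal F,\mathcal R)=\Phi\cdot(\tilde{\mathcal F},\tilde{\mathcal R})$ be two equivalent loop germs. 1. Let $P=RD\in\mathrm{Poinc}(\mathcal F,\mathcal R)$ and $\tilde P=\tilde R\tilde D\in\mathrm{Poinc}(\tilde{\mathcal F},\tilde{\mathcal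 R})$ be such that the pairs $R_1=R$, $R_2=\Phi_\star(\tilde R)$ and $D_1=D$, $D_2=\Phi_\star(\tilde D)$ are related by the same transporting path $\Upsilon\subset\bar\Delta^\star$. Then $P$ and $\tilde P$ are analytically conjugate. 2. Every $P\in\mathrm{Poinc}(\mathcal F,\mathcal R)$ is analytically conjugate to some $\tilde P\in\mathrm{Poinc}(\tilde{\mathcal F},\tilde{\mathcal R})$, and conversely; moreover $\tilde P$ (respectively $P$) can be found in any given representative of its loop germ. -/

import Mathlib

open Set Filter Topology

noncomputable section

namespace SaddleLoop

/-- The closed region `{|y||x|^lam ≤ A, |x| ≤ 1, |y| ≤ B}` of `ℂ²`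
(a `lam`-adapted region when `A, B > 0`). -/
def adaptedRegion (lam A B : ℝ) : Set (ℂ × ℂ) :=
  {p | ‖p.2‖ * ‖p.1‖ ^ lam ≤ A ∧ ‖p.1‖ ≤ 1 ∧ ‖p.2‖ ≤ B}

/-- A prepared saddle foliation `(U, F)` of eigenratio `lam > 0`: the singular foliation of the
open set `U` defined by the 1-form `x dy + lam y (1 + x^n y K(x, y)) dx`. -/
structure PreparedSaddle where
  lam : ℝ
  lam_pos : 0 < lam
  U : Set (ℂ × ℂ)
  isOpen_U : IsOpen U
  simplyConnected_vertical : SimplyConnectedSpace {y : ℂ | ((0 : ℂ), y) ∈ U}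
  simplyConnected_horizontal : SimplyConnectedSpace {x : ℂ | (x, (0 : ℂ)) ∈ U}
  n : ℕ
  n_pos : 0 < n
  floor_le : ⌊lam⌋₊ ≤ n
  K : ℂ × ℂ → ℂ
  holo_K : DifferentiableOn ℂ K U
  adapted : ∃ A B ε : ℝ, 0 < A ∧ 0 < B ∧ 0 < ε ∧ adaptedRegion lam A B ⊆ U ∧
    (∀ p ∈ U, ‖K p‖ ≤ ε) ∧ ε * B < 1

namespace PreparedSaddle

variable (S : PreparedSaddle)

/-- The vector field `x ∂x - lam y (1 + x^n y K) ∂y`, which spans the kernel of the 1-form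
defining the foliation, and vanishes in `U` at the origin only. -/
def X (p : ℂ × ℂ) : ℂ × ℂ :=
  (p.1, -((S.lam : ℂ) * p.2 * (1 + p.1 ^ S.n * p.2 * S.K p)))

/-- `c : [0,1] → U` is a (piecewise differentiable) path in a leaf of the foliation. -/
def IsLeafPath (c : ℝ → ℂ × ℂ) : Prop :=
  ContinuousOn c (Icc 0 1) ∧ (∀ t ∈ Icc (0 : ℝ) 1, c t ∈ S.U ∧ c t ≠ 0) ∧
    ∃ s : Set ℝ, s.Finite ∧ ∀ t ∈ Ioo (0 : ℝ) 1 \ s, ∃ k : ℂ, HasDerivAt c (k • S.X (c t)) t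

/-- The path `Γ : [0,1] → ℂ` in the `x`-line has a lift in a leaf, through the fibration
`{x = const}`, going from `p` to `q`. -/
def LiftsTo (Γ : ℝ → ℂ) (p q : ℂ × ℂ) : Prop :=
  ∃ c : ℝ → ℂ × ℂ, S.IsLeafPath c ∧ (∀ t ∈ Icc (0 : ℝ) 1, (c t).1 = Γ t) ∧ c 0 = p ∧ c 1 = q

/-- `h` represents the holonomy germ along the leaf path `c`, from the transversal `y = α₁ x` at
its point of abscissa `x₁` to the transversal `y = α₂ x` (both parametrized by `x`): `c` deforms
continuously through leaf paths joining the point of abscissa `x` to that of abscissa `h x`. -/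
def IsHolonomy (α₁ α₂ : ℂ → ℂ) (x₁ : ℂ) (c : ℝ → ℂ × ℂ) (h : ℂ → ℂ) : Prop :=
  ∃ N ∈ 𝓝 x₁, ∃ H : ℂ → ℝ → ℂ × ℂ,
    ContinuousOn (Function.uncurry H) (N ×ˢ Icc (0 : ℝ) 1) ∧
    (∀ t ∈ Icc (0 : ℝ) 1, H x₁ t = c t) ∧
    ∀ x ∈ N, S.IsLeafPath (H x) ∧ H x 0 = (x, α₁ x) ∧ H x 1 = (h x, α₂ (h x))

end PreparedSaddle

/-- A germ of a diffeomorphism `(Ω, 1) → (Σ, σ)`, where `Ω = {x = 1}` is parametrized by `y` and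
`Σ = {y = α x}` is a germ of a curve through a point `σ = α 0 ≠ 0` of `{x = 0}`, transverse to
the fibration `{x = const}` and parametrized by `x`. In these parameters the germ is `r`. -/
structure RegGerm where
  α : ℂ → ℂ
  r : ℂ → ℂ
  analytic_α : AnalyticAt ℂ α 0
  α_ne : α 0 ≠ 0
  analytic_r : AnalyticAt ℂ r 0
  r_zero : r 0 = 0
  deriv_r : deriv r 0 ≠ 0

/-- The germ as a map from `Ω` to `Σ ⊆ ℂ²`. -/
def RegGerm.toMap (R : RegGerm) (y : ℂ) : ℂ × ℂ := (R.r y, R.α (R.r y))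

/-- The reparametrized exponential paths: `ξ(t) = t + i C (e^{β t} - 1)`. -/
def expPath (β C t : ℝ) : ℂ := (t : ℂ) + Complex.I * ((C * (Real.exp (β * t) - 1) : ℝ) : ℂ)

namespace PreparedSaddle

variable (S : PreparedSaddle)

/-- `R₂ = h R₁` for a holonomy germ `h` along a leaf path between the endpoints of `R₁`, `R₂`
(the constant path gives the changes of transversal with the same base point). -/
def HolRel (R₁ R₂ : RegGerm) : Prop :=
  ∃ (c : ℝ → ℂ × ℂ) (h : ℂ → ℂ), S.IsLeafPath c ∧ c 0 = (0, R₁.α 0) ∧ c 1 = (0, R₂.α 0) ∧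
    S.IsHolonomy R₁.α R₂.α 0 c h ∧ ∀ᶠ y in 𝓝 0, R₂.r y = h (R₁.r y)

/-- Near the base point of the cut transversal `{y = α x}`, `x ∉ ℝ_{≤ 0}`, the map `D` is the
`m`-th determination `D_[m]` of the corner transition towards `Ω`: starting from `(x, α x)`, lift
backwards the exponential path through `x` (which lies in the strip `|Im| < π`), then lift
the `(-m)`-th power of the unit circle. -/
def IsCornerDet (α : ℂ → ℂ) (m : ℤ) (D : ℂ → ℂ) : Prop :=
  ∃ ρ > 0, ∀ β ∈ Ico 0 S.lam, ∀ C : ℝ, (C = 1 ∨ C = -1) → ∀ T : ℝ, 0 ≤ T →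
    β * T < Real.log (1 + Real.pi) → ∀ x : ℂ, x = Complex.exp (-expPath β C T) → ‖x‖ < ρ →
      ∃ q : ℂ,
        S.LiftsTo (fun t => Complex.exp (-expPath β C ((1 - t) * T))) (x, α x) (1, q) ∧
        S.LiftsTo (fun t => Complex.exp (-(2 * Real.pi * m * t * Complex.I))) (1, q) (1, D x)

/-- `D` represents a corner transition germ `(Σ^cut, σ) → (Ω, 1)` of the prepared saddle, on the
transversal `Σ = {y = α x}` with base point `σ = α 0`. -/
def IsCorner (α D : ℂ → ℂ) : Prop :=
  AnalyticAt ℂ α 0 ∧ α 0 ≠ 0 ∧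
  (∃ A B : ℝ, 0 < A ∧ 0 < B ∧ adaptedRegion S.lam A B ⊆ S.U ∧ ‖α 0‖ ≤ B) ∧
  Tendsto D (𝓝[Complex.slitPlane] 0) (𝓝 0) ∧
  (∀ᶠ x in 𝓝[Complex.slitPlane] 0, DifferentiableAt ℂ D x) ∧
  ∃ m : ℤ, S.IsCornerDet α m D

/-- The germ of transversal `{y = α x}` is realized over the domain `N` of the `x`-line: its
graph lies in `U`, is simply connected, and is transverse to the foliation. -/
def IsRealized (α : ℂ → ℂ) (N : Set ℂ) : Prop :=
  IsOpen N ∧ (0 : ℂ) ∈ N ∧ SimplyConnectedSpace N ∧ DifferentiableOn ℂ α N ∧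
    ∀ x ∈ N, (x, α x) ∈ S.U ∧ ¬ ∃ k : ℂ, S.X (x, α x) = k • ((1 : ℂ), deriv α x)

/-- The pairs `R₁, R₂` and `D₁, D₂` are related by the same transporting path `Υ` of the punctured
closed unit disk: `Υ` has a leaf lift `c` between points `z₁`, `z₂` of realizations of the two
transversals, and `R₂ = hol_c R₁`, `D₁ = D₂ hol_c` as germs at `z₁`.
Here `R₁, R₂` are realized on a common connected `W ⊆ Ω`, with `z₁ = R₁ y₀`, `z₂ = R₂ y₀`,
and `D₁, D₂` are holomorphic on parts `R₁ G`, `R₂ G` of the cut transversals, connected,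
containing `z₁`, resp. `z₂`, and adherent to the base points. -/
def RelatedBy (R₁ R₂ : RegGerm) (D₁ D₂ : ℂ → ℂ) (Υ : ℝ → ℂ) : Prop :=
  (∀ t ∈ Icc (0 : ℝ) 1, Υ t ≠ 0 ∧ ‖Υ t‖ ≤ 1) ∧
  ∃ (N₁ N₂ W G : Set ℂ) (y₀ : ℂ) (c : ℝ → ℂ × ℂ) (h : ℂ → ℂ),
    S.IsRealized R₁.α N₁ ∧ S.IsRealized R₂.α N₂ ∧
    (IsOpen W ∧ IsConnected W ∧ (0 : ℂ) ∈ W ∧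
      DifferentiableOn ℂ R₁.r W ∧ InjOn R₁.r W ∧ MapsTo R₁.r W N₁ ∧
      DifferentiableOn ℂ R₂.r W ∧ InjOn R₂.r W ∧ MapsTo R₂.r W N₂) ∧
    (IsOpen G ∧ IsConnected G ∧ G ⊆ W ∧ y₀ ∈ G ∧ (0 : ℂ) ∈ closure G ∧
      MapsTo R₁.r G Complex.slitPlane ∧ DifferentiableOn ℂ D₁ (R₁.r '' G) ∧
      MapsTo R₂.r G Complex.slitPlane ∧ DifferentiableOn ℂ D₂ (R₂.r '' G)) ∧
    (S.IsLeafPath c ∧ (∀ t ∈ Icc (0 : ℝ) 1, (c t).1 = Υ t) ∧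
      c 0 = R₁.toMap y₀ ∧ c 1 = R₂.toMap y₀ ∧
      S.IsHolonomy R₁.α R₂.α (R₁.r y₀) c h) ∧
    (∀ᶠ y in 𝓝 y₀, R₂.r y = h (R₁.r y)) ∧
    (∀ᶠ x in 𝓝 (R₁.r y₀), D₁ x = D₂ (h x))

end PreparedSaddle

/-- An abstract saddle loop `(U, F, R)`: a prepared saddle with an orbit `cls` of the holonomy
groupoid on the regular transition germs with endpoint in `U`. -/
structure AbstractLoop extends PreparedSaddle where
  cls : Set RegGerm
  isOrbit : ∃ R₀ : RegGerm, ((0 : ℂ), R₀.α 0) ∈ U ∧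
    cls = {R | toPreparedSaddle.HolRel R₀ R}

/-- `P = R D` is a Poincaré first return germ of the loop, on a cut transversal parametrized by
`x`, with dynamical decomposition `(R, D)`. -/
def AbstractLoop.IsDecomposition (L : AbstractLoop) (P : ℂ → ℂ) (R : RegGerm) (D : ℂ → ℂ) :
    Prop :=
  R ∈ L.cls ∧ L.IsCorner R.α D ∧ ∀ᶠ x in 𝓝[Complex.slitPlane] 0, P x = R.r (D x)

/-- The Poincaré first return class. -/
def AbstractLoop.Poinc (L : AbstractLoop) : Set (ℂ → ℂ) :=
  {P | ∃ R D, L.IsDecomposition P R D}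

/-- `P` and `Pt`, germs on cut transversals, are analytically conjugate: `Pt φ = φ P` for a germ of
diffeomorphism `φ` of the (uncut) transversals, as germs at points arbitrarily close to the base
point (hence everywhere, by analytic continuation of the multivalued maps). -/
def AnalyticallyConjugate (P Pt : ℂ → ℂ) : Prop :=
  ∃ φ : ℂ → ℂ, AnalyticAt ℂ φ 0 ∧ φ 0 = 0 ∧ deriv φ 0 ≠ 0 ∧
    ∃ᶠ x in 𝓝[Complex.slitPlane] 0, φ x ∈ Complex.slitPlane ∧ ∀ᶠ w in 𝓝 x, Pt (φ w) = φ (P w)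

/-- A representative of an element of `Diff_fib(ℂ², Δ̄)`: a biholomorphism between neighbourhoods
of `Δ̄ × {0}` preserving `Δ̄ × {0}` and each fiber of `{x = const}`. -/
structure FiberedDiffeo where
  e : OpenPartialHomeomorph (ℂ × ℂ) (ℂ × ℂ)
  holo : DifferentiableOn ℂ e e.source
  holo_symm : DifferentiableOn ℂ e.symm e.target
  disk : ∀ x : ℂ, ‖x‖ ≤ 1 → (x, (0 : ℂ)) ∈ e.source ∧ e (x, 0) = (x, 0)
  fibered : ∀ p ∈ e.source, (e p).1 = p.1

namespace FiberedDiffeo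

variable (Φ : FiberedDiffeo)

/-- `R = Φ_*(Rt)`: `R` is the `Φ`-correspondent `(Φ|Σ) Rt (Φ|Ω)⁻¹` of `Rt`, on the image
transversal. -/
def RegCorresp (Rt R : RegGerm) : Prop :=
  ((0 : ℂ), Rt.α 0) ∈ Φ.e.source ∧ (∀ᶠ x in 𝓝 0, Φ.e (x, Rt.α x) = (x, R.α x)) ∧
    ∀ᶠ y in 𝓝 0, R.toMap (Φ.e (1, y)).2 = Φ.e (Rt.toMap y)

/-- `D = Φ_*(Dt)`: the germ `D` on `{y = α x}` is the `Φ`-correspondent `(Φ|Ω) Dt (Φ|Σ)⁻¹` of the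
germ `Dt` on `{y = αt x}`. -/
def CornerCorresp (αt Dt α D : ℂ → ℂ) : Prop :=
  ((0 : ℂ), αt 0) ∈ Φ.e.source ∧ (∀ᶠ x in 𝓝 0, Φ.e (x, αt x) = (x, α x)) ∧
    ∀ᶠ x in 𝓝[Complex.slitPlane] 0, (1, D (Φ.e (x, αt x)).1) = Φ.e (1, Dt x)

/-- `(F, R) = Φ · (Ft, Rt)` for the loop germs represented by `L` and `Lt`: on some adapted
region `Φ` maps the foliation of `Lt` to that of `L`, and it maps the class of `Lt` to
that of `L`, i.e. maps some element of the first to an element of the second. -/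
def Carries (Lt L : AbstractLoop) : Prop :=
  ∃ A B : ℝ, 0 < A ∧ 0 < B ∧
    adaptedRegion Lt.lam A B ⊆ Lt.U ∩ Φ.e.source ∧
    MapsTo Φ.e (adaptedRegion Lt.lam A B) L.U ∧
    (∀ p ∈ adaptedRegion Lt.lam A B, ∃ k : ℂ, k ≠ 0 ∧
      fderiv ℂ Φ.e p (Lt.X p) = k • L.X (Φ.e p)) ∧
    ∃ Rt ∈ Lt.cls, ∃ R ∈ L.cls, ‖Rt.α 0‖ ≤ B ∧ Φ.RegCorresp Rt R

end FiberedDiffeo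

end SaddleLoop

end

/-!
Both parts rest on the same remark: a first return germ `P = R D` depends on the choice of the
transversal only up to conjugacy by the holonomy. If `R₂ = h R₁` and `D₁ = D₂ h` then
`D₁ R₁ = D₂ R₂`, and `R₂ R₁⁻¹` conjugates `R₁ D₁` to `R₂ D₂`.

For germs related by a transporting path, the holonomy `h` exists only near a point `z₁` possibly
far from the base point, but `D₁ R₁ = D₂ R₂` extends from `y₀` to the connected set `G`, which is
adherent to the base point (`PreparedSaddle.RelatedBy.exists_eqOn`), while `R₂ R₁⁻¹` is a germ of
diffeomorphism there. The map `Φ` cancels in `R₂ D₂ = Φ_*(Rt) Φ_*(Dt)`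
(`analyticallyConjugate_of_relatedBy`).

To find a conjugate of a given `P = R D`, the difficulty is that its base point may lie outside the
domain of `Φ`. The flow of the vector field `x ∂x - λ y (1 + x^n y K) ∂y` for a large time `τ` sends
the transversal `y = α x` to a transversal with base point `e^{-λτ} α 0`, by the homothety
`x ↦ e^τ x`, and this one can be mapped by `Φ`. It has to be checked that the image of `R` belongs
to the class of the other loop, and that the image of `D` is a corner transition
(`FiberedDiffeo.LoopConj.exists_conjugate`).

* For corner transitions: over a small transversal the leaves extend to a large sector in the
  logarithmic coordinate `log x`, because `y` decays exponentially along them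
  (`PreparedSaddle.exists_sector`). Thus the lifts from the old and from the new transversal have
  the same end, and the lift from the new one stays in the domain where `Φ` conjugates the
  foliations (`FiberedDiffeo.IsConj.isCornerDet`).
* For regular transitions: two elements of a class with base points in a small disk `‖y‖ < η` are
  related by the holonomy of a path which may leave this disk, and the domain of `Φ`. As
  `{x = 0} ∩ U` is simply connected, the punctured disk carries the whole fundamental group of
  `({x = 0} ∩ U) ∖ {0}`, so that the path can be replaced by one in the disk
  (`PreparedSaddle.HolRel.exists_small`). This uses a conformal coordinate on a part of
  `{x = 0} ∩ U` (`exists_conformal_disk`), whose logarithm is a coordinate on the universal cover,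
  and the fact that near `{x = 0}` the leaves are graphs over it
  (`PreparedSaddle.exists_transverse_box`).

The definition of an equivalence gives one pair of corresponding regular germs, with base points
possibly on the boundary of the region where the foliations are conjugate. Moving it by the flow
gives a pair with small base points (`FiberedDiffeo.Carries.loopConj`), which makes the situation
symmetric in the two loops. The leaves used above come from a holomorphic differential equation
with parameter, solved along rays by Picard iteration (`exists_solution_along_rays`), and are unique
by the flow box theorem (`PreparedSaddle.LeafOn.unique`).
-/

noncomputable section

namespace SaddleLoop

/-! ### Holomorphic functions of two variables -/

/-- A family of holomorphic functions depending continuously on a parameter has jointly continuous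
derivatives: it is locally uniformly continuous in the parameter, and so are the derivatives by
Cauchy's estimate. -/
theorem continuousOn_deriv_of_param {T : Type*} [TopologicalSpace T] {φ : T → ℂ → ℂ} {S : Set T}
    {Z : Set ℂ} (hZ : IsOpen Z) (hc : ContinuousOn (Function.uncurry φ) (S ×ˢ Z))
    (hd : ∀ u ∈ S, DifferentiableOn ℂ (φ u) Z) :
    ContinuousOn (fun p : T × ℂ => deriv (φ p.1) p.2) (S ×ˢ Z) := by
  rintro ⟨u₀, z₀⟩ ⟨hu₀, hz₀⟩
  have hlim : TendstoLocallyUniformlyOn φ (φ u₀) (𝓝[S] u₀) Z := by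
    rw [Metric.tendstoLocallyUniformlyOn_iff]
    intro ε hε z hz
    have h1 : ∀ᶠ p in 𝓝[S ×ˢ Z] (u₀, z), dist (φ p.1 p.2) (φ u₀ z) < ε / 2 :=
      (hc (u₀, z) ⟨hu₀, hz⟩).eventually (Metric.ball_mem_nhds _ (half_pos hε))
    rw [nhdsWithin_prod_eq] at h1
    obtain ⟨pa, hpa, pb, hpb, h⟩ := Filter.eventually_prod_iff.1 h1
    refine ⟨{z | pb z}, hpb, ?_⟩
    filter_upwards [hpa] with u hu w hw
    have e1 := h hu hw
    have e2 := h (hpa.self_of_nhdsWithin hu₀) hw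
    calc dist (φ u₀ w) (φ u w) ≤ dist (φ u₀ w) (φ u₀ z) + dist (φ u w) (φ u₀ z) :=
          dist_triangle_right _ _ _
      _ < ε := by simp only at e1 e2; linarith
  have hev : ∀ᶠ u in 𝓝[S] u₀, DifferentiableOn ℂ (φ u) Z := by
    filter_upwards [self_mem_nhdsWithin] with u hu using hd u hu
  have : (𝓝[S] u₀).NeBot := mem_closure_iff_nhdsWithin_neBot.1 (subset_closure hu₀)
  have hder := hlim.deriv hev hZ
  have hcont : ContinuousOn (deriv (φ u₀)) Z := ((hd u₀ hu₀).deriv hZ).continuousOn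
  rw [ContinuousWithinAt, Metric.tendsto_nhds]
  intro ε hε
  obtain ⟨t, ht, h1⟩ := Metric.tendstoLocallyUniformlyOn_iff.1 hder (ε / 2) (half_pos hε) z₀ hz₀
  have h2 : ∀ᶠ z in 𝓝[Z] z₀, dist (deriv (φ u₀) z) (deriv (φ u₀) z₀) < ε / 2 :=
    (hcont z₀ hz₀).eventually (Metric.ball_mem_nhds _ (half_pos hε))
  rw [nhdsWithin_prod_eq]
  filter_upwards [Filter.prod_mem_prod h1 (inter_mem ht h2)] with p hp
  have e1 := hp.1 p.2 hp.2.1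
  have e2 : dist (deriv (φ u₀) p.2) (deriv (φ u₀) z₀) < ε / 2 := hp.2.2
  rw [dist_comm] at e1
  calc dist (deriv (φ p.1) p.2) (deriv (φ u₀) z₀) ≤ _ + _ := dist_triangle _ (deriv (φ u₀) p.2) _
    _ < ε := by simp only [Function.comp] at e1; linarith

/-- Osgood's lemma: a continuous function of two variables which is holomorphic in each of them is
of class `C¹`. -/
theorem contDiffOn_of_separately {f : ℂ × ℂ → ℂ} {Ω : Set (ℂ × ℂ)} (hΩ : IsOpen Ω)
    (hc : ContinuousOn f Ω) (h1 : ∀ p ∈ Ω, DifferentiableAt ℂ (fun s => f (s, p.2)) p.1)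
    (h2 : ∀ p ∈ Ω, DifferentiableAt ℂ (fun a => f (p.1, a)) p.2) : ContDiffOn ℂ 1 f Ω := by
  have c1 : ContinuousOn (fun p : ℂ × ℂ => deriv (fun s => f (s, p.2)) p.1) Ω := by
    rintro ⟨s₀, a₀⟩ hp
    obtain ⟨r, hr, hball⟩ := Metric.isOpen_iff.1 hΩ _ hp
    have hsub : Metric.ball a₀ r ×ˢ Metric.ball s₀ r ⊆ Prod.swap ⁻¹' Ω := by
      rintro ⟨a, s⟩ ⟨ha, hs⟩
      apply hball
      simpa [Prod.dist_eq] using ⟨hs, ha⟩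
    have := continuousOn_deriv_of_param (φ := fun a s => f (s, a)) (S := Metric.ball a₀ r)
      (Z := Metric.ball s₀ r) Metric.isOpen_ball
      (hc.comp continuous_swap.continuousOn hsub)
      (fun a ha s hs => (h1 (s, a) (hsub (Set.mk_mem_prod ha hs))).differentiableWithinAt)
    have h3 := this.continuousAt ((Metric.isOpen_ball.prod Metric.isOpen_ball).mem_nhds
      (Set.mk_mem_prod (Metric.mem_ball_self hr) (Metric.mem_ball_self hr)))
    exact (h3.comp (f := Prod.swap) (x := (s₀, a₀)) continuous_swap.continuousAt).continuousWithinAt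
  have c2 : ContinuousOn (fun p : ℂ × ℂ => deriv (fun a => f (p.1, a)) p.2) Ω := by
    rintro ⟨s₀, a₀⟩ hp
    obtain ⟨r, hr, hball⟩ := Metric.isOpen_iff.1 hΩ _ hp
    have hsub : Metric.ball s₀ r ×ˢ Metric.ball a₀ r ⊆ Ω := by
      rintro ⟨s, a⟩ ⟨hs, ha⟩
      apply hball
      simpa [Prod.dist_eq] using ⟨hs, ha⟩
    have := continuousOn_deriv_of_param (φ := fun s a => f (s, a)) (S := Metric.ball s₀ r)
      (Z := Metric.ball a₀ r) Metric.isOpen_ball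
      (hc.mono hsub)
      (fun s hs a ha => (h2 (s, a) (hsub (Set.mk_mem_prod hs ha))).differentiableWithinAt)
    exact (this.continuousAt ((Metric.isOpen_ball.prod Metric.isOpen_ball).mem_nhds
      (Set.mk_mem_prod (Metric.mem_ball_self hr) (Metric.mem_ball_self hr)))).continuousWithinAt
  set D : ℂ × ℂ → (ℂ × ℂ →L[ℂ] ℂ) := fun p =>
    (ContinuousLinearMap.toSpanSingleton ℂ (deriv (fun s => f (s, p.2)) p.1)).coprod
      (ContinuousLinearMap.toSpanSingleton ℂ (deriv (fun a => f (p.1, a)) p.2)) with hD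
  have d1 : ContinuousOn (fun p : ℂ × ℂ => ContinuousLinearMap.toSpanSingleton ℂ
      (deriv (fun s => f (s, p.2)) p.1)) Ω :=
    (ContinuousLinearMap.toSpanSingletonCLE (𝕜 := ℂ) (E := ℂ)).continuous.comp_continuousOn c1
  have d2 : ContinuousOn (fun p : ℂ × ℂ => ContinuousLinearMap.toSpanSingleton ℂ
      (deriv (fun a => f (p.1, a)) p.2)) Ω :=
    (ContinuousLinearMap.toSpanSingletonCLE (𝕜 := ℂ) (E := ℂ)).continuous.comp_continuousOn c2
  -- continuous partial derivatives give the derivative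
  have hst : ∀ p ∈ Ω, HasStrictFDerivAt f (D p) p := by
    intro p hp
    have hev := hΩ.mem_nhds hp
    exact hasStrictFDerivAt_uncurry_coprod (𝕜 := ℂ) (f := fun s a => f (s, a))
      (f₁ := fun s a => ContinuousLinearMap.toSpanSingleton ℂ (deriv (fun s => f (s, a)) s))
      (f₂ := fun s a => ContinuousLinearMap.toSpanSingleton ℂ (deriv (fun a => f (s, a)) a))
      (by filter_upwards [hev] with v hv using (h1 v hv).hasDerivAt.hasFDerivAt)
      (by filter_upwards [hev] with v hv using (h2 v hv).hasDerivAt.hasFDerivAt)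
      (d1.continuousAt hev) (d2.continuousAt hev)
  rw [show (1 : WithTop ℕ∞) = 0 + 1 from rfl, contDiffOn_succ_iff_fderiv_of_isOpen hΩ]
  refine ⟨fun p hp => (hst p hp).differentiableAt.differentiableWithinAt, by simp, ?_⟩
  rw [contDiffOn_zero]
  have : ContinuousOn D Ω := by
    have := (ContinuousLinearMap.coprodEquivL ℂ (𝕜 := ℂ) (E := ℂ) (F := ℂ) (G := ℂ)).continuous.comp_continuousOn (d1.prodMk d2)
    exact this
  exact this.congr fun p hp => (hst p hp).hasFDerivAt.fderiv

/-- Holomorphic functions of two variables are of class `C¹`. -/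
theorem contDiffOn_of_differentiableOn {f : ℂ × ℂ → ℂ} {Ω : Set (ℂ × ℂ)} (hΩ : IsOpen Ω)
    (hf : DifferentiableOn ℂ f Ω) : ContDiffOn ℂ 1 f Ω := by
  refine contDiffOn_of_separately hΩ hf.continuousOn (fun p hp => ?_) (fun p hp => ?_)
  · have := hf.differentiableAt (hΩ.mem_nhds hp)
    exact DifferentiableAt.comp (g := f) (f := fun s => (s, p.2)) p.1 this (by fun_prop)
  · have := hf.differentiableAt (hΩ.mem_nhds hp)
    exact DifferentiableAt.comp (g := f) (f := fun s => (p.1, s)) p.2 this (by fun_prop)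

/-- On a domain `Ω` which is star-shaped in its first variable `s`, the integral of `f` over the
segment from `0` to `s` is holomorphic in both variables, and is a primitive of `f` in `s`. -/
theorem primitive_along_rays {f : ℂ × ℂ → ℂ} {Ω : Set (ℂ × ℂ)} (hΩ : IsOpen Ω)
    (hstar : ∀ p ∈ Ω, ∀ u ∈ Icc (0 : ℝ) 1, ((u : ℂ) * p.1, p.2) ∈ Ω)
    (hf : DifferentiableOn ℂ f Ω) :
    DifferentiableOn ℂ (fun p : ℂ × ℂ => ∫ u in (0 : ℝ)..1, p.1 * f ((u : ℂ) * p.1, p.2)) Ω ∧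
    ∀ p ∈ Ω, HasDerivAt (fun s => ∫ u in (0 : ℝ)..1, s * f ((u : ℂ) * s, p.2)) (f p) p.1 := by
  set ψ : ℝ → ℂ × ℂ → ℂ × ℂ := fun u p => ((u : ℂ) * p.1, p.2) with hψ
  set L : ℝ → (ℂ × ℂ →L[ℂ] ℂ × ℂ) := fun u =>
    (u : ℂ) • ((ContinuousLinearMap.fst ℂ ℂ ℂ).prod 0) +
      (0 : ℂ × ℂ →L[ℂ] ℂ).prod (ContinuousLinearMap.snd ℂ ℂ ℂ) with hL
  have hLc : Continuous L := by fun_prop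
  have hLv : ∀ u p, L u p = ψ u p := fun u p => by
    simp [hL, hψ]
  have hψd : ∀ u p, HasFDerivAt (ψ u) (L u) p := fun u p =>
    ((L u).hasFDerivAt (x := p)).congr_of_eventuallyEq (Eventually.of_forall fun q => (hLv u q).symm)
  have hψc : Continuous (Function.uncurry ψ) := by
    simp only [hψ]; fun_prop
  have hC1 := contDiffOn_of_differentiableOn hΩ hf
  have hf'c : ContinuousOn (fderiv ℂ f) Ω := hC1.continuousOn_fderiv_of_isOpen hΩ le_rfl
  have hmap : MapsTo (Function.uncurry ψ) (Icc (0 : ℝ) 1 ×ˢ Ω) Ω := fun q hq => hstar _ hq.2 _ hq.1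
  set F : ℂ × ℂ → ℝ → ℂ := fun p u => p.1 * f (ψ u p) with hF
  set F' : ℂ × ℂ → ℝ → (ℂ × ℂ →L[ℂ] ℂ) := fun p u =>
    p.1 • ((fderiv ℂ f (ψ u p)).comp (L u)) + f (ψ u p) • ContinuousLinearMap.fst ℂ ℂ ℂ with hF'
  have hfψ : ContinuousOn (fun q : ℝ × (ℂ × ℂ) => f (ψ q.1 q.2)) (Icc (0 : ℝ) 1 ×ˢ Ω) :=
    hf.continuousOn.comp hψc.continuousOn hmap
  have hFc : ContinuousOn (fun q : ℝ × (ℂ × ℂ) => F q.2 q.1) (Icc (0 : ℝ) 1 ×ˢ Ω) :=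
    (by fun_prop : Continuous fun q : ℝ × (ℂ × ℂ) => q.2.1).continuousOn.mul hfψ
  have hF'c : ContinuousOn (fun q : ℝ × (ℂ × ℂ) => F' q.2 q.1) (Icc (0 : ℝ) 1 ×ˢ Ω) := by
    refine ContinuousOn.add ?_ ?_
    · refine ContinuousOn.smul (continuous_fst.comp continuous_snd).continuousOn ?_
      refine ContinuousOn.clm_comp (hf'c.comp hψc.continuousOn hmap) ?_
      exact (hLc.comp continuous_fst).continuousOn
    · exact hfψ.smul continuousOn_const
  have hFd : ∀ u ∈ Icc (0 : ℝ) 1, ∀ p ∈ Ω, HasFDerivAt (fun p => F p u) (F' p u) p := by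
    intro u hu p hp
    have h1 : HasFDerivAt f (fderiv ℂ f (ψ u p)) (ψ u p) :=
      (hf.differentiableAt (hΩ.mem_nhds (hstar p hp u hu))).hasFDerivAt
    have h2 := h1.comp p (hψd u p)
    exact (hasFDerivAt_fst (𝕜 := ℂ) (p := p)).mul h2
  have key : ∀ p ∈ Ω, HasFDerivAt (fun p => ∫ u in (0 : ℝ)..1, F p u)
      (∫ u in (0 : ℝ)..1, F' p u) p := by
    intro p hp
    obtain ⟨r, hr, hball⟩ := Metric.nhds_basis_closedBall.mem_iff.1 (hΩ.mem_nhds hp)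
    have hK : IsCompact (Icc (0 : ℝ) 1 ×ˢ Metric.closedBall p r) :=
      isCompact_Icc.prod (isCompact_closedBall p r)
    obtain ⟨M, hM⟩ := hK.exists_bound_of_continuousOn
      (hF'c.mono (Set.prod_mono_right hball))
    have slice : ∀ x ∈ Ω, ContinuousOn (fun u : ℝ => F x u) (Icc 0 1) := fun x hx =>
      hFc.comp (f := fun u : ℝ => (u, x)) (by fun_prop) fun u hu => ⟨hu, hx⟩
    have slice' : ContinuousOn (fun u : ℝ => F' p u) (Icc 0 1) :=
      hF'c.comp (f := fun u : ℝ => (u, p)) (by fun_prop) fun u hu => ⟨hu, hp⟩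
    simp only [intervalIntegral.integral_of_le zero_le_one]
    refine hasFDerivAt_integral_of_dominated_of_fderiv_le (bound := fun _ => M)
      (Metric.closedBall_mem_nhds p hr) ?_ ?_ ?_ ?_ ?_ ?_
    · filter_upwards [hΩ.mem_nhds hp] with x hx
      exact ((slice x hx).mono Ioc_subset_Icc_self).aestronglyMeasurable measurableSet_Ioc
    · exact (slice p hp).integrableOn_Icc.mono_set Ioc_subset_Icc_self
    · exact (slice'.mono Ioc_subset_Icc_self).aestronglyMeasurable measurableSet_Ioc
    · refine (MeasureTheory.ae_restrict_iff' measurableSet_Ioc).2 (Eventually.of_forall ?_)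
      intro u hu x hx
      exact hM (u, x) ⟨Ioc_subset_Icc_self hu, hx⟩
    · exact MeasureTheory.integrable_const _
    · refine (MeasureTheory.ae_restrict_iff' measurableSet_Ioc).2 (Eventually.of_forall ?_)
      intro u hu x hx
      exact hFd u (Ioc_subset_Icc_self hu) x (hball hx)
  refine ⟨fun p hp => (key p hp).differentiableAt.differentiableWithinAt, fun p hp => ?_⟩
  have h1 : HasDerivAt (fun s : ℂ => (s, p.2)) ((1 : ℂ), (0 : ℂ)) p.1 :=
    (hasDerivAt_id p.1).prodMk (hasDerivAt_const p.1 p.2)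
  have h2 := (key p hp).comp_hasDerivAt p.1 h1
  have h3 : (∫ u in (0 : ℝ)..1, F' p u) ((1 : ℂ), (0 : ℂ)) = f p := by
    have slice' : ContinuousOn (fun u : ℝ => F' p u) (Icc 0 1) :=
      hF'c.comp (f := fun u : ℝ => (u, p)) (by fun_prop) fun u hu => ⟨hu, hp⟩
    have hint : IntervalIntegrable (fun u => F' p u) MeasureTheory.volume 0 1 :=
      slice'.intervalIntegrable_of_Icc zero_le_one
    rw [ContinuousLinearMap.intervalIntegral_apply hint]
    have hder : ∀ u ∈ Ioo (0 : ℝ) 1, HasDerivAt (fun u : ℝ => (u : ℂ) * f (ψ u p))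
        (F' p u ((1 : ℂ), (0 : ℂ))) u := by
      intro u hu
      have e1 : HasFDerivAt f (fderiv ℂ f (ψ u p)) (ψ u p) :=
        (hf.differentiableAt (hΩ.mem_nhds (hstar p hp u (Ioo_subset_Icc_self hu)))).hasFDerivAt
      have e2 : HasDerivAt (fun u : ℝ => ψ u p) (p.1, (0 : ℂ)) u := by
        have : HasDerivAt (fun u : ℝ => (u : ℂ) * p.1) p.1 u := by
          simpa using (Complex.ofRealCLM.hasDerivAt (x := u)).mul_const p.1
        exact this.prodMk (hasDerivAt_const u p.2)
      have e3 := (e1.restrictScalars ℝ).comp_hasDerivAt u e2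
      have e4 := (Complex.ofRealCLM.hasDerivAt (x := u)).mul e3
      refine HasDerivAt.congr_deriv (f := fun u : ℝ => (u : ℂ) * f (ψ u p)) e4 ?_
      have h4 : fderiv ℂ f (ψ u p) (p.1, 0) = p.1 * fderiv ℂ f (ψ u p) (1, 0) := by
        rw [← smul_eq_mul, ← map_smul]; simp
      have h5 : fderiv ℂ f (ψ u p) (u, 0) = (u : ℂ) * fderiv ℂ f (ψ u p) (1, 0) := by
        rw [← smul_eq_mul, ← map_smul]; simp
      have h6 : F' p u (1, 0) = p.1 * fderiv ℂ f (ψ u p) (L u (1, 0)) + f (ψ u p) * 1 := rfl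
      have h7 : L u (1, 0) = ((u : ℂ), 0) := by rw [hLv]; simp [hψ]
      rw [h6, h7, h5]
      simp only [Complex.ofRealCLM_apply, Function.comp, ContinuousLinearMap.coe_restrictScalars', h4,
        Complex.ofReal_one]
      ring
    have hint2 : IntervalIntegrable (fun u => F' p u ((1 : ℂ), (0 : ℂ))) MeasureTheory.volume 0 1 :=
      (slice'.clm_apply continuousOn_const).intervalIntegrable_of_Icc zero_le_one
    have hcont : ContinuousOn (fun u : ℝ => (u : ℂ) * f (ψ u p)) (Icc 0 1) :=
      (by fun_prop : Continuous fun u : ℝ => (u : ℂ)).continuousOn.mul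
        (hfψ.comp (f := fun u : ℝ => (u, p)) (by fun_prop) fun u hu => ⟨hu, hp⟩)
    rw [intervalIntegral.integral_eq_sub_of_hasDerivAt_of_le zero_le_one hcont hder hint2]
    simp [hψ]
  rw [h3] at h2
  exact h2

/-! ### Holomorphic differential equations with a parameter -/

/-- The equation `∂E/∂s = F (s, a, E)`, `E (0, a) = 0`, has a holomorphic solution on the whole of a
domain `Ω` star-shaped in `s`, as soon as `|F| ≤ κ` for `|E| < κ |s| + δ`: this bound prevents the
Picard iterates `E k`, which are primitives along rays, from leaving the domain of `F`. -/
theorem exists_solution_along_rays {Ω : Set (ℂ × ℂ)} (hΩ : IsOpen Ω)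
    (hstar : ∀ p ∈ Ω, ∀ u ∈ Icc (0 : ℝ) 1, ((u : ℂ) * p.1, p.2) ∈ Ω)
    {F : (ℂ × ℂ) × ℂ → ℂ} {κ δ : ℝ} (hκ : 0 ≤ κ) (hδ : 0 < δ)
    (hF : DifferentiableOn ℂ F {q | q.1 ∈ Ω ∧ ‖q.2‖ < κ * ‖q.1.1‖ + δ})
    (hbd : ∀ q : (ℂ × ℂ) × ℂ, q.1 ∈ Ω → ‖q.2‖ < κ * ‖q.1.1‖ + δ → ‖F q‖ ≤ κ) :
    ∃ E : ℂ × ℂ → ℂ, DifferentiableOn ℂ E Ω ∧ (∀ p ∈ Ω, ‖E p‖ ≤ κ * ‖p.1‖) ∧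
      ∀ p ∈ Ω, HasDerivAt (fun s => E (s, p.2)) (F (p, E p)) p.1 := by
  set V : Set ((ℂ × ℂ) × ℂ) := {q | q.1 ∈ Ω ∧ ‖q.2‖ < κ * ‖q.1.1‖ + δ} with hV
  have hlt : IsOpen {q : (ℂ × ℂ) × ℂ | ‖q.2‖ < κ * ‖q.1.1‖ + δ} :=
    isOpen_lt (by fun_prop) (by fun_prop)
  have hVo : IsOpen V := (hΩ.preimage continuous_fst).inter hlt
  -- Cauchy's estimate makes `F` Lipschitz in the unknown
  set ℓ : ℝ := κ / (δ / 2) + 1 with hℓ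
  have hℓ0 : 0 < ℓ := by positivity
  have hlip : ∀ p ∈ Ω, ∀ e e' : ℂ, ‖e‖ ≤ κ * ‖p.1‖ → ‖e'‖ ≤ κ * ‖p.1‖ →
      ‖F (p, e) - F (p, e')‖ ≤ ℓ * ‖e - e'‖ := by
    intro p hp e e' he he'
    have hdiff : ∀ w ∈ Metric.ball (0 : ℂ) (κ * ‖p.1‖ + δ), DifferentiableAt ℂ (fun e => F (p, e)) w := by
      intro w hw
      have : DifferentiableAt ℂ F (p, w) :=
        hF.differentiableAt (hVo.mem_nhds ⟨hp, by simpa using hw⟩)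
      exact DifferentiableAt.comp (g := F) (f := fun e => (p, e)) w this (by fun_prop)
    refine Convex.norm_image_sub_le_of_norm_deriv_le (f := fun e => F (p, e)) (C := ℓ)
      (s := Metric.closedBall 0 (κ * ‖p.1‖)) (fun w hw => ?_) (fun w hw => ?_)
      (convex_closedBall _ _) (by simpa using he') (by simpa using he)
    · exact hdiff w (Metric.closedBall_subset_ball (by linarith) hw)
    · have hw' : ‖w‖ ≤ κ * ‖p.1‖ := by simpa using hw
      have hsub : Metric.closedBall w (δ / 2) ⊆ Metric.ball (0 : ℂ) (κ * ‖p.1‖ + δ) := by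
        intro z hz
        have hz' : ‖z - w‖ ≤ δ / 2 := by simpa [dist_eq_norm] using hz
        have : ‖z‖ ≤ ‖z - w‖ + ‖w‖ := by simpa using norm_add_le (z - w) w
        simp only [Metric.mem_ball, dist_zero_right]
        linarith
      have hd : DifferentiableOn ℂ (fun e => F (p, e)) (Metric.closedBall w (δ / 2)) :=
        fun z hz => (hdiff z (hsub hz)).differentiableWithinAt
      have := Complex.norm_deriv_le_of_forall_mem_sphere_norm_le (C := κ) (half_pos hδ)
        (hd.mono (closure_ball w (half_pos hδ).ne').subset).diffContOnCl
        (fun z hz => hbd (p, z) hp (by simpa using hsub (Metric.sphere_subset_closedBall hz)))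
      linarith
  set ψ : ℝ → ℂ × ℂ → ℂ × ℂ := fun u p => ((u : ℂ) * p.1, p.2) with hψ
  set E : ℕ → ℂ × ℂ → ℂ := fun k => Nat.rec (fun _ => 0)
    (fun _ e p => ∫ u in (0 : ℝ)..1, p.1 * F (ψ u p, e (ψ u p))) k with hE
  have hE0 : ∀ p, E 0 p = 0 := fun p => rfl
  have hEs : ∀ k p, E (k + 1) p = ∫ u in (0 : ℝ)..1, p.1 * F (ψ u p, E k (ψ u p)) := fun k p => rfl
  have hψn : ∀ u ∈ Icc (0 : ℝ) 1, ∀ p, ‖(ψ u p).1‖ = u * ‖p.1‖ := by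
    intro u hu p
    simp [hψ, abs_of_nonneg hu.1]
  have hgood : ∀ k, DifferentiableOn ℂ (E k) Ω ∧ ∀ p ∈ Ω, ‖E k p‖ ≤ κ * ‖p.1‖ := by
    intro k
    induction k with
    | zero => exact ⟨differentiableOn_const 0, fun p _ => by rw [hE0, norm_zero]; positivity⟩
    | succ k ih =>
      have hcomp : DifferentiableOn ℂ (fun p => F (p, E k p)) Ω :=
        hF.comp (differentiableOn_id.prodMk ih.1) fun p hp =>
          ⟨hp, (ih.2 p hp).trans_lt (lt_add_of_pos_right _ hδ)⟩
      refine ⟨(primitive_along_rays hΩ hstar hcomp).1, fun p hp => ?_⟩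
      rw [hEs]
      have := intervalIntegral.norm_integral_le_of_norm_le_const (a := (0 : ℝ)) (b := 1)
        (f := fun u => p.1 * F (ψ u p, E k (ψ u p))) (C := κ * ‖p.1‖) (fun u hu => by
          rw [uIoc_of_le zero_le_one] at hu
          have hu' := Ioc_subset_Icc_self hu
          have hm := hstar p hp u hu'
          rw [norm_mul, mul_comm]
          exact mul_le_mul_of_nonneg_right (hbd _ hm ((ih.2 _ hm).trans_lt
            (lt_add_of_pos_right _ hδ))) (norm_nonneg _))
      simpa using this
  have hcomp : ∀ k, DifferentiableOn ℂ (fun p => F (p, E k p)) Ω := fun k =>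
    hF.comp (differentiableOn_id.prodMk (hgood k).1) fun p hp =>
      ⟨hp, ((hgood k).2 p hp).trans_lt (lt_add_of_pos_right _ hδ)⟩
  have hprim := fun k => primitive_along_rays hΩ hstar (hcomp k)
  have hray : ∀ k, ∀ p ∈ Ω, ContinuousOn (fun u : ℝ => p.1 * F (ψ u p, E k (ψ u p))) (Icc 0 1) := by
    intro k p hp
    refine continuousOn_const.mul ((hcomp k).continuousOn.comp (f := fun u : ℝ => ψ u p) ?_ ?_)
    · simp only [hψ]; fun_prop
    · exact fun u hu => hstar p hp u hu
  -- for the weight `exp (2 ℓ |s|)` each iteration contracts by `1 / 2`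
  set C : ℝ := κ / (2 * ℓ) with hC
  have hC0 : 0 ≤ C := by positivity
  have hstep : ∀ k, ∀ p ∈ Ω, ‖E (k + 1) p - E k p‖ ≤ C * (1 / 2) ^ k * Real.exp (2 * ℓ * ‖p.1‖) := by
    intro k
    induction k with
    | zero =>
      intro p hp
      rw [hE0, sub_zero, pow_zero, mul_one]
      refine ((hgood 1).2 p hp).trans ?_
      have h1 : 2 * ℓ * ‖p.1‖ ≤ Real.exp (2 * ℓ * ‖p.1‖) :=
        (by linarith [Real.add_one_le_exp (2 * ℓ * ‖p.1‖)])
      calc κ * ‖p.1‖ = C * (2 * ℓ * ‖p.1‖) := by rw [hC]; field_simp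
        _ ≤ _ := mul_le_mul_of_nonneg_left h1 hC0
    | succ k ih =>
      intro p hp
      rw [hEs (k + 1), hEs k, ← intervalIntegral.integral_sub
        ((hray (k + 1) p hp).intervalIntegrable_of_Icc zero_le_one)
        ((hray k p hp).intervalIntegrable_of_Icc zero_le_one)]
      set c : ℝ := 2 * ℓ * ‖p.1‖ with hc
      set g : ℝ → ℝ := fun u => C * (1 / 2) ^ (k + 1) * (c * Real.exp (c * u)) with hg
      have hgd : ∀ u : ℝ, HasDerivAt (fun u => C * (1 / 2) ^ (k + 1) * Real.exp (c * u)) (g u) u := by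
        intro u
        have : HasDerivAt (fun u : ℝ => Real.exp (c * u)) (Real.exp (c * u) * c) u := by
          simpa using ((hasDerivAt_id u).const_mul c).exp
        simpa [hg, mul_comm] using this.const_mul (C * (1 / 2) ^ (k + 1))
      have hgc : Continuous g := by simp only [hg]; fun_prop
      have hle : ‖∫ u in (0 : ℝ)..1, (p.1 * F (ψ u p, E (k + 1) (ψ u p)) -
          p.1 * F (ψ u p, E k (ψ u p)))‖ ≤ ∫ u in (0 : ℝ)..1, g u := by
        refine intervalIntegral.norm_integral_le_of_norm_le zero_le_one
          (Eventually.of_forall fun u hu => ?_) (hgc.intervalIntegrable 0 1)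
        have hu' := Ioc_subset_Icc_self hu
        have hm := hstar p hp u hu'
        have e1 := hlip (ψ u p) hm _ _ ((hgood (k + 1)).2 _ hm) ((hgood k).2 _ hm)
        have e2 := ih (ψ u p) hm
        rw [hψn u hu' p] at e2
        rw [← mul_sub, norm_mul]
        calc ‖p.1‖ * ‖F (ψ u p, E (k + 1) (ψ u p)) - F (ψ u p, E k (ψ u p))‖
            ≤ ‖p.1‖ * (ℓ * (C * (1 / 2) ^ k * Real.exp (2 * ℓ * (u * ‖p.1‖)))) := by gcongr; exact e1.trans (by gcongr)
          _ = g u := by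
            simp only [hg, hc]
            rw [show 2 * ℓ * (u * ‖p.1‖) = 2 * ℓ * ‖p.1‖ * u by ring]
            ring
      refine hle.trans ?_
      rw [intervalIntegral.integral_eq_sub_of_hasDerivAt (fun u _ => hgd u)
        (hgc.intervalIntegrable 0 1)]
      have : 0 ≤ C * (1 / 2) ^ (k + 1) * Real.exp (c * 0) := by positivity
      simp only [mul_one]
      linarith
  -- the limit
  set B : ℂ × ℂ → ℝ := fun p => C * Real.exp (2 * ℓ * ‖p.1‖) with hB
  have hgeo : ∀ p ∈ Ω, ∀ k, dist (E k p) (E (k + 1) p) ≤ B p * (1 / 2) ^ k := by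
    intro p hp k
    rw [dist_comm, dist_eq_norm]
    refine (hstep k p hp).trans_eq ?_
    simp only [hB]; ring
  have hlim : ∀ p ∈ Ω, ∃ e, Tendsto (fun k => E k p) atTop (𝓝 e) := fun p hp =>
    cauchySeq_tendsto_of_complete (cauchySeq_of_le_geometric (1 / 2) (B p) (by norm_num) (hgeo p hp))
  choose! Einf hEinf using hlim
  have htail : ∀ p ∈ Ω, ∀ k, dist (E k p) (Einf p) ≤ B p * (1 / 2) ^ k / (1 - 1 / 2) := fun p hp k =>
    dist_le_of_le_geometric_of_tendsto (1 / 2) (B p) (by norm_num) (hgeo p hp) (hEinf p hp) k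
  have hunif : TendstoLocallyUniformlyOn E Einf atTop Ω := by
    rw [Metric.tendstoLocallyUniformlyOn_iff]
    intro ε hε p hp
    set M : ℝ := C * Real.exp (2 * ℓ * (‖p.1‖ + 1)) with hM
    have hMlim : Tendsto (fun k : ℕ => M * (1 / 2 : ℝ) ^ k / (1 - 1 / 2)) atTop (𝓝 0) := by
      have := ((tendsto_pow_atTop_nhds_zero_of_lt_one (r := (1 / 2 : ℝ)) (by norm_num)
        (by norm_num)).const_mul M).div_const (1 - 1 / 2)
      simpa using this
    refine ⟨Ω ∩ Metric.ball p 1, inter_mem self_mem_nhdsWithin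
      (mem_nhdsWithin_of_mem_nhds (Metric.ball_mem_nhds p one_pos)), ?_⟩
    filter_upwards [hMlim.eventually (gt_mem_nhds hε)] with k hk q hq
    rw [dist_comm]
    refine (htail q hq.1 k).trans_lt (lt_of_le_of_lt ?_ hk)
    have h1 : ‖q.1‖ ≤ ‖p.1‖ + 1 := by
      have h2 : dist q.1 p.1 < 1 := (le_max_left _ _).trans_lt hq.2
      rw [dist_eq_norm] at h2
      have : ‖q.1‖ ≤ ‖q.1 - p.1‖ + ‖p.1‖ := by simpa using norm_add_le (q.1 - p.1) p.1
      linarith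
    have : B q ≤ M := by
      simp only [hB, hM]; gcongr
    gcongr
  have hcont : ContinuousOn Einf Ω :=
    hunif.continuousOn (Frequently.of_forall fun k => (hgood k).1.continuousOn)
  have hbound : ∀ p ∈ Ω, ‖Einf p‖ ≤ κ * ‖p.1‖ := fun p hp =>
    le_of_tendsto (hEinf p hp).norm (Eventually.of_forall fun k => (hgood k).2 p hp)
  have hslice1 : ∀ a, IsOpen {s : ℂ | (s, a) ∈ Ω} := fun a => hΩ.preimage (by fun_prop)
  have hslice2 : ∀ s, IsOpen {a : ℂ | (s, a) ∈ Ω} := fun s => hΩ.preimage (by fun_prop)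
  have hunif1 : ∀ a, TendstoLocallyUniformlyOn (fun k s => E k (s, a)) (fun s => Einf (s, a)) atTop
      {s : ℂ | (s, a) ∈ Ω} := fun a =>
    hunif.comp (fun s => (s, a)) (fun s hs => hs) (by fun_prop)
  have hunif2 : ∀ s, TendstoLocallyUniformlyOn (fun k a => E k (s, a)) (fun a => Einf (s, a)) atTop
      {a : ℂ | (s, a) ∈ Ω} := fun s =>
    hunif.comp (fun a => (s, a)) (fun s hs => hs) (by fun_prop)
  have hd1 : ∀ k a, DifferentiableOn ℂ (fun s => E k (s, a)) {s : ℂ | (s, a) ∈ Ω} := fun k a =>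
    (hgood k).1.comp (by fun_prop) fun s hs => hs
  have hd2 : ∀ k s, DifferentiableOn ℂ (fun a => E k (s, a)) {a : ℂ | (s, a) ∈ Ω} := fun k s =>
    (hgood k).1.comp (by fun_prop) fun s hs => hs
  have hD1 := fun a => (hunif1 a).differentiableOn (Eventually.of_forall fun k => hd1 k a) (hslice1 a)
  have hD2 := fun s => (hunif2 s).differentiableOn (Eventually.of_forall fun k => hd2 k s) (hslice2 s)
  refine ⟨Einf, ?_, hbound, ?_⟩
  · exact (contDiffOn_of_separately hΩ hcont
      (fun p hp => (hD1 p.2).differentiableAt ((hslice1 p.2).mem_nhds hp))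
      (fun p hp => (hD2 p.1).differentiableAt ((hslice2 p.1).mem_nhds hp))).differentiableOn one_ne_zero
  · intro p hp
    have h1 : HasDerivAt (fun s => Einf (s, p.2)) (deriv (fun s => Einf (s, p.2)) p.1) p.1 :=
      ((hD1 p.2).differentiableAt ((hslice1 p.2).mem_nhds hp)).hasDerivAt
    have h2 := ((hunif1 p.2).deriv (Eventually.of_forall fun k => hd1 k p.2) (hslice1 p.2)).tendsto_at
      (a := p.1) hp
    have h3 : ∀ k, deriv (fun s => E (k + 1) (s, p.2)) p.1 = F (p, E k p) := fun k =>
      ((hprim k).2 p hp).deriv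
    have h4 : Tendsto (fun k => F (p, E k p)) atTop (𝓝 (F (p, Einf p))) := by
      have hFc : ContinuousAt F (p, Einf p) := (hF.differentiableAt (hVo.mem_nhds
        ⟨hp, (hbound p hp).trans_lt (lt_add_of_pos_right _ hδ)⟩)).continuousAt
      exact hFc.tendsto.comp (tendsto_const_nhds.prodMk_nhds (hEinf p hp))
    have h5 := h2.comp (tendsto_add_atTop_nat 1)
    have h6 := tendsto_nhds_unique (h5.congr fun k => h3 k) h4
    rw [← h6]
    exact h1

/-! ### The flow of the foliation -/

theorem eqOn_of_hasDerivAt_zero_off_finite {g : ℝ → ℂ} {a b : ℝ} (hc : ContinuousOn g (Icc a b))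
    {s : Set ℝ} (hs : s.Finite) (hd : ∀ t ∈ Ioo a b \ s, HasDerivAt g 0 t) :
    ∀ t ∈ Icc a b, g t = g a := by
  intro t ht
  have := MeasureTheory.integral_eq_of_hasDerivAt_off_countable_of_le g (fun _ => (0 : ℂ)) ht.1
    hs.countable (hc.mono (Icc_subset_Icc_right ht.2))
    (fun x hx => hd x ⟨⟨hx.1.1, hx.1.2.trans_le ht.2⟩, hx.2⟩) (by simp)
  rw [intervalIntegral.integral_zero] at this
  exact (sub_eq_zero.1 this.symm)

theorem exists_local_inverse {f : ℂ → ℂ} {f' a : ℂ} (hf : HasStrictDerivAt f f' a) (hf' : f' ≠ 0) :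
    ∃ g : ℂ → ℂ, g (f a) = a ∧ HasStrictDerivAt g f'⁻¹ (f a) ∧ (∀ᶠ x in 𝓝 a, g (f x) = x) ∧
      ∀ᶠ y in 𝓝 (f a), f (g y) = y :=
  ⟨hf.localInverse f f' a hf', (hf.hasStrictFDerivAt_equiv hf').localInverse_apply_image,
    hf.to_localInverse hf', (hf.hasStrictFDerivAt_equiv hf').eventually_left_inverse,
    (hf.hasStrictFDerivAt_equiv hf').eventually_right_inverse⟩

namespace PreparedSaddle

variable (S : PreparedSaddle)

/-- The perturbation term `x^n y K(x, y)`. -/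
def pert (p : ℂ × ℂ) : ℂ := p.1 ^ S.n * p.2 * S.K p

theorem X_def (p : ℂ × ℂ) : S.X p = (p.1, -((S.lam : ℂ) * p.2 * (1 + S.pert p))) := rfl

theorem differentiableOn_pert : DifferentiableOn ℂ S.pert S.U := by
  unfold pert
  exact DifferentiableOn.mul (by fun_prop) S.holo_K

/-- Complex flow of the field along a family of starting points `(x a, y a)`. Its first component is
`x a * exp s`; the second one is sought as `y a * exp (-λ s + E)`, where `E` is then driven by the
perturbation term alone. -/
theorem exists_flow {Ω : Set (ℂ × ℂ)} (hΩ : IsOpen Ω)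
    (hstar : ∀ p ∈ Ω, ∀ u ∈ Icc (0 : ℝ) 1, ((u : ℂ) * p.1, p.2) ∈ Ω) {x y : ℂ → ℂ}
    (hx : ∀ p ∈ Ω, DifferentiableAt ℂ x p.2) (hy : ∀ p ∈ Ω, DifferentiableAt ℂ y p.2)
    {κ δ : ℝ} (hκ : 0 ≤ κ) (hδ : 0 < δ)
    (hU : ∀ p ∈ Ω, ∀ e : ℂ, ‖e‖ < κ * ‖p.1‖ + δ →
      (x p.2 * Complex.exp p.1, y p.2 * Complex.exp (-S.lam * p.1 + e)) ∈ S.U ∧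
      S.lam * ‖S.pert (x p.2 * Complex.exp p.1, y p.2 * Complex.exp (-S.lam * p.1 + e))‖ ≤ κ) :
    ∃ Y : ℂ × ℂ → ℂ, DifferentiableOn ℂ Y Ω ∧ ∀ p ∈ Ω,
      (x p.2 * Complex.exp p.1, Y p) ∈ S.U ∧
      (∃ e : ℂ, ‖e‖ ≤ κ * ‖p.1‖ ∧ Y p = y p.2 * Complex.exp (-S.lam * p.1 + e)) ∧
      HasDerivAt (fun s => Y (s, p.2)) (S.X (x p.2 * Complex.exp p.1, Y p)).2 p.1 := by
  set m : (ℂ × ℂ) × ℂ → ℂ × ℂ := fun q =>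
    (x q.1.2 * Complex.exp q.1.1, y q.1.2 * Complex.exp (-S.lam * q.1.1 + q.2)) with hm
  set F : (ℂ × ℂ) × ℂ → ℂ := fun q => -(S.lam * S.pert (m q)) with hF
  have hFd : DifferentiableOn ℂ F {q | q.1 ∈ Ω ∧ ‖q.2‖ < κ * ‖q.1.1‖ + δ} := by
    have hmd : DifferentiableOn ℂ m {q | q.1 ∈ Ω ∧ ‖q.2‖ < κ * ‖q.1.1‖ + δ} := by
      intro q hq
      have h1 : DifferentiableAt ℂ (fun q : (ℂ × ℂ) × ℂ => x q.1.2) q :=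
        DifferentiableAt.comp (g := x) (f := fun q : (ℂ × ℂ) × ℂ => q.1.2) q (hx q.1 hq.1) (by fun_prop)
      have h2 : DifferentiableAt ℂ (fun q : (ℂ × ℂ) × ℂ => y q.1.2) q :=
        DifferentiableAt.comp (g := y) (f := fun q : (ℂ × ℂ) × ℂ => q.1.2) q (hy q.1 hq.1) (by fun_prop)
      have h3 : DifferentiableAt ℂ (fun q : (ℂ × ℂ) × ℂ => Complex.exp q.1.1) q := by fun_prop
      have h4 : DifferentiableAt ℂ (fun q : (ℂ × ℂ) × ℂ => Complex.exp (-S.lam * q.1.1 + q.2)) q := by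
        fun_prop
      exact ((h1.mul h3).prodMk (h2.mul h4)).differentiableWithinAt
    exact ((S.differentiableOn_pert.comp hmd fun q hq => (hU q.1 hq.1 q.2 hq.2).1).const_mul _).neg
  obtain ⟨E, hEd, hEb, hE'⟩ := exists_solution_along_rays hΩ hstar hκ hδ hFd (fun q h1 h2 => by
    have := (hU q.1 h1 q.2 h2).2
    simpa [hF, hm, abs_of_pos S.lam_pos] using this)
  refine ⟨fun p => y p.2 * Complex.exp (-S.lam * p.1 + E p), ?_, fun p hp => ⟨?_, ?_, ?_⟩⟩
  · intro p hp
    have h1 : DifferentiableAt ℂ (fun p : ℂ × ℂ => y p.2) p :=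
      DifferentiableAt.comp (g := y) (f := fun q : ℂ × ℂ => q.2) p (hy p hp) (by fun_prop)
    have h2 : DifferentiableAt ℂ E p := hEd.differentiableAt (hΩ.mem_nhds hp)
    have h3 : DifferentiableAt ℂ (fun p : ℂ × ℂ => -S.lam * p.1 + E p) p :=
      DifferentiableAt.add (by fun_prop) h2
    exact (h1.mul h3.cexp).differentiableWithinAt
  · exact (hU p hp (E p) ((hEb p hp).trans_lt (lt_add_of_pos_right _ hδ))).1
  · exact ⟨E p, hEb p hp, rfl⟩
  · have h1 : HasDerivAt (fun s => -(S.lam : ℂ) * s + E (s, p.2)) (-S.lam + F (p, E p)) p.1 := by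
      exact (((hasDerivAt_id' p.1).const_mul (-(S.lam : ℂ))).fun_add (hE' p hp)).congr_deriv (by simp)
    refine (h1.cexp.const_mul (y p.2)).congr_deriv ?_
    simp only [X_def, hF, hm]
    ring

theorem flow_hasDerivAt {x : ℂ} {Y : ℂ × ℂ → ℂ} {p : ℂ × ℂ}
    (h : HasDerivAt (fun s => Y (s, p.2)) (S.X (x * Complex.exp p.1, Y p)).2 p.1) :
    HasDerivAt (fun s => (x * Complex.exp s, Y (s, p.2))) (S.X (x * Complex.exp p.1, Y p)) p.1 := by
  have h1 : HasDerivAt (fun s => x * Complex.exp s) (x * Complex.exp p.1) p.1 :=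
    (Complex.hasDerivAt_exp p.1).const_mul x
  exact h1.prodMk h

/-- A flow box at a point `p₀` where the field does not vanish: `Fl (s, b)` is the flow for the time
`s` from the point `b` of a line transverse to the field, and `G` is its inverse, whose second
component is a first integral. The plaque of `p₀` is parametrized by `s ↦ Fl (s, 0)`, with velocity
`X p₀` at `0`. -/
theorem exists_flowBox {p₀ : ℂ × ℂ} (hp₀ : p₀ ∈ S.U) (hX : S.X p₀ ≠ 0) :
    ∃ Fl G : ℂ × ℂ → ℂ × ℂ, G p₀ = 0 ∧ ContinuousAt G p₀ ∧ (∀ᶠ p in 𝓝 p₀, Fl (G p) = p) ∧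
      (∀ᶠ p in 𝓝 p₀, ∃ G' : ℂ × ℂ →L[ℂ] ℂ × ℂ, HasFDerivAt G G' p ∧ (G' (S.X p)).2 = 0) ∧
      HasStrictDerivAt (fun s => (Fl (s, 0)).1) (S.X p₀).1 0 ∧
      HasStrictDerivAt (fun s => (Fl (s, 0)).2) (S.X p₀).2 0 ∧ Fl 0 = p₀ := by
  -- a direction transverse to the field
  obtain ⟨u, hu⟩ : ∃ u : ℂ × ℂ, ∀ s b : ℂ, s • S.X p₀ + b • u = 0 → s = 0 ∧ b = 0 := by
    by_cases h1 : (S.X p₀).1 = 0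
    · have h2 : (S.X p₀).2 ≠ 0 := fun h2 => hX (Prod.ext h1 h2)
      refine ⟨(1, 0), fun s b h => ?_⟩
      have e1 := congrArg Prod.fst h
      have e2 := congrArg Prod.snd h
      simp [h1, h2] at e1 e2
      exact ⟨e2, e1⟩
    · refine ⟨(0, 1), fun s b h => ?_⟩
      have e1 := congrArg Prod.fst h
      have e2 := congrArg Prod.snd h
      simp [h1] at e1 e2
      exact ⟨e1, by simpa [e1] using e2⟩
  set x : ℂ → ℂ := fun b => p₀.1 + b * u.1 with hx
  set y : ℂ → ℂ := fun b => p₀.2 + b * u.2 with hy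
  set κ : ℝ := S.lam * ‖S.pert p₀‖ + 1 with hκ
  have hκ0 : 0 < κ := by have := S.lam_pos; positivity
  set m : (ℂ × ℂ) × ℂ → ℂ × ℂ := fun q =>
    (x q.1.2 * Complex.exp q.1.1, y q.1.2 * Complex.exp (-S.lam * q.1.1 + q.2)) with hm
  have hmc : Continuous m := by simp only [hm, hx, hy]; fun_prop
  have hm0 : m 0 = p₀ := by simp [hm, hx, hy]
  have hev : ∀ᶠ q in 𝓝 (0 : (ℂ × ℂ) × ℂ), m q ∈ S.U ∧ S.lam * ‖S.pert (m q)‖ ≤ κ := by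
    have hU : S.U ∈ 𝓝 (m 0) := by rw [hm0]; exact S.isOpen_U.mem_nhds hp₀
    have h1 : ∀ᶠ q in 𝓝 (0 : (ℂ × ℂ) × ℂ), m q ∈ S.U := hmc.continuousAt.eventually hU
    have hpc : ContinuousAt (fun q => S.lam * ‖S.pert (m q)‖) 0 := by
      have : ContinuousAt S.pert (m 0) := (S.differentiableOn_pert.differentiableAt hU).continuousAt
      exact ((this.comp hmc.continuousAt).norm).const_mul _
    have h2 : ∀ᶠ q in 𝓝 (0 : (ℂ × ℂ) × ℂ), S.lam * ‖S.pert (m q)‖ < κ :=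
      hpc.eventually (gt_mem_nhds (by
        change S.lam * ‖S.pert (m 0)‖ < κ
        rw [hm0, hκ]; linarith))
    filter_upwards [h1, h2] with q a b using ⟨a, b.le⟩
  obtain ⟨ρ, hρ, hball⟩ := Metric.eventually_nhds_iff_ball.1 hev
  set r : ℝ := min ρ (ρ / (2 * κ)) with hr
  have hr0 : 0 < r := by positivity
  set Ω : Set (ℂ × ℂ) := Metric.ball 0 r with hΩ
  have hmemΩ : ∀ p : ℂ × ℂ, p ∈ Ω ↔ ‖p.1‖ < r ∧ ‖p.2‖ < r := fun p => by
    simp [hΩ, Prod.norm_def]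
  have hstar : ∀ p ∈ Ω, ∀ v ∈ Icc (0 : ℝ) 1, ((v : ℂ) * p.1, p.2) ∈ Ω := by
    intro p hp v hv
    rw [hmemΩ] at hp ⊢
    refine ⟨lt_of_le_of_lt ?_ hp.1, hp.2⟩
    simp only [norm_mul, Complex.norm_real, Real.norm_eq_abs, abs_of_nonneg hv.1]
    exact mul_le_of_le_one_left (norm_nonneg _) hv.2
  obtain ⟨Y, hYd, hY⟩ := S.exists_flow (Ω := Ω) Metric.isOpen_ball hstar (x := x) (y := y)
    (fun p _ => by simp only [hx]; fun_prop) (fun p _ => by simp only [hy]; fun_prop)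
    hκ0.le (half_pos hρ) (by
      intro p hp e he
      rw [hmemΩ] at hp
      have h1 : κ * ‖p.1‖ ≤ ρ / 2 := by
        have : ‖p.1‖ ≤ ρ / (2 * κ) := hp.1.le.trans (min_le_right _ _)
        calc κ * ‖p.1‖ ≤ κ * (ρ / (2 * κ)) := by gcongr
          _ = ρ / 2 := by field_simp
      refine hball (p, e) ?_
      simp only [Metric.mem_ball, dist_zero_right, Prod.norm_def, sup_lt_iff]
      exact ⟨⟨hp.1.trans_le (min_le_left _ _), hp.2.trans_le (min_le_left _ _)⟩, by linarith⟩)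
  set Fl : ℂ × ℂ → ℂ × ℂ := fun q => (x q.2 * Complex.exp q.1, Y q) with hFl
  have hΩo : IsOpen Ω := Metric.isOpen_ball
  have h0Ω : (0 : ℂ × ℂ) ∈ Ω := Metric.mem_ball_self hr0
  have hY0 : ∀ b, ‖b‖ < r → Y (0, b) = y b := by
    intro b hb
    obtain ⟨e, he, h⟩ := (hY (0, b) ((hmemΩ _).2 ⟨by simpa using hr0, hb⟩)).2.1
    have : e = 0 := by simpa using he
    simpa [this] using h
  have hFl0 : Fl 0 = p₀ := by
    have : Y 0 = p₀.2 := (hY0 0 (by simpa using hr0)).trans (by simp [hy])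
    simp [hFl, hx, this]
  have hFlC : ContDiffOn ℂ 1 Fl Ω := by
    refine ContDiffOn.prodMk ?_ (contDiffOn_of_differentiableOn hΩo hYd)
    refine (ContDiff.mul ?_ ?_).contDiffOn
    · simp only [hx]; fun_prop
    · exact Complex.contDiff_exp.comp contDiff_fst
  have hFlAt : ContDiffAt ℂ 1 Fl 0 := hFlC.contDiffAt (hΩo.mem_nhds h0Ω)
  have hFls : ∀ p ∈ Ω, HasDerivAt (fun s => Fl (s, p.2)) (S.X (Fl p)) p.1 := fun p hp =>
    S.flow_hasDerivAt (hY p hp).2.2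
  -- the derivative of the flow at the origin
  have hpart1 : fderiv ℂ Fl 0 (1, 0) = S.X p₀ := by
    have h1 := (hFlAt.differentiableAt one_ne_zero).hasFDerivAt
    have h2 : HasDerivAt (fun s : ℂ => (s, (0 : ℂ))) (1, 0) 0 :=
      (hasDerivAt_id 0).prodMk (hasDerivAt_const _ _)
    have h3 := HasFDerivAt.comp_hasDerivAt (f := fun s : ℂ => (s, (0 : ℂ))) 0 h1 h2
    have h4 := h3.unique (hFls 0 h0Ω)
    rwa [hFl0] at h4
  have hpart2 : fderiv ℂ Fl 0 (0, 1) = u := by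
    have h1 := (hFlAt.differentiableAt one_ne_zero).hasFDerivAt
    have h2 : HasDerivAt (fun s : ℂ => ((0 : ℂ), s)) (0, 1) 0 :=
      (hasDerivAt_const _ _).prodMk (hasDerivAt_id 0)
    have h3 := HasFDerivAt.comp_hasDerivAt (f := fun s : ℂ => ((0 : ℂ), s)) 0 h1 h2
    have h4 : HasDerivAt (fun b : ℂ => (x b, y b)) (u.1, u.2) 0 := by
      have e1 : HasDerivAt x u.1 0 := by
        simpa [hx] using ((hasDerivAt_id (0 : ℂ)).mul_const u.1).const_add p₀.1
      have e2 : HasDerivAt y u.2 0 := by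
        simpa [hy] using ((hasDerivAt_id (0 : ℂ)).mul_const u.2).const_add p₀.2
      exact e1.prodMk e2
    refine h3.unique (h4.congr_of_eventuallyEq ?_)
    filter_upwards [Metric.ball_mem_nhds (0 : ℂ) hr0] with b hb
    simp [hFl, hY0 b (by simpa using hb)]
  have hlin : ∀ q : ℂ × ℂ, fderiv ℂ Fl 0 q = q.1 • S.X p₀ + q.2 • u := by
    intro q
    have : q = q.1 • ((1 : ℂ), (0 : ℂ)) + q.2 • ((0 : ℂ), (1 : ℂ)) := by simp
    conv_lhs => rw [this]
    rw [map_add, map_smul, map_smul, hpart1, hpart2]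
  have hinj : Function.Injective (fderiv ℂ Fl 0) := by
    rw [injective_iff_map_eq_zero]
    intro q hq
    rw [hlin] at hq
    obtain ⟨h1, h2⟩ := hu _ _ hq
    exact Prod.ext h1 h2
  set Le : (ℂ × ℂ) ≃L[ℂ] ℂ × ℂ :=
    (LinearEquiv.ofInjectiveEndo (fderiv ℂ Fl 0 : ℂ × ℂ →ₗ[ℂ] ℂ × ℂ) hinj).toContinuousLinearEquiv with hLe
  have hLe' : (Le : ℂ × ℂ →L[ℂ] ℂ × ℂ) = fderiv ℂ Fl 0 := by
    ext <;> rfl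
  have hst : HasStrictFDerivAt Fl (Le : ℂ × ℂ →L[ℂ] ℂ × ℂ) 0 := by
    rw [hLe']; exact hFlAt.hasStrictFDerivAt one_ne_zero
  have hfd : HasFDerivAt Fl (Le : ℂ × ℂ →L[ℂ] ℂ × ℂ) 0 := hst.hasFDerivAt
  set G := hFlAt.localInverse hfd one_ne_zero with hG
  have hGC : ContDiffAt ℂ 1 G p₀ := by
    have := hFlAt.to_localInverse hfd one_ne_zero
    rwa [hFl0] at this
  have hG0 : G p₀ = 0 := by
    have := hFlAt.localInverse_apply_image hfd one_ne_zero
    rwa [hFl0] at this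
  have hst' := hFlAt.hasStrictFDerivAt' hfd one_ne_zero
  have hGr : ∀ᶠ p in 𝓝 p₀, Fl (G p) = p := by
    have := hst'.eventually_right_inverse
    rwa [hFl0] at this
  have hGl : ∀ᶠ q in 𝓝 (0 : ℂ × ℂ), G (Fl q) = q := hst'.eventually_left_inverse
  have hstrict : ∀ L : ℂ × ℂ →L[ℂ] ℂ, HasStrictDerivAt (fun s => L (Fl (s, 0))) (L (S.X p₀)) 0 := by
    intro L
    have h2 : HasStrictDerivAt (fun s : ℂ => (s, (0 : ℂ))) (1, 0) 0 :=
      (hasStrictDerivAt_id 0).prodMk (hasStrictDerivAt_const _ _)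
    have h3 := HasStrictFDerivAt.comp_hasStrictDerivAt (f := fun s : ℂ => (s, (0 : ℂ))) 0
      (hFlAt.hasStrictFDerivAt one_ne_zero) h2
    rw [hpart1] at h3
    exact HasStrictFDerivAt.comp_hasStrictDerivAt 0 L.hasStrictFDerivAt h3
  refine ⟨Fl, G, hG0, hGC.continuousAt, hGr, ?_, hstrict (ContinuousLinearMap.fst ℂ ℂ ℂ),
    hstrict (ContinuousLinearMap.snd ℂ ℂ ℂ), hFl0⟩
  have hGtend : Tendsto G (𝓝 p₀) (𝓝 0) := by
    have := hGC.continuousAt.tendsto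
    rwa [hG0] at this
  filter_upwards [hGr, hGtend.eventually hGl.eventually_nhds, hGtend.eventually (hΩo.mem_nhds h0Ω),
    hGC.eventually (by simp)] with p h1 h2 h3 h4
  have hGd : HasFDerivAt G (fderiv ℂ G p) p := (h4.differentiableAt one_ne_zero).hasFDerivAt
  refine ⟨fderiv ℂ G p, hGd, ?_⟩
  have h5 := hFls (G p) h3
  have h6 : HasFDerivAt G (fderiv ℂ G p) (Fl ((G p).1, (G p).2)) := by
    rw [Prod.mk.eta, h1]; exact hGd
  have h7 := h6.comp_hasDerivAt (G p).1 h5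
  have h8 : HasDerivAt (fun s : ℂ => (s, (G p).2)) (1, 0) (G p).1 :=
    (hasDerivAt_id _).prodMk (hasDerivAt_const _ _)
  have h9 : (G ∘ fun s => Fl (s, (G p).2)) =ᶠ[𝓝 (G p).1] fun s => (s, (G p).2) := by
    have : Tendsto (fun s : ℂ => (s, (G p).2)) (𝓝 (G p).1) (𝓝 (G p)) :=
      (by fun_prop : Continuous fun s : ℂ => (s, (G p).2)).tendsto' _ _ rfl
    exact this.eventually h2
  have h10 := h7.unique (h8.congr_of_eventuallyEq h9)
  rw [h1] at h10
  rw [h10]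

end PreparedSaddle

/-! ### Uniqueness of leaf paths -/

namespace PreparedSaddle

variable (S : PreparedSaddle)

/-- Paths in a leaf, parametrized by `[a, b]`. Unlike in `IsLeafPath`, the origin is allowed. -/
def LeafOn (c : ℝ → ℂ × ℂ) (a b : ℝ) : Prop :=
  ContinuousOn c (Icc a b) ∧ (∀ t ∈ Icc a b, c t ∈ S.U) ∧
    ∃ s : Set ℝ, s.Finite ∧ ∀ t ∈ Ioo a b \ s, ∃ k : ℂ, HasDerivAt c (k • S.X (c t)) t

variable {S}

theorem IsLeafPath.leafOn {c : ℝ → ℂ × ℂ} (h : S.IsLeafPath c) : S.LeafOn c 0 1 :=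
  ⟨h.1, fun t ht => (h.2.1 t ht).1, h.2.2⟩

theorem LeafOn.mono {c : ℝ → ℂ × ℂ} {a b a' b' : ℝ} (h : S.LeafOn c a b) (ha : a ≤ a')
    (hb : b' ≤ b) : S.LeafOn c a' b' := by
  obtain ⟨h1, h2, s, hs, h3⟩ := h
  exact ⟨h1.mono (Icc_subset_Icc ha hb), fun t ht => h2 t (Icc_subset_Icc ha hb ht), s, hs,
    fun t ht => h3 t ⟨Ioo_subset_Ioo ha hb ht.1, ht.2⟩⟩

theorem pert_zero_left (y : ℂ) : S.pert (0, y) = 0 := by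
  simp [pert, zero_pow S.n_pos.ne']

theorem X_zero_left (y : ℂ) : S.X (0, y) = (0, -(S.lam * y)) := by
  rw [X_def, pert_zero_left]; simp

theorem lam_ne : (S.lam : ℂ) ≠ 0 := by exact_mod_cast S.lam_pos.ne'

/-- Two leaf paths with the same origin agree for small times if they have the same projection to an
axis on which the leaf projects diffeomorphically: both stay in the plaque of the origin. -/
theorem LeafOn.local_unique {c₁ c₂ : ℝ → ℂ × ℂ} {a b : ℝ} (hab : a < b) (h₁ : S.LeafOn c₁ a b)
    (h₂ : S.LeafOn c₂ a b) (h0 : c₁ a = c₂ a)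
    (hcase : ((c₁ a).1 ≠ 0 ∧ ∀ t ∈ Icc a b, (c₁ t).1 = (c₂ t).1) ∨
      ((S.X (c₁ a)).2 ≠ 0 ∧ ∀ t ∈ Icc a b, (c₁ t).2 = (c₂ t).2)) :
    ∀ᶠ t in 𝓝[>] a, c₁ t = c₂ t := by
  set p₀ := c₁ a with hp₀
  have haI : a ∈ Icc a b := left_mem_Icc.2 hab.le
  have hX : S.X p₀ ≠ 0 := by
    intro h
    rcases hcase with h1 | h1
    · exact h1.1 (congrArg Prod.fst h)
    · exact h1.1 (congrArg Prod.snd h)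
  obtain ⟨Fl, G, hG0, hGc, hGr, hGd, hs1, hs2, hFl0⟩ := S.exists_flowBox (h₁.2.1 a haI) hX
  obtain ⟨ρ, hρ, hball⟩ := Metric.eventually_nhds_iff_ball.1 (hGr.and hGd)
  have hGcont : ContinuousOn G (Metric.ball p₀ ρ) := fun p hp => by
    obtain ⟨G', hG', -⟩ := (hball p hp).2
    exact hG'.continuousAt.continuousWithinAt
  -- a leaf path from `p₀` stays in the plaque of `p₀`
  have key : ∀ c : ℝ → ℂ × ℂ, S.LeafOn c a b → c a = p₀ →
      (∀ᶠ t in 𝓝[>] a, Fl ((G (c t)).1, 0) = c t) ∧ Tendsto (fun t => (G (c t)).1) (𝓝[>] a) (𝓝 0) := by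
    intro c hc hca
    have hcw : Tendsto c (𝓝[Icc a b] a) (𝓝 p₀) := by
      have := hc.1 a haI
      rwa [ContinuousWithinAt, hca] at this
    obtain ⟨d, hd, hdb⟩ : ∃ d > 0, ∀ t ∈ Icc a b, dist t a < d → c t ∈ Metric.ball p₀ ρ := by
      have := hcw.eventually (Metric.ball_mem_nhds p₀ hρ)
      rw [eventually_nhdsWithin_iff, Metric.eventually_nhds_iff_ball] at this
      obtain ⟨d, hd, h⟩ := this
      exact ⟨d, hd, fun t ht h' => h t h' ht⟩
    set b' := min b (a + d / 2) with hb'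
    have hab' : a < b' := lt_min hab (by linarith)
    have hin : ∀ t ∈ Icc a b', c t ∈ Metric.ball p₀ ρ := fun t ht =>
      hdb t ⟨ht.1, ht.2.trans (min_le_left _ _)⟩ (by
        rw [Real.dist_eq, abs_of_nonneg (by linarith [ht.1])]
        linarith [ht.2.trans (min_le_right b (a + d / 2))])
    obtain ⟨hc1, hc2, s, hs, hc3⟩ := hc.mono le_rfl (min_le_left b (a + d / 2))
    have hconst := eqOn_of_hasDerivAt_zero_off_finite (g := fun t => (G (c t)).2)
      (continuous_snd.comp_continuousOn (hGcont.comp hc1 hin)) hs (fun t ht => by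
        obtain ⟨k, hk⟩ := hc3 t ht
        obtain ⟨G', hG', hz⟩ := (hball (c t) (hin t (Ioo_subset_Icc_self ht.1))).2
        have h4 := (hG'.restrictScalars ℝ).comp_hasDerivAt t hk
        have h5 := HasFDerivAt.comp_hasDerivAt t
          ((ContinuousLinearMap.snd ℝ ℂ ℂ).hasFDerivAt (x := G (c t))) h4
        refine h5.congr_deriv ?_
        change (G' (k • S.X (c t))).2 = 0
        rw [map_smul, Prod.smul_snd, hz, smul_zero])
    have hmem : Ioc a b' ∈ 𝓝[>] a := Ioc_mem_nhdsGT hab'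
    constructor
    · filter_upwards [hmem] with t ht
      have htI : t ∈ Icc a b' := Ioc_subset_Icc_self ht
      have e1 := hconst t htI
      rw [hca, hG0] at e1
      have e2 : G (c t) = ((G (c t)).1, 0) := Prod.ext rfl e1
      rw [← e2]
      exact (hball (c t) (hin t htI)).1
    · have h1 : Tendsto c (𝓝[>] a) (𝓝 p₀) :=
        hcw.mono_left (le_inf inf_le_left (le_principal_iff.2
          (mem_of_superset (Ioc_mem_nhdsGT hab) Ioc_subset_Icc_self)))
      have h2 : Tendsto G (𝓝 p₀) (𝓝 0) := by
        have := hGc.tendsto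
        rwa [hG0] at this
      exact (continuous_fst.tendsto' (0 : ℂ × ℂ) 0 rfl).comp (h2.comp h1)
  obtain ⟨k1, l1⟩ := key c₁ h₁ rfl
  obtain ⟨k2, l2⟩ := key c₂ h₂ h0.symm
  have hmemI : ∀ᶠ t in 𝓝[>] a, t ∈ Icc a b :=
    mem_of_superset (Ioc_mem_nhdsGT hab) Ioc_subset_Icc_self
  have fin : ∀ (f : ℂ → ℂ) (f' : ℂ), HasStrictDerivAt f f' 0 → f' ≠ 0 →
      (∀ᶠ t in 𝓝[>] a, f (G (c₁ t)).1 = f (G (c₂ t)).1) → ∀ᶠ t in 𝓝[>] a, c₁ t = c₂ t := by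
    intro f f' hf hf' hev
    obtain ⟨g, -, -, hg, -⟩ := exists_local_inverse hf hf'
    filter_upwards [k1, k2, l1.eventually hg, l2.eventually hg, hev] with t e1 e2 e3 e4 e5
    rw [← e1, ← e2, ← e3, ← e4, e5]
  rcases hcase with ⟨hne, heq⟩ | ⟨hne, heq⟩
  · refine fin _ _ hs1 hne ?_
    filter_upwards [k1, k2, hmemI] with t e1 e2 e3
    rw [e1, e2, heq t e3]
  · refine fin _ _ hs2 hne ?_
    filter_upwards [k1, k2, hmemI] with t e1 e2 e3
    rw [e1, e2, heq t e3]

theorem LeafOn.unique {c₁ c₂ : ℝ → ℂ × ℂ} {a b : ℝ} (h₁ : S.LeafOn c₁ a b)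
    (h₂ : S.LeafOn c₂ a b) (h0 : c₁ a = c₂ a)
    (hcase : (∀ t ∈ Icc a b, (c₁ t).1 ≠ 0 ∧ (c₁ t).1 = (c₂ t).1) ∨
      (∀ t ∈ Icc a b, (S.X (c₁ t)).2 ≠ 0 ∧ (c₁ t).2 = (c₂ t).2)) :
    ∀ t ∈ Icc a b, c₁ t = c₂ t := by
  have hcl : IsClosed ({t | c₁ t = c₂ t} ∩ Icc a b) := by
    have : IsClosed (Icc a b ∩ (fun t => (c₁ t, c₂ t)) ⁻¹' {q | q.1 = q.2}) :=
      (h₁.1.prodMk h₂.1).preimage_isClosed_of_isClosed isClosed_Icc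
        (isClosed_eq continuous_fst continuous_snd)
    rwa [inter_comm] at this
  refine hcl.Icc_subset_of_forall_mem_nhdsWithin h0 ?_
  rintro t ⟨ht, htI⟩
  refine (h₁.mono htI.1 le_rfl).local_unique htI.2 (h₂.mono htI.1 le_rfl) ht ?_
  rcases hcase with h | h
  · exact Or.inl ⟨(h t ⟨htI.1, htI.2.le⟩).1, fun u hu => (h u ⟨htI.1.trans hu.1, hu.2⟩).2⟩
  · exact Or.inr ⟨(h t ⟨htI.1, htI.2.le⟩).1, fun u hu => (h u ⟨htI.1.trans hu.1, hu.2⟩).2⟩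

/-- The separatrix `{x = 0}` is invariant under leaf paths. -/
theorem IsLeafPath.fst_eq_zero {c : ℝ → ℂ × ℂ} (h : S.IsLeafPath c) (h0 : (c 0).1 = 0) :
    ∀ t ∈ Icc (0 : ℝ) 1, (c t).1 = 0 := by
  have hcl : IsClosed ({t | (c t).1 = 0} ∩ Icc (0 : ℝ) 1) := by
    have : IsClosed (Icc (0 : ℝ) 1 ∩ c ⁻¹' {q | q.1 = 0}) :=
      h.1.preimage_isClosed_of_isClosed isClosed_Icc (isClosed_eq continuous_fst continuous_const)
    rwa [inter_comm] at this
  refine hcl.Icc_subset_of_forall_mem_nhdsWithin h0 ?_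
  rintro t ⟨ht, htI⟩
  have htI' : t ∈ Icc (0 : ℝ) 1 := ⟨htI.1, htI.2.le⟩
  have hct : c t = (0, (c t).2) := Prod.ext ht rfl
  have hne : (c t).2 ≠ 0 := fun h' => (h.2.1 t htI').2 (Prod.ext ht h')
  have hU : {y : ℂ | ((0 : ℂ), y) ∈ S.U} ∈ 𝓝 (c t).2 :=
    (S.isOpen_U.preimage (by fun_prop : Continuous fun y : ℂ => ((0 : ℂ), y))).mem_nhds (by
      have := (h.2.1 t htI').1
      rw [hct] at this
      exact this)
  have hev : ∀ᶠ u in 𝓝[Icc 0 1] t, ((0 : ℂ), (c u).2) ∈ S.U :=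
    (continuous_snd.continuousAt.comp_continuousWithinAt (h.1 t htI')).eventually hU
  rw [eventually_nhdsWithin_iff, Metric.eventually_nhds_iff_ball] at hev
  obtain ⟨d, hd, hev⟩ := hev
  set b := min 1 (t + d / 2) with hb
  have htb : t < b := lt_min htI.2 (by linarith)
  have hsub : Icc t b ⊆ Icc 0 1 := Icc_subset_Icc htI.1 (min_le_left _ _)
  have h1 := h.leafOn.mono (a' := t) (b' := b) htI.1 (min_le_left _ _)
  -- the projection of `c` to `{x = 0}` is also a leaf path
  have h2 : S.LeafOn (fun u => (0, (c u).2)) t b := by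
    obtain ⟨hc1, -, s, hs, hc3⟩ := h1
    refine ⟨continuousOn_const.prodMk (continuous_snd.comp_continuousOn hc1), fun u hu => ?_, s, hs,
      fun u hu => ?_⟩
    · refine hev u ?_ (hsub hu)
      rw [Metric.mem_ball, Real.dist_eq, abs_of_nonneg (by linarith [hu.1])]
      linarith [hu.2.trans (min_le_right 1 (t + d / 2))]
    · obtain ⟨k, hk⟩ := hc3 u hu
      have h3 := HasFDerivAt.comp_hasDerivAt u
          ((ContinuousLinearMap.snd ℝ ℂ ℂ).hasFDerivAt (x := c u)) hk
      refine ⟨k * (1 + S.pert (c u)), ((hasDerivAt_const u (0 : ℂ)).prodMk h3).congr_deriv ?_⟩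
      rw [X_zero_left]
      refine Prod.ext (by simp) ?_
      change (k • S.X (c u)).2 = _
      rw [X_def]
      simp
      ring
  have := h1.local_unique htb h2 hct (Or.inr ⟨?_, fun u _ => rfl⟩)
  · filter_upwards [this] with u hu
    exact congrArg Prod.fst hu
  · rw [hct, X_zero_left]
    simp [hne, S.lam_pos.ne']

end PreparedSaddle

/-! ### Sectors of leaves over a transversal -/

theorem exists_closedBall_prod_subset {U : Set (ℂ × ℂ)} (hU : IsOpen U) {r₁ r₂ : ℝ} (h₁ : 0 ≤ r₁)
    (h₂ : 0 ≤ r₂) (h : ∀ x y : ℂ, ‖x‖ ≤ r₁ → ‖y‖ ≤ r₂ → (x, y) ∈ U) :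
    ∃ d > 0, ∀ x y : ℂ, ‖x‖ ≤ r₁ + d → ‖y‖ ≤ r₂ + d → (x, y) ∈ U := by
  obtain ⟨u, v, hu, hv, hu1, hv1, huv⟩ := generalized_tube_lemma
    (isCompact_closedBall (0 : ℂ) r₁) (isCompact_closedBall (0 : ℂ) r₂) hU
    (fun p hp => h p.1 p.2 (by simpa using hp.1) (by simpa using hp.2))
  obtain ⟨d, hd, hdu⟩ := (isCompact_closedBall (0 : ℂ) r₁).exists_cthickening_subset_open hu hu1
  obtain ⟨d', hd', hdv⟩ := (isCompact_closedBall (0 : ℂ) r₂).exists_cthickening_subset_open hv hv1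
  rw [cthickening_closedBall hd.le h₁] at hdu
  rw [cthickening_closedBall hd'.le h₂] at hdv
  refine ⟨min d d', lt_min hd hd', fun x y hx hy => huv ⟨hdu ?_, hdv ?_⟩⟩
  · simp only [Metric.mem_closedBall, dist_zero_right]
    linarith [min_le_left d d']
  · simp only [Metric.mem_closedBall, dist_zero_right]
    linarith [min_le_right d d']

namespace PreparedSaddle

variable (S : PreparedSaddle)

theorem mem_U_of_disk {x : ℂ} (hx : ‖x‖ ≤ 1) : (x, (0 : ℂ)) ∈ S.U := by
  obtain ⟨A, B, ε, hA, hB, -, h, -⟩ := S.adapted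
  exact h ⟨by simpa using hA.le, hx, by simpa using hB.le⟩

theorem exists_bound_K : ∃ M > 0, ∀ p ∈ S.U, ‖S.K p‖ ≤ M := by
  obtain ⟨A, B, ε, hA, hB, hε, h, h', -⟩ := S.adapted
  exact ⟨ε, hε, h'⟩

/-- The leaves issued from the transversal `{y = α x}`, followed for a complex time: the leaf
through `(a, α a)` is parametrized by `s ↦ (a * exp s, Y (s, a))`. The domain `Ω` contains a cone
of logarithmic abscissas `s`, of slope governed by `c`, as long as the abscissa `a * exp s` stays
in the closed unit disk. -/
structure IsSector (α : ℂ → ℂ) (c : ℝ) (Ω : Set (ℂ × ℂ)) (Y : ℂ × ℂ → ℂ) (ρ B : ℝ) : Prop where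
  isOpen : IsOpen Ω
  radius_pos : 0 < ρ
  radius_le : ρ ≤ 1
  bound_pos : 0 < B
  mem : ∀ s a : ℂ, ‖a‖ < ρ → c * ‖s‖ ≤ s.re → ‖a‖ * Real.exp s.re ≤ 1 → (s, a) ∈ Ω
  holo : DifferentiableOn ℂ Y Ω
  mem_U : ∀ p ∈ Ω, (p.2 * Complex.exp p.1, Y p) ∈ S.U
  hasDerivAt : ∀ p ∈ Ω, HasDerivAt (fun s => (p.2 * Complex.exp s, Y (s, p.2)))
    (S.X (p.2 * Complex.exp p.1, Y p)) p.1
  norm_le : ∀ p ∈ Ω, ‖Y p‖ ≤ B * Real.exp (-(S.lam / 2 * p.1.re))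
  init : ∀ a, ((0 : ℂ), a) ∈ Ω → Y (0, a) = α a
  eq_mul_exp : ∀ p ∈ Ω, ∃ w : ℂ, Y p = α p.2 * Complex.exp w

/-- A transversal with base point `α 0` such that the disk `‖y‖ ≤ ‖α 0‖` of `{x = 0}` lies in `U`
has sectors of any slope. The coordinate `y` decays exponentially along the leaves, so that
`x^n y K` is small for small `x` because of `x^n`, and for the other `x` because of `y`, once the
transversal is taken small. -/
theorem exists_sector {α : ℂ → ℂ} (hα : AnalyticAt ℂ α 0)
    (hα0 : ∀ y : ℂ, ‖y‖ ≤ ‖α 0‖ → ((0 : ℂ), y) ∈ S.U) {c : ℝ} (hc : 0 < c) :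
    ∃ (Ω : Set (ℂ × ℂ)) (Y : ℂ × ℂ → ℂ) (ρ B : ℝ), S.IsSector α c Ω Y ρ B := by
  obtain ⟨M, hM, hK⟩ := S.exists_bound_K
  have hlam := S.lam_pos
  obtain ⟨d₁, hd₁, hU₁⟩ := exists_closedBall_prod_subset S.isOpen_U le_rfl (norm_nonneg (α 0))
    (fun x y hx hy => by
      rw [norm_le_zero_iff.1 hx]; exact hα0 y hy)
  obtain ⟨d₂, hd₂, hU₂⟩ := exists_closedBall_prod_subset S.isOpen_U zero_le_one le_rfl
    (fun x y hx hy => by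
      rw [norm_le_zero_iff.1 hy]; exact S.mem_U_of_disk hx)
  rw [zero_add] at hU₁ hU₂
  set B : ℝ := ‖α 0‖ + d₁ with hB
  have hB0 : 0 < B := by positivity
  -- the margin `θ` makes the domain open; it costs a factor `exp ((λ + 1) θ) = B / B'`
  set B' : ℝ := ‖α 0‖ + d₁ / 2 with hB'
  have hB'0 : 0 < B' := by positivity
  have hB'B : B' < B := by simp only [hB, hB']; linarith
  set κ : ℝ := S.lam / 2 * c with hκ
  have hκ0 : 0 < κ := by positivity
  set θ : ℝ := Real.log (B / B') / (S.lam + 1) with hθ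
  have hθ0 : 0 < θ := div_pos (Real.log_pos ((one_lt_div hB'0).2 hB'B)) (by linarith)
  have hθe : B' * Real.exp ((S.lam + 1) * θ) = B := by
    rw [hθ, mul_div_cancel₀ _ (by linarith : S.lam + 1 ≠ 0), Real.exp_log (by positivity)]
    field_simp
  -- near `{x = 0}`, and near the disk of `{y = 0}`, the perturbation is small
  set δ₁ : ℝ := min (min d₁ 1) (κ / (S.lam * B * M)) with hδ₁
  have hδ₁0 : 0 < δ₁ := by positivity
  set η : ℝ := min d₂ (κ / (S.lam * (1 + d₂) ^ S.n * M)) with hη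
  have hη0 : 0 < η := by positivity
  obtain ⟨R, hR0, hR⟩ : ∃ R : ℝ, 0 ≤ R ∧ B * Real.exp (-(S.lam / 2 * R)) ≤ η := by
    refine ⟨|Real.log (B / η)| / (S.lam / 2), by positivity, ?_⟩
    rw [mul_div_cancel₀ _ (by positivity : S.lam / 2 ≠ 0), ← le_div_iff₀' hB0]
    calc Real.exp (-|Real.log (B / η)|) ≤ Real.exp (-Real.log (B / η)) :=
          Real.exp_le_exp.2 (neg_le_neg (le_abs_self _))
      _ = η / B := by rw [Real.exp_neg, Real.exp_log (by positivity), inv_div]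
  have hev : ∀ᶠ a in 𝓝 (0 : ℂ), DifferentiableAt ℂ α a ∧ ‖α a‖ ≤ B' := by
    have h1 : ∀ᶠ a in 𝓝 (0 : ℂ), AnalyticAt ℂ α a := hα.eventually_analyticAt
    have h2 : ∀ᶠ a in 𝓝 (0 : ℂ), ‖α a‖ < B' :=
      hα.continuousAt.norm.eventually (gt_mem_nhds (by simp only [hB']; linarith))
    filter_upwards [h1, h2] with a e1 e2 using ⟨e1.differentiableAt, e2.le⟩
  obtain ⟨ρ₁, hρ₁, hball⟩ := Metric.eventually_nhds_iff_ball.1 hev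
  set ρ : ℝ := min (min ρ₁ 1) (δ₁ * Real.exp (-R)) with hρ
  have hρ0 : 0 < ρ := by positivity
  have hρ1 : ρ ≤ 1 := (min_le_left _ _).trans (min_le_right _ _)
  have hρ₁' : ρ ≤ ρ₁ := (min_le_left _ _).trans (min_le_left _ _)
  set Ω : Set (ℂ × ℂ) := {p | c * ‖p.1‖ < p.1.re + θ ∧ ‖p.2‖ * Real.exp p.1.re < 1 + d₂ ∧ ‖p.2‖ < ρ}
    with hΩ
  have hre : Continuous fun p : ℂ × ℂ => p.1.re := Complex.continuous_re.comp continuous_fst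
  have hΩo : IsOpen Ω := by
    have o1 : IsOpen {p : ℂ × ℂ | c * ‖p.1‖ < p.1.re + θ} :=
      isOpen_lt (by fun_prop) (hre.add continuous_const)
    have o2 : IsOpen {p : ℂ × ℂ | ‖p.2‖ * Real.exp p.1.re < 1 + d₂} :=
      isOpen_lt ((continuous_norm.comp continuous_snd).mul (Real.continuous_exp.comp hre))
        continuous_const
    have o3 : IsOpen {p : ℂ × ℂ | ‖p.2‖ < ρ} := isOpen_lt (by fun_prop) continuous_const
    exact o1.inter (o2.inter o3)
  have hstar : ∀ p ∈ Ω, ∀ u ∈ Icc (0 : ℝ) 1, ((u : ℂ) * p.1, p.2) ∈ Ω := by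
    rintro p ⟨h1, h2, h3⟩ u ⟨hu0, hu1⟩
    refine ⟨?_, ?_, h3⟩
    · simp only [norm_mul, Complex.norm_real, Real.norm_eq_abs, abs_of_nonneg hu0, Complex.re_ofReal_mul]
      rcases hu0.eq_or_lt with h | h
      · rw [← h]; simpa using hθ0
      · nlinarith [mul_lt_mul_of_pos_left h1 h, mul_le_mul_of_nonneg_right hu1 hθ0.le]
    · simp only [Complex.re_ofReal_mul]
      rcases le_total 0 p.1.re with h | h
      · refine lt_of_le_of_lt ?_ h2
        gcongr
        exact mul_le_of_le_one_left h hu1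
      · have : Real.exp (u * p.1.re) ≤ 1 := Real.exp_le_one_iff.2 (mul_nonpos_of_nonneg_of_nonpos hu0 h)
        calc ‖p.2‖ * Real.exp (u * p.1.re) ≤ ‖p.2‖ * 1 := by gcongr
          _ < 1 + d₂ := by linarith
  have hnorm : ∀ p ∈ Ω, ∀ e : ℂ, ‖e‖ < κ * ‖p.1‖ + θ →
      ‖α p.2 * Complex.exp (-S.lam * p.1 + e)‖ ≤ B * Real.exp (-(S.lam / 2 * p.1.re)) ∧
      ‖α p.2 * Complex.exp (-S.lam * p.1 + e)‖ ≤ B := by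
    rintro p ⟨h1, h2, h3⟩ e he
    have hαp : ‖α p.2‖ ≤ B' := (hball p.2 (by simpa using h3.trans_le hρ₁')).2
    have hre : (-(S.lam : ℂ) * p.1 + e).re ≤ -(S.lam / 2 * (p.1.re + θ)) + (S.lam + 1) * θ := by
      have e1 : e.re ≤ ‖e‖ := Complex.re_le_norm e
      have e2 : κ * ‖p.1‖ ≤ S.lam / 2 * (p.1.re + θ) := by
        calc κ * ‖p.1‖ = S.lam / 2 * (c * ‖p.1‖) := by rw [hκ]; ring
          _ ≤ _ := by gcongr
      have e3 : (-(S.lam : ℂ) * p.1 + e).re = -(S.lam * p.1.re) + e.re := by simp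
      rw [e3]
      nlinarith
    have hmain : ‖α p.2 * Complex.exp (-S.lam * p.1 + e)‖ ≤ B * Real.exp (-(S.lam / 2 * (p.1.re + θ))) := by
      rw [norm_mul, Complex.norm_exp]
      calc ‖α p.2‖ * Real.exp (-(S.lam : ℂ) * p.1 + e).re
          ≤ B' * Real.exp (-(S.lam / 2 * (p.1.re + θ)) + (S.lam + 1) * θ) := by gcongr
        _ = B' * Real.exp ((S.lam + 1) * θ) * Real.exp (-(S.lam / 2 * (p.1.re + θ))) := by
          rw [Real.exp_add]; ring
        _ = _ := by rw [hθe]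
    have hpos : 0 ≤ p.1.re + θ := le_trans (by positivity) h1.le
    constructor
    · refine hmain.trans ?_
      gcongr
      linarith
    · refine hmain.trans (mul_le_of_le_one_right hB0.le ?_)
      exact Real.exp_le_one_iff.2 (by nlinarith)
  have hxnorm : ∀ p : ℂ × ℂ, ‖p.2 * Complex.exp p.1‖ = ‖p.2‖ * Real.exp p.1.re := fun p => by
    rw [norm_mul, Complex.norm_exp]
  obtain ⟨Y, hYd, hY⟩ := S.exists_flow hΩo hstar (x := fun a => a) (y := α)
    (fun p _ => differentiableAt_id)
    (fun p hp => (hball p.2 (by simpa using hp.2.2.trans_le hρ₁')).1) hκ0.le hθ0 (by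
      intro p hp e he
      obtain ⟨hn1, hn2⟩ := hnorm p hp e he
      set y := α p.2 * Complex.exp (-S.lam * p.1 + e) with hy
      set x := p.2 * Complex.exp p.1 with hx
      have hxn : ‖x‖ = ‖p.2‖ * Real.exp p.1.re := hxnorm p
      rcases lt_or_ge ‖x‖ δ₁ with hlt | hge
      · have hx1 : ‖x‖ ≤ 1 := hlt.le.trans ((min_le_left _ _).trans (min_le_right _ _))
        have hmem : (x, y) ∈ S.U :=
          hU₁ x y (hlt.le.trans ((min_le_left _ _).trans (min_le_left _ _))) hn2
        refine ⟨hmem, ?_⟩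
        have hxpow : ‖x‖ ^ S.n ≤ δ₁ :=
          (pow_le_of_le_one (norm_nonneg _) hx1 S.n_pos.ne').trans hlt.le
        rw [pert, norm_mul, norm_mul, norm_pow]
        calc S.lam * (‖x‖ ^ S.n * ‖y‖ * ‖S.K (x, y)‖) ≤ S.lam * (δ₁ * B * M) := by
              gcongr
              exact hK _ hmem
          _ ≤ S.lam * (κ / (S.lam * B * M) * B * M) := by gcongr; exact min_le_right _ _
          _ = κ := by field_simp
      · have hρR : ‖p.2‖ < δ₁ * Real.exp (-R) := hp.2.2.trans_le (min_le_right _ _)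
        have hs : R ≤ p.1.re := by
          by_contra! hlt
          have h1 : Real.exp p.1.re < Real.exp R := Real.exp_lt_exp.2 hlt
          have : ‖x‖ < δ₁ := by
            rw [hxn]
            calc ‖p.2‖ * Real.exp p.1.re ≤ ‖p.2‖ * Real.exp R := by gcongr
              _ < δ₁ * Real.exp (-R) * Real.exp R := by gcongr
              _ = δ₁ := by rw [mul_assoc, ← Real.exp_add]; simp
          linarith
        have hyη : ‖y‖ ≤ η := by
          refine hn1.trans (le_trans ?_ hR)
          gcongr
        have hx1 : ‖x‖ ≤ 1 + d₂ := by rw [hxn]; exact hp.2.1.le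
        have hmem : (x, y) ∈ S.U := hU₂ x y hx1 (hyη.trans (min_le_left _ _))
        refine ⟨hmem, ?_⟩
        rw [pert, norm_mul, norm_mul, norm_pow]
        calc S.lam * (‖x‖ ^ S.n * ‖y‖ * ‖S.K (x, y)‖) ≤ S.lam * ((1 + d₂) ^ S.n * η * M) := by
              gcongr
              exact hK _ hmem
          _ ≤ S.lam * ((1 + d₂) ^ S.n * (κ / (S.lam * (1 + d₂) ^ S.n * M)) * M) := by
              gcongr; exact min_le_right _ _
          _ = κ := by field_simp)
  refine ⟨Ω, Y, ρ, B, hΩo, hρ0, hρ1, hB0, fun s a ha h1 h2 =>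
    ⟨by simp only; linarith, by simp only; linarith, ha⟩, hYd, fun p hp => (hY p hp).1,
    fun p hp => S.flow_hasDerivAt (hY p hp).2.2, fun p hp => ?_, fun a ha => ?_, fun p hp => ?_⟩
  · obtain ⟨h1, ⟨e, he, hYe⟩, h3⟩ := hY p hp
    rw [hYe]
    exact (hnorm p hp e (by linarith)).1
  · obtain ⟨h1, ⟨e, he, hYe⟩, h3⟩ := hY _ ha
    have : e = 0 := by simpa using he
    rw [hYe, this]; simp
  · obtain ⟨h1, ⟨e, he, hYe⟩, h3⟩ := hY p hp
    exact ⟨_, hYe⟩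

end PreparedSaddle

/-! ### Conformal disks exhausting a simply connected domain -/

/-- The Möbius transformation of the unit disk sending `a` to `0`. -/
def moebius (a z : ℂ) : ℂ := (z - a) / (1 - (starRingEnd ℂ) a * z)

theorem moebius_denom_ne {a z : ℂ} (ha : ‖a‖ < 1) (hz : ‖z‖ < 1) :
    1 - (starRingEnd ℂ) a * z ≠ 0 := by
  intro h
  have h1 : (starRingEnd ℂ) a * z = 1 := (sub_eq_zero.1 h).symm
  have h2 : ‖a‖ * ‖z‖ = 1 := by
    rw [← RCLike.norm_conj a, ← norm_mul, h1, norm_one]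
  nlinarith [norm_nonneg a, norm_nonneg z]

theorem one_sub_moebius_sq (a z : ℂ) (h : 1 - (starRingEnd ℂ) a * z ≠ 0) :
    1 - ‖moebius a z‖ ^ 2 = (1 - ‖a‖ ^ 2) * (1 - ‖z‖ ^ 2) / ‖1 - (starRingEnd ℂ) a * z‖ ^ 2 := by
  have h' : ‖1 - (starRingEnd ℂ) a * z‖ ^ 2 ≠ 0 := by simpa using h
  rw [moebius, norm_div, div_pow, eq_div_iff h', sub_mul, div_mul_cancel₀ _ h', one_mul]
  simp only [← Complex.normSq_eq_norm_sq, Complex.normSq_apply]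
  simp
  ring

theorem norm_moebius_lt {a z : ℂ} (ha : ‖a‖ < 1) (hz : ‖z‖ < 1) : ‖moebius a z‖ < 1 := by
  have h := moebius_denom_ne ha hz
  have h1 := one_sub_moebius_sq a z h
  have h2 : 0 < (1 - ‖a‖ ^ 2) * (1 - ‖z‖ ^ 2) / ‖1 - (starRingEnd ℂ) a * z‖ ^ 2 := by
    have h3 : 0 < ‖1 - (starRingEnd ℂ) a * z‖ := norm_pos_iff.2 h
    have h4 : 0 < 1 - ‖a‖ ^ 2 := by nlinarith [norm_nonneg a]
    have h5 : 0 < 1 - ‖z‖ ^ 2 := by nlinarith [norm_nonneg z]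
    positivity
  nlinarith [norm_nonneg (moebius a z)]

theorem moebius_self (a : ℂ) : moebius a a = 0 := by simp [moebius]

theorem moebius_eq_zero {a z : ℂ} (ha : ‖a‖ < 1) (hz : ‖z‖ < 1) (h : moebius a z = 0) : z = a := by
  rw [moebius, div_eq_zero_iff] at h
  exact sub_eq_zero.1 (h.resolve_right (moebius_denom_ne ha hz))

theorem moebius_injOn {a z w : ℂ} (ha : ‖a‖ < 1) (hz : ‖z‖ < 1) (hw : ‖w‖ < 1)
    (h : moebius a z = moebius a w) : z = w := by
  have h1 := moebius_denom_ne ha hz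
  have h2 := moebius_denom_ne ha hw
  have h3 : 1 - (starRingEnd ℂ) a * a ≠ 0 := moebius_denom_ne ha ha
  rw [moebius, moebius, div_eq_div_iff h1 h2] at h
  have : (z - w) * (1 - (starRingEnd ℂ) a * a) = 0 := by linear_combination h
  exact sub_eq_zero.1 ((mul_eq_zero.1 this).resolve_right h3)

theorem hasDerivAt_moebius {a z : ℂ} (ha : ‖a‖ < 1) (hz : ‖z‖ < 1) :
    HasDerivAt (moebius a)
      ((1 - (starRingEnd ℂ) a * a) / (1 - (starRingEnd ℂ) a * z) ^ 2) z := by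
  have h1 := moebius_denom_ne ha hz
  have h2 : HasDerivAt (fun z : ℂ => 1 - (starRingEnd ℂ) a * z) (-(starRingEnd ℂ) a) z := by
    simpa using ((hasDerivAt_id z).const_mul ((starRingEnd ℂ) a)).const_sub 1
  refine (((hasDerivAt_id z).sub_const a).fun_div h2 h1).congr_deriv ?_
  simp only [id]
  ring

/-- Univalent maps of `U` into the unit disk, fixing `0`. -/
structure IsDiskMap (U : Set ℂ) (f : ℂ → ℂ) : Prop where
  deriv_ne : ∀ z ∈ U, deriv f z ≠ 0
  mapsTo : ∀ z ∈ U, ‖f z‖ < 1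
  injOn : InjOn f U
  zero : f 0 = 0

theorem IsDiskMap.differentiableAt {U : Set ℂ} {f : ℂ → ℂ} (h : IsDiskMap U f) {z : ℂ} (hz : z ∈ U) :
    DifferentiableAt ℂ f z := differentiableAt_of_deriv_ne_zero (h.deriv_ne z hz)

/-- Schwarz–Pick: a holomorphic map of a disk into the unit disk which is away from the boundary
at the centre is so, uniformly, on smaller disks. -/
theorem one_sub_sq_ge_of_ball {f : ℂ → ℂ} {w : ℂ} {R s r : ℝ} (hR : 0 < R) (hs1 : s < 1)
    (hr : r < 1) (hd : DifferentiableOn ℂ f (Metric.ball w R))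
    (hf : ∀ z ∈ Metric.ball w R, ‖f z‖ < 1) (hw : ‖f w‖ ≤ r) {z : ℂ} (hz : dist z w ≤ s * R) :
    (1 - r) ^ 2 * (1 - s ^ 2) ≤ 1 - ‖f z‖ ^ 2 := by
  have hs0 : 0 ≤ s := nonneg_of_mul_nonneg_left (dist_nonneg.trans hz) hR
  have hr0 : 0 ≤ r := (norm_nonneg _).trans hw
  have hzb : z ∈ Metric.ball w R := lt_of_le_of_lt hz (by nlinarith)
  have hwb : w ∈ Metric.ball w R := Metric.mem_ball_self hR
  have ha := hf w hwb
  have hz1 := hf z hzb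
  have h1 : ‖moebius (f w) (f z)‖ ≤ s := by
    have h2 := Complex.dist_le_div_mul_dist_of_mapsTo_ball (f := fun z => moebius (f w) (f z))
      (c := w) (R₁ := R) (R₂ := 1) (z := z) (fun x hx =>
        ((hasDerivAt_moebius ha (hf x hx)).differentiableAt.comp x
          (hd.differentiableAt (Metric.isOpen_ball.mem_nhds hx))).differentiableWithinAt)
      (fun x hx => by
        have := norm_moebius_lt ha (hf x hx)
        simpa [moebius_self] using this.le) hzb
    simp only [moebius_self, dist_zero_right] at h2
    refine h2.trans ?_
    rw [div_mul_eq_mul_div, one_mul, div_le_iff₀ hR]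
    exact hz
  have hden := moebius_denom_ne ha hz1
  have h3 := one_sub_moebius_sq (f w) (f z) hden
  have hd2 : 0 < ‖1 - (starRingEnd ℂ) (f w) * f z‖ := norm_pos_iff.2 hden
  have hd4 : 1 - r ≤ ‖1 - (starRingEnd ℂ) (f w) * f z‖ := by
    have h5 := norm_sub_norm_le 1 ((starRingEnd ℂ) (f w) * f z)
    rw [norm_one, norm_mul, RCLike.norm_conj] at h5
    nlinarith [norm_nonneg (f w), norm_nonneg (f z)]
  have hd3 : 0 < 1 - ‖f w‖ ^ 2 := by nlinarith [norm_nonneg (f w)]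
  set a := ‖f w‖
  set b := ‖f z‖
  set d := ‖1 - (starRingEnd ℂ) (f w) * f z‖
  have hb : 0 < 1 - b ^ 2 := by nlinarith [norm_nonneg (f z)]
  rw [eq_div_iff (by positivity)] at h3
  have key : (1 - s ^ 2) * d ^ 2 ≤ (1 - a ^ 2) * (1 - b ^ 2) := by
    rw [← h3]
    gcongr
  have hs2 : 0 ≤ 1 - s ^ 2 := by nlinarith
  calc (1 - r) ^ 2 * (1 - s ^ 2) ≤ d ^ 2 * (1 - s ^ 2) := by
        gcongr
    _ ≤ (1 - a ^ 2) * (1 - b ^ 2) := by linarith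
    _ ≤ 1 * (1 - b ^ 2) := by
        gcongr
        nlinarith [sq_nonneg a]
    _ = _ := one_mul _

/-- The univalent maps of `U` into the unit disk which fix `0` stay uniformly away from the circle
over a compact part of `U`, by Schwarz–Pick along chains of disks. -/
theorem IsDiskMap.exists_uniform_bound {U : Set ℂ} (hUo : IsOpen U) (hUc : IsPreconnected U)
    (h0 : (0 : ℂ) ∈ U) {Q : Set ℂ} (hQ : IsCompact Q) (hQU : Q ⊆ U) :
    ∃ r < 1, 0 < r ∧ ∀ f, IsDiskMap U f → ∀ z ∈ Q, ‖f z‖ ≤ r := by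
  -- `V` is the open set of the points near which the maps are uniformly away from the circle
  set V : Set ℂ := {z | ∃ δ > 0, ∀ᶠ w in 𝓝 z, ∀ f, IsDiskMap U f → δ ≤ 1 - ‖f w‖ ^ 2} with hV
  have hVo : IsOpen V := by
    rw [isOpen_iff_mem_nhds]
    rintro z ⟨δ, hδ, h⟩
    filter_upwards [h.eventually_nhds] with w hw using ⟨δ, hδ, hw⟩
  have step : ∀ z w R, 0 < R → Metric.ball w R ⊆ U → dist z w < R / 2 →
      (∃ r < 1, ∀ f, IsDiskMap U f → ‖f w‖ ≤ r) → z ∈ V := by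
    rintro z w R hR hb hzw ⟨r, hr, h⟩
    refine ⟨(1 - r) ^ 2 * (1 - (1 / 2) ^ 2), by have := sub_pos.2 hr; positivity, ?_⟩
    filter_upwards [(isOpen_lt (continuous_id.dist continuous_const)
      continuous_const).mem_nhds hzw] with x hx f hf
    exact one_sub_sq_ge_of_ball hR (by norm_num) hr
      (fun y hy => (hf.differentiableAt (hb hy)).differentiableWithinAt)
      (fun y hy => hf.mapsTo y (hb hy)) (h f hf) (by simp only [id] at hx; linarith)
  have hVw : ∀ w ∈ V, ∃ r < 1, ∀ f, IsDiskMap U f → ‖f w‖ ≤ r := by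
    rintro w ⟨δ, hδ, h⟩
    refine ⟨√(1 - δ), ?_, fun f hf => Real.le_sqrt_of_sq_le (by linarith [h.self_of_nhds f hf])⟩
    rw [Real.sqrt_lt' one_pos]
    linarith
  have hUV : U ⊆ V := by
    refine hUc.subset_of_closure_inter_subset hVo ⟨0, h0, ?_⟩ ?_
    · obtain ⟨R, hR, hb⟩ := Metric.isOpen_iff.1 hUo 0 h0
      exact step 0 0 R hR hb (by simpa using hR) ⟨0, one_pos, fun f hf => by simp [hf.zero]⟩
    · rintro z ⟨hz1, hz2⟩
      obtain ⟨R, hR, hb⟩ := Metric.isOpen_iff.1 hUo z hz2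
      obtain ⟨w, hw, hzw⟩ := Metric.mem_closure_iff.1 hz1 (R / 4) (by positivity)
      refine step z w (R / 2) (by positivity) (fun y hy => hb ?_) (by linarith) (hVw w hw)
      rw [Metric.mem_ball] at hy ⊢
      linarith [dist_triangle y w z, dist_comm z w]
  have hloc : ∀ z ∈ Q, ∃ t ∈ 𝓝[Q] z, ∃ r < 1, ∀ f, IsDiskMap U f → ∀ w ∈ t, ‖f w‖ ≤ r := by
    intro z hz
    obtain ⟨δ, hδ, h⟩ := hUV (hQU hz)
    refine ⟨_, mem_nhdsWithin_of_mem_nhds h, √(1 - δ), ?_, fun f hf w hw =>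
      Real.le_sqrt_of_sq_le (by linarith [hw f hf])⟩
    rw [Real.sqrt_lt' one_pos]
    linarith
  obtain ⟨r, hr, h⟩ := hQ.induction_on (p := fun t => ∃ r < 1, ∀ f, IsDiskMap U f → ∀ w ∈ t, ‖f w‖ ≤ r)
    ⟨0, one_pos, fun _ _ _ h => h.elim⟩
    (fun s t hst ⟨r, hr, h⟩ => ⟨r, hr, fun f hf w hw => h f hf w (hst hw)⟩)
    (fun s t ⟨r, hr, h⟩ ⟨r', hr', h'⟩ => ⟨max r r', max_lt hr hr', fun f hf w hw =>
      hw.elim (fun hw => (h f hf w hw).trans (le_max_left _ _))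
        fun hw => (h' f hf w hw).trans (le_max_right _ _)⟩) hloc
  exact ⟨max r (1 / 2), max_lt hr (by norm_num), lt_max_of_lt_right (by norm_num),
    fun f hf z hz => (h f hf z hz).trans (le_max_left _ _)⟩

theorem IsDiskMap.moebius_comp {U : Set ℂ} {f : ℂ → ℂ} {a : ℂ} (ha : ‖a‖ < 1)
    (h1 : ∀ z ∈ U, deriv f z ≠ 0) (h2 : ∀ z ∈ U, ‖f z‖ < 1) (h3 : InjOn f U) {z : ℂ} (hz : z ∈ U) :
    HasDerivAt (fun z => moebius a (f z))
      ((1 - (starRingEnd ℂ) a * a) / (1 - (starRingEnd ℂ) a * f z) ^ 2 * deriv f z) z ∧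
    deriv (fun z => moebius a (f z)) z ≠ 0 ∧ ‖moebius a (f z)‖ < 1 ∧
    InjOn (fun z => moebius a (f z)) U := by
  have hd : HasDerivAt (fun z => moebius a (f z))
      ((1 - (starRingEnd ℂ) a * a) / (1 - (starRingEnd ℂ) a * f z) ^ 2 * deriv f z) z :=
    (hasDerivAt_moebius ha (h2 z hz)).comp z
      (differentiableAt_of_deriv_ne_zero (h1 z hz)).hasDerivAt
  refine ⟨hd, ?_, norm_moebius_lt ha (h2 z hz), fun x hx y hy hxy =>
    h3 hx hy (moebius_injOn ha (h2 x hx) (h2 y hy) hxy)⟩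
  rw [hd.deriv]
  exact mul_ne_zero (div_ne_zero (moebius_denom_ne ha ha)
    (pow_ne_zero _ (moebius_denom_ne ha (h2 z hz)))) (h1 z hz)

theorem exists_sqrt {U : Set ℂ} (hUo : IsOpen U) (hUc : IsSimplyConnected U) {m : ℂ → ℂ}
    (hm : ∀ z ∈ U, DifferentiableAt ℂ m z) (hm0 : ∀ z ∈ U, m z ≠ 0) :
    ∃ q : ℂ → ℂ, (∀ z, q z ^ 2 = m z) ∧ (∀ z ∈ U, q z ≠ 0) ∧
      ∀ z ∈ U, HasDerivAt q ((2 * q z)⁻¹ * deriv m z) z := by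
  obtain ⟨q, hqc, hq⟩ := Complex.exists_continuousOn_pow_eq hUc hUo (g := m)
    (fun z hz => (hm z hz).continuousAt.continuousWithinAt)
    (by rintro ⟨z, hz, h⟩; exact hm0 z hz h) two_ne_zero
  have hq0 : ∀ z ∈ U, q z ≠ 0 := fun z hz h => hm0 z hz (by rw [← hq z, h]; simp)
  refine ⟨q, hq, hq0, fun z hz => ?_⟩
  obtain ⟨g, hg1, hg2, hg3, hg4⟩ := exists_local_inverse (f := fun z : ℂ => z ^ 2)
    (hasStrictDerivAt_pow 2 (q z)) (by simpa using hq0 z hz)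
  have hqz : Tendsto q (𝓝 z) (𝓝 (q z)) := hqc.continuousAt (hUo.mem_nhds hz)
  have h1 : ∀ᶠ x in 𝓝 z, q x = g (m x) := by
    filter_upwards [hqz.eventually hg3] with x hx
    rw [← hq x]; exact hx.symm
  have h2 := hg2.hasDerivAt
  simp only [hq z] at h2
  refine ((h2.comp z (hm z hz).hasDerivAt).congr_of_eventuallyEq h1).congr_deriv ?_
  simp

/-- A simply connected proper open set has a univalent map into the unit disk: if `a` is not in
the set, a branch `q` of `√(z - a)` omits a neighbourhood of `-q 0`. -/
theorem exists_isDiskMap {U : Set ℂ} (hUo : IsOpen U) (hUc : IsSimplyConnected U)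
    (h0 : (0 : ℂ) ∈ U) (hU : U ≠ univ) : ∃ f, IsDiskMap U f := by
  obtain ⟨a, ha⟩ := (ne_univ_iff_exists_notMem U).1 hU
  have hmd : ∀ z : ℂ, HasDerivAt (fun z => z - a) 1 z := fun z => (hasDerivAt_id z).sub_const a
  obtain ⟨q, hq, hq0, hqd⟩ := exists_sqrt hUo hUc (m := fun z => z - a)
    (fun z _ => (hmd z).differentiableAt) (fun z hz h => ha (by rwa [← sub_eq_zero.1 h]))
  have hqd' : ∀ z ∈ U, HasDerivAt q (2 * q z)⁻¹ z := fun z hz =>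
    (hqd z hz).congr_deriv (by rw [(hmd z).deriv, mul_one])
  obtain ⟨ε, hε, hfar⟩ : ∃ ε > 0, ∀ z ∈ U, ε ≤ ‖q z + q 0‖ := by
    have hs : HasStrictDerivAt q (2 * q 0)⁻¹ 0 := by
      have : AnalyticAt ℂ q 0 := DifferentiableOn.analyticAt
        (fun z hz => (hqd' z hz).differentiableAt.differentiableWithinAt) (hUo.mem_nhds h0)
      have h2 := this.hasStrictDerivAt
      rwa [(hqd' 0 h0).deriv] at h2
    have him : q '' U ∈ 𝓝 (q 0) := by
      rw [← hs.map_nhds_eq (by simpa using hq0 0 h0)]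
      exact image_mem_map (hUo.mem_nhds h0)
    obtain ⟨ε, hε, hb⟩ := Metric.mem_nhds_iff.1 him
    refine ⟨ε, hε, fun z hz => ?_⟩
    by_contra! hlt
    obtain ⟨w, hw, hwz⟩ := hb (show -q z ∈ Metric.ball (q 0) ε by
      rw [Metric.mem_ball, dist_eq_norm, ← norm_neg, show -(-q z - q 0) = q z + q 0 by ring]
      exact hlt)
    have h3 : w = z := by
      have h4 := hq w
      rw [hwz, neg_sq, hq z] at h4
      exact (sub_left_inj.1 h4).symm
    rw [h3] at hwz
    exact hq0 z hz (by linear_combination hwz / 2)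
  set p : ℂ → ℂ := fun z => ((ε / 2 : ℝ) : ℂ) / (q z + q 0) with hp
  have hne : ∀ z ∈ U, q z + q 0 ≠ 0 := fun z hz h => by
    have := hfar z hz
    rw [h, norm_zero] at this
    linarith
  have hε' : ((ε / 2 : ℝ) : ℂ) ≠ 0 := by exact_mod_cast (by positivity : ε / 2 ≠ 0)
  have h1 : ∀ z ∈ U, deriv p z ≠ 0 := fun z hz => by
    rw [((hasDerivAt_const z _).fun_div ((hqd' z hz).add_const (q 0)) (hne z hz)).deriv]
    simp [hne z hz, hε', hq0 z hz, -Complex.ofReal_div, -Complex.ofReal_mul]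
  have h2 : ∀ z ∈ U, ‖p z‖ < 1 := fun z hz => by
    rw [hp, norm_div, Complex.norm_real, Real.norm_eq_abs, abs_of_pos (by positivity),
      div_lt_one (norm_pos_iff.2 (hne z hz))]
    linarith [hfar z hz]
  have h3 : InjOn p U := by
    intro x hx y hy hxy
    simp only [hp] at hxy
    rw [div_eq_div_iff (hne x hx) (hne y hy)] at hxy
    have h4 : q y = q x := by linear_combination mul_left_cancel₀ hε' hxy
    have h5 := hq y
    rw [h4, hq x] at h5
    exact sub_left_inj.1 h5
  have hg := fun z (hz : z ∈ U) => IsDiskMap.moebius_comp (h2 0 h0) h1 h2 h3 hz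
  exact ⟨fun z => moebius (p 0) (p z), fun z hz => (hg z hz).2.1, fun z hz => (hg z hz).2.2.1,
    (hg 0 h0).2.2.2, moebius_self _⟩

/-- Koebe's square root trick: if `f` omits the point `w`, another map has derivative at `0`
larger by the factor `(1 + |w|) / (2 √|w|)`. -/
theorem IsDiskMap.exists_larger {U : Set ℂ} (hUo : IsOpen U) (hUc : IsSimplyConnected U)
    (h0 : (0 : ℂ) ∈ U) {f : ℂ → ℂ} (hf : IsDiskMap U f) {w : ℂ} (hw : ‖w‖ < 1) (hwU : w ∉ f '' U) :
    ∃ g, IsDiskMap U g ∧ ‖deriv g 0‖ = (1 + ‖w‖) / (2 * √‖w‖) * ‖deriv f 0‖ := by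
  have hw0 : w ≠ 0 := fun h => hwU ⟨0, h0, by rw [hf.zero, h]⟩
  have hm := fun z (hz : z ∈ U) => IsDiskMap.moebius_comp hw hf.deriv_ne hf.mapsTo hf.injOn hz
  set m : ℂ → ℂ := fun z => moebius w (f z) with hmdef
  have hm0 : ∀ z ∈ U, m z ≠ 0 := fun z hz h =>
    hwU ⟨z, hz, moebius_eq_zero hw (hf.mapsTo z hz) h⟩
  obtain ⟨q, hq, hq0, hqd⟩ := exists_sqrt hUo hUc (m := m)
    (fun z hz => (hm z hz).1.differentiableAt) hm0
  have hqn : ∀ z ∈ U, ‖q z‖ < 1 := by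
    intro z hz
    rw [← pow_lt_one_iff_of_nonneg (norm_nonneg _) two_ne_zero, ← norm_pow, hq]
    exact (hm z hz).2.2.1
  have hqi : InjOn q U := fun x hx y hy hxy => (hm x hx).2.2.2 hx hy (by
    rw [← hq x, ← hq y, hxy])
  have hqd' : ∀ z ∈ U, deriv q z ≠ 0 := by
    intro z hz
    rw [(hqd z hz).deriv]
    exact mul_ne_zero (inv_ne_zero (mul_ne_zero two_ne_zero (hq0 z hz))) (hm z hz).2.1
  have hg := fun z (hz : z ∈ U) => IsDiskMap.moebius_comp (hqn 0 h0) hqd' hqn hqi hz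
  refine ⟨fun z => moebius (q 0) (q z), ⟨fun z hz => (hg z hz).2.1, fun z hz => (hg z hz).2.2.1,
    (hg 0 h0).2.2.2, moebius_self _⟩, ?_⟩
  have hq00 : q 0 ^ 2 = -w := by rw [hq]; simp [hmdef, hf.zero, moebius]
  have hqw : ‖q 0‖ ^ 2 = ‖w‖ := by rw [← norm_pow, hq00, norm_neg]
  have hqs : √‖w‖ = ‖q 0‖ := by rw [← hqw, Real.sqrt_sq (norm_nonneg _)]
  have hn : ∀ a : ℂ, ‖a‖ < 1 → ‖1 - (starRingEnd ℂ) a * a‖ = 1 - ‖a‖ ^ 2 := by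
    intro a ha
    have : 1 - (starRingEnd ℂ) a * a = ((1 - ‖a‖ ^ 2 : ℝ) : ℂ) := by
      rw [Complex.conj_mul']; push_cast; ring
    rw [this, Complex.norm_real, Real.norm_eq_abs, abs_of_pos]
    nlinarith [norm_nonneg a]
  have hne : 1 - ‖q 0‖ ^ 2 ≠ 0 := by nlinarith [norm_nonneg (q 0), hqn 0 h0]
  have hq0' : ‖q 0‖ ≠ 0 := norm_ne_zero_iff.2 (hq0 0 h0)
  rw [(hg 0 h0).1.deriv, (hqd 0 h0).deriv, (hm 0 h0).1.deriv, hf.zero, hqs, ← hqw]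
  simp only [norm_mul, norm_div, norm_inv, norm_pow, hn _ (hqn 0 h0), hn _ hw, mul_zero, sub_zero,
    norm_one, RCLike.norm_ofNat]
  rw [← hqw]
  field_simp
  ring

/-- A quantitative form of the Riemann mapping theorem: every compact part `Q` of a simply connected
open set `U` lies in a conformal disk of `U`. The univalent map `f` sends the conformal disk to
the disk of radius `R`, with inverse `g`. By Koebe's square root trick it is enough that the
derivative of `f` at `0` be close to the supremum, so that no extremal map is needed. -/
theorem exists_conformal_disk {U : Set ℂ} (hUo : IsOpen U) (hUc : IsSimplyConnected U)
    (h0 : (0 : ℂ) ∈ U) {Q : Set ℂ} (hQ : IsCompact Q) (hQU : Q ⊆ U) :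
    ∃ (f g : ℂ → ℂ) (r R : ℝ), 0 < r ∧ r < R ∧ (∀ z ∈ U, deriv f z ≠ 0) ∧ InjOn f U ∧ f 0 = 0 ∧
      (∀ w, ‖w‖ < R → g w ∈ U ∧ f (g w) = w) ∧ ∀ z ∈ Q, ‖f z‖ < r := by
  by_cases hU : U = univ
  · obtain ⟨C, hC⟩ := hQ.isBounded.exists_norm_le
    refine ⟨id, id, |C| + 1, |C| + 2, by positivity, by linarith, fun z _ => by simp, injOn_id _, rfl,
      fun w _ => ⟨by simp [hU], rfl⟩, fun z hz => ?_⟩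
    have := hC z hz
    simp only [id]
    linarith [le_abs_self C]
  obtain ⟨r, hr1, hr0, hr⟩ := IsDiskMap.exists_uniform_bound hUo
    hUc.isPathConnected.isConnected.isPreconnected h0 hQ hQU
  obtain ⟨r', hr', hr'1⟩ := exists_between hr1
  obtain ⟨R, hR, hb⟩ := Metric.isOpen_iff.1 hUo 0 h0
  set T : Set ℝ := {t | ∃ f, IsDiskMap U f ∧ t = ‖deriv f 0‖} with hT
  have hTb : BddAbove T := by
    refine ⟨1 / R, ?_⟩
    rintro _ ⟨f, hf, rfl⟩
    refine Complex.norm_deriv_le_div_of_mapsTo_ball (c := 0) (R₁ := R) (R₂ := 1)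
      (fun y hy => (hf.differentiableAt (hb hy)).differentiableWithinAt) (fun y hy => ?_) hR
    rw [hf.zero]
    simpa using (hf.mapsTo y (hb hy)).le
  obtain ⟨f₀, hf₀⟩ := exists_isDiskMap hUo hUc h0 hU
  have hTn : T.Nonempty := ⟨_, f₀, hf₀, rfl⟩
  have hs0 : 0 < sSup T :=
    (norm_pos_iff.2 (hf₀.deriv_ne 0 h0)).trans_le (le_csSup hTb ⟨f₀, hf₀, rfl⟩)
  have hr'0 : 0 < r' := hr0.trans hr'
  have hs' : 0 < √r' := Real.sqrt_pos.2 hr'0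
  have hs'1 : √r' < 1 := by rw [Real.sqrt_lt' one_pos]; simpa using hr'1
  have hq : 1 < (1 + r') / (2 * √r') := by
    rw [one_lt_div (by positivity)]
    nlinarith [Real.sq_sqrt hr'0.le]
  obtain ⟨_, ⟨f, hf, rfl⟩, hlt⟩ := exists_lt_of_lt_csSup hTn (div_lt_self hs0 hq)
  have hsurj : ∀ w, ‖w‖ < r' → w ∈ f '' U := by
    intro w hw
    by_contra hwU
    obtain ⟨g, hg, hgd⟩ := hf.exists_larger hUo hUc h0 (hw.trans hr'1) hwU
    have h1 : ‖deriv g 0‖ ≤ sSup T := le_csSup hTb ⟨g, hg, rfl⟩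
    have hw0 : 0 < ‖w‖ := norm_pos_iff.2 fun h => hwU ⟨0, h0, by rw [hf.zero, h]⟩
    have h2 : (1 + r') / (2 * √r') ≤ (1 + ‖w‖) / (2 * √‖w‖) := by
      have ha : 0 < √‖w‖ := Real.sqrt_pos.2 hw0
      have hab : √‖w‖ ≤ √r' := Real.sqrt_le_sqrt hw.le
      rw [div_le_div_iff₀ (by positivity) (by positivity)]
      nth_rw 1 [← Real.sq_sqrt hr'0.le]
      nth_rw 2 [← Real.sq_sqrt hw0.le]
      nlinarith [mul_nonneg (sub_nonneg.2 hab) (sub_nonneg.2 (mul_le_one₀ hs'1.le ha.le (hab.trans hs'1.le)))]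
    rw [div_lt_iff₀ (by positivity)] at hlt
    have h3 : (1 + r') / (2 * √r') * ‖deriv f 0‖ ≤ (1 + ‖w‖) / (2 * √‖w‖) * ‖deriv f 0‖ := by
      gcongr
    linarith
  choose! g hg using hsurj
  obtain ⟨r'', h1, h2⟩ := exists_between hr'
  exact ⟨f, g, r'', r', hr0.trans h1, h2, hf.deriv_ne, hf.injOn, hf.zero, hg,
    fun z hz => (hr f hf z hz).trans_lt h1⟩

/-! ### Leaves as graphs over the separatrix `{x = 0}` -/

theorem exists_tube {U : Set (ℂ × ℂ)} (hU : IsOpen U) {Q : Set ℂ} (hQ : IsCompact Q)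
    (h : ∀ y ∈ Q, ((0 : ℂ), y) ∈ U) : ∃ d > 0, ∀ x : ℂ, ‖x‖ < d → ∀ y ∈ Q, (x, y) ∈ U := by
  obtain ⟨u, v, hu, hv, hu1, hv1, huv⟩ := generalized_tube_lemma
    (isCompact_singleton (x := (0 : ℂ))) hQ hU (by rintro ⟨x, y⟩ ⟨hx, hy⟩; obtain rfl : x = 0 := hx; exact h y hy)
  obtain ⟨d, hd, hb⟩ := Metric.isOpen_iff.1 hu 0 (hu1 rfl)
  exact ⟨d, hd, fun x hx y hy => huv ⟨hb (by simpa using hx), hv1 hy⟩⟩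

namespace PreparedSaddle

variable (S : PreparedSaddle)

/-- The leaves near `{x = 0}` as graphs over a coordinate `v` of a part of the separatrix:
`y = q v`, `x = A (v, a)`, where `a` is the abscissa of the leaf on the transversal `v = vs a`.
They are obtained by integrating `d(log x)/dv = -(q'/q) / (λ (1 + x^n y K))` along segments from
`vs a`. -/
theorem exists_transverse_box {V : Set ℂ} (hVo : IsOpen V) (hVc : Convex ℝ V) {q : ℂ → ℂ}
    (hq : DifferentiableOn ℂ q V) (hq0 : ∀ v ∈ V, q v ≠ 0) {C : ℝ}
    (hC : ∀ v ∈ V, ‖deriv q v / q v‖ ≤ C) (hVb : ∀ v ∈ V, ‖v‖ ≤ C) {Q : Set ℂ} (hQ : IsCompact Q)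
    (hQU : ∀ y ∈ Q, ((0 : ℂ), y) ∈ S.U) (hqQ : MapsTo q V Q) {vs : ℂ → ℂ}
    (hvs : AnalyticAt ℂ vs 0) (hvs0 : vs 0 ∈ V) :
    ∃ ρ > 0, ∃ A : ℂ × ℂ → ℂ, ContinuousOn A (V ×ˢ Metric.ball 0 ρ) ∧
      (∀ a ∈ Metric.ball (0 : ℂ) ρ, vs a ∈ V ∧ A (vs a, a) = a) ∧ (∀ v ∈ V, A (v, 0) = 0) ∧
      ∀ v ∈ V, ∀ a ∈ Metric.ball (0 : ℂ) ρ, (A (v, a), q v) ∈ S.U ∧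
        1 + S.pert (A (v, a), q v) ≠ 0 ∧
        HasDerivAt (fun v => A (v, a))
          (-(deriv q v / q v / (S.lam * (1 + S.pert (A (v, a), q v)))) * A (v, a)) v := by
  have hlam := S.lam_pos
  obtain ⟨M, hM, hK⟩ := S.exists_bound_K
  obtain ⟨d, hd, hdU⟩ := exists_tube S.isOpen_U hQ hQU
  obtain ⟨Y, hY⟩ := hQ.isBounded.exists_norm_le
  have hC0 : 0 ≤ C := (norm_nonneg _).trans (hVb _ hvs0)
  set κ : ℝ := 2 * C / S.lam with hκ
  have hκ0 : 0 ≤ κ := by positivity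
  set δ₁ : ℝ := min (min d 1) (1 / (2 * ((|Y| + 1) * M))) with hδ₁
  have hδ₁0 : 0 < δ₁ := by positivity
  -- the perturbation is at most `1/2` for `‖x‖ < δ₁`
  have hpert : ∀ x : ℂ, ‖x‖ < δ₁ → ∀ y ∈ Q, (x, y) ∈ S.U ∧ ‖S.pert (x, y)‖ ≤ 1 / 2 := by
    intro x hx y hy
    have hU := hdU x (hx.trans_le ((min_le_left _ _).trans (min_le_left _ _))) y hy
    refine ⟨hU, ?_⟩
    have hx1 : ‖x‖ ≤ 1 := hx.le.trans ((min_le_left _ _).trans (min_le_right _ _))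
    have hxn : ‖x‖ ^ S.n ≤ δ₁ :=
      (pow_le_of_le_one (norm_nonneg _) hx1 S.n_pos.ne').trans hx.le
    rw [pert, norm_mul, norm_mul, norm_pow]
    calc ‖x‖ ^ S.n * ‖y‖ * ‖S.K (x, y)‖ ≤ 1 / (2 * ((|Y| + 1) * M)) * (|Y| + 1) * M := by
          gcongr
          · exact hxn.trans (min_le_right _ _)
          · linarith [hY y hy, le_abs_self Y]
          · exact hK _ hU
      _ = 1 / 2 := by field_simp
  obtain ⟨ρ₁, hρ₁, hball⟩ := Metric.eventually_nhds_iff_ball.1 (hvs.eventually_analyticAt.and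
    (hvs.continuousAt.eventually (hVo.mem_nhds hvs0)))
  set ρ : ℝ := min ρ₁ (δ₁ * Real.exp (-(κ * (2 * C) + 1))) with hρ
  have hρ0 : 0 < ρ := by positivity
  have hvsd : ∀ a ∈ Metric.ball (0 : ℂ) ρ, DifferentiableAt ℂ vs a := fun a ha =>
    (hball a (Metric.ball_subset_ball (min_le_left _ _) ha)).1.differentiableAt
  have hvsV : ∀ a ∈ Metric.ball (0 : ℂ) ρ, vs a ∈ V := fun a ha =>
    (hball a (Metric.ball_subset_ball (min_le_left _ _) ha)).2
  set Ω : Set (ℂ × ℂ) := (univ ×ˢ Metric.ball (0 : ℂ) ρ) ∩ (fun p => vs p.2 + p.1) ⁻¹' V with hΩ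
  have hvs2 : ∀ p : ℂ × ℂ, p.2 ∈ Metric.ball (0 : ℂ) ρ →
      DifferentiableAt ℂ (fun p : ℂ × ℂ => vs p.2 + p.1) p := fun p hp => by
    have : DifferentiableAt ℂ (fun p : ℂ × ℂ => vs p.2) p :=
      DifferentiableAt.comp (g := vs) (f := fun p : ℂ × ℂ => p.2) p (hvsd _ hp) (by fun_prop)
    exact this.add (by fun_prop)
  have hΩo : IsOpen Ω := ContinuousOn.isOpen_inter_preimage
    (fun p hp => (hvs2 p hp.2).continuousAt.continuousWithinAt)
    (isOpen_univ.prod Metric.isOpen_ball) hVo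
  have hsn : ∀ p ∈ Ω, ‖p.1‖ ≤ 2 * C := fun p hp => by
    have h1 := hVb _ hp.2
    have h2 := hVb _ (hvsV p.2 hp.1.2)
    have : p.1 = (vs p.2 + p.1) - vs p.2 := by ring
    rw [this]
    exact (norm_sub_le _ _).trans (by simp only at h1; linarith)
  have hin : ∀ p ∈ Ω, ∀ e : ℂ, ‖e‖ < κ * ‖p.1‖ + 1 → ‖p.2 * Complex.exp e‖ < δ₁ := by
    intro p hp e he
    have h1 : ‖p.2‖ < δ₁ * Real.exp (-(κ * (2 * C) + 1)) := by
      have := hp.1.2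
      rw [Metric.mem_ball, dist_zero_right] at this
      exact this.trans_le (min_le_right _ _)
    have h2 : e.re ≤ κ * (2 * C) + 1 :=
      (Complex.re_le_norm e).trans (he.le.trans (by gcongr; exact hsn p hp))
    rw [norm_mul, Complex.norm_exp]
    calc ‖p.2‖ * Real.exp e.re ≤ ‖p.2‖ * Real.exp (κ * (2 * C) + 1) := by gcongr
      _ < δ₁ * Real.exp (-(κ * (2 * C) + 1)) * Real.exp (κ * (2 * C) + 1) := by gcongr
      _ = δ₁ := by rw [mul_assoc, ← Real.exp_add]; simp
  have hone : ∀ z : ℂ, ‖z‖ ≤ 1 / 2 → 1 / 2 ≤ ‖1 + z‖ := fun z hz => by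
    have := norm_sub_norm_le 1 (-z)
    rw [norm_one, norm_neg, sub_neg_eq_add] at this
    linarith
  set m : (ℂ × ℂ) × ℂ → ℂ × ℂ := fun r => (r.1.2 * Complex.exp r.2, q (vs r.1.2 + r.1.1)) with hm
  set F : (ℂ × ℂ) × ℂ → ℂ := fun r =>
    -(deriv q (vs r.1.2 + r.1.1) / q (vs r.1.2 + r.1.1) / (S.lam * (1 + S.pert (m r)))) with hF
  have hmU : ∀ r : (ℂ × ℂ) × ℂ, r.1 ∈ Ω → ‖r.2‖ < κ * ‖r.1.1‖ + 1 →
      m r ∈ S.U ∧ ‖S.pert (m r)‖ ≤ 1 / 2 := fun r h1 h2 =>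
    hpert _ (hin r.1 h1 r.2 h2) _ (hqQ h1.2)
  obtain ⟨E, hEd, hEb, hE'⟩ := exists_solution_along_rays (F := F) hΩo (κ := κ) (δ := 1)
    (by
      rintro p ⟨⟨-, hp⟩, hpV⟩ u ⟨hu0, hu1⟩
      refine ⟨⟨mem_univ _, hp⟩, ?_⟩
      have := hVc (hvsV p.2 hp) hpV (sub_nonneg.2 hu1) hu0 (by ring)
      simp only [mem_preimage]
      convert this using 1
      simp only [Complex.real_smul]
      push_cast
      ring) hκ0 one_pos
    (by
      intro r hr
      have hvr : vs r.1.2 + r.1.1 ∈ V := hr.1.2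
      have d0 : DifferentiableAt ℂ (fun r : (ℂ × ℂ) × ℂ => vs r.1.2 + r.1.1) r :=
        DifferentiableAt.comp (g := fun p : ℂ × ℂ => vs p.2 + p.1)
          (f := fun r : (ℂ × ℂ) × ℂ => r.1) r (hvs2 r.1 hr.1.1.2) (by fun_prop)
      have d1 : DifferentiableAt ℂ (fun r : (ℂ × ℂ) × ℂ => q (vs r.1.2 + r.1.1)) r :=
        DifferentiableAt.comp (g := q) r (hq.differentiableAt (hVo.mem_nhds hvr)) d0
      have d2 : DifferentiableAt ℂ (fun r : (ℂ × ℂ) × ℂ => deriv q (vs r.1.2 + r.1.1)) r :=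
        DifferentiableAt.comp (g := deriv q) r
          ((hq.deriv hVo).differentiableAt (hVo.mem_nhds hvr)) d0
      have d3 : DifferentiableAt ℂ m r :=
        DifferentiableAt.prodMk (by fun_prop) d1
      obtain ⟨h1, h2⟩ := hmU r hr.1 hr.2
      have d4 : DifferentiableAt ℂ (fun r => S.pert (m r)) r :=
        DifferentiableAt.comp (g := S.pert) r
          (S.differentiableOn_pert.differentiableAt (S.isOpen_U.mem_nhds h1)) d3
      have hne : S.lam * (1 + S.pert (m r)) ≠ 0 := by
        refine mul_ne_zero S.lam_ne fun h => ?_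
        have := hone _ h2
        rw [h, norm_zero] at this
        norm_num at this
      have d5 : DifferentiableAt ℂ (fun r => (S.lam : ℂ) * (1 + S.pert (m r))) r :=
        (d4.const_add 1).const_mul _
      simp only [hF, div_eq_mul_inv]
      exact ((d2.mul (d1.inv (hq0 _ hvr))).mul (d5.inv hne)).fun_neg.differentiableWithinAt)
    (by
      intro r h1 h2
      obtain ⟨h3, h4⟩ := hmU r h1 h2
      have h5 := hone _ h4
      have h6 := hC _ h1.2
      simp only [hF]
      rw [norm_neg, norm_div, norm_mul, Complex.norm_real, Real.norm_eq_abs, abs_of_pos hlam, hκ]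
      calc _ ≤ C / (S.lam * (1 / 2)) := by gcongr
        _ = 2 * C / S.lam := by field_simp)
  have hΩ' : ∀ v ∈ V, ∀ a ∈ Metric.ball (0 : ℂ) ρ, (v - vs a, a) ∈ Ω := fun v hv a ha =>
    ⟨⟨mem_univ _, ha⟩, by simpa using hv⟩
  refine ⟨ρ, hρ0, fun p => p.2 * Complex.exp (E (p.1 - vs p.2, p.2)), ?_, fun a ha =>
    ⟨hvsV a ha, ?_⟩, fun v _ => by simp, fun v hv a ha => ?_⟩
  · refine continuousOn_snd.mul (ContinuousOn.cexp (hEd.continuousOn.comp (ContinuousOn.prodMk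
      (continuousOn_fst.sub fun p hp => ?_) continuousOn_snd) fun p hp => hΩ' _ hp.1 _ hp.2))
    exact ((hvsd p.2 hp.2).continuousAt.comp continuousAt_snd).continuousWithinAt
  · have : E (vs a - vs a, a) = 0 := by
      simpa using hEb (vs a - vs a, a) (hΩ' _ (hvsV a ha) a ha)
    simp only [this]; simp
  · have hp := hΩ' v hv a ha
    have hEp : ‖E (v - vs a, a)‖ < κ * ‖v - vs a‖ + 1 := (hEb _ hp).trans_lt (lt_add_one _)
    obtain ⟨h1, h2⟩ := hmU ((v - vs a, a), E (v - vs a, a)) hp hEp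
    simp only [hm, add_sub_cancel] at h1 h2
    refine ⟨h1, fun h => ?_, ?_⟩
    · have := hone _ h2
      rw [h, norm_zero] at this
      norm_num at this
    · have h3 := HasDerivAt.comp v (hE' _ hp) ((hasDerivAt_id v).sub_const (vs a))
      refine (h3.cexp.const_mul a).congr_deriv ?_
      simp only [hF, hm, add_sub_cancel, Function.comp, id]
      ring

end PreparedSaddle

/-! ### A coordinate on the universal cover of the punctured separatrix -/

/-- A continuous function `v` is locally the composition of `f ∘ v` with a local inverse of `f`. -/
theorem exists_eventuallyEq_comp_of_continuousAt {f : ℂ → ℂ} {f' : ℂ} {E : Type*} [NormedAddCommGroup E]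
    [NormedSpace ℝ E] {v : E → ℂ} {t : E} (hf : HasStrictDerivAt f f' (v t)) (hf' : f' ≠ 0)
    (hv : ContinuousAt v t) : ∃ g : ℂ → ℂ, HasDerivAt g f'⁻¹ (f (v t)) ∧ ∀ᶠ u in 𝓝 t, v u = g (f (v u)) := by
  obtain ⟨g, -, hg2, hg3, -⟩ := exists_local_inverse hf hf'
  exact ⟨g, hg2.hasDerivAt, (hv.eventually hg3).mono fun u hu => hu.symm⟩

/-- Holomorphic branches of the logarithm on simply connected sets. -/
theorem exists_log_branch {U : Set ℂ} (hUo : IsOpen U) (hUc : IsSimplyConnected U) {m : ℂ → ℂ}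
    (hm : ∀ z ∈ U, DifferentiableAt ℂ m z) (hm0 : ∀ z ∈ U, m z ≠ 0) :
    ∃ q : ℂ → ℂ, ∀ z ∈ U, Complex.exp (q z) = m z ∧ DifferentiableAt ℂ q z := by
  obtain ⟨q, hqc, hq⟩ := Complex.exists_continuousOn_eqOn_exp_comp hUc hUo (g := m)
    (fun z hz => (hm z hz).continuousAt.continuousWithinAt)
    (by rintro ⟨z, hz, h⟩; exact hm0 z hz h)
  refine ⟨q, fun z hz => ⟨hq hz, ?_⟩⟩
  have hqz : ContinuousAt q z := hqc.continuousAt (hUo.mem_nhds hz)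
  obtain ⟨g, hg, hqg⟩ := exists_eventuallyEq_comp_of_continuousAt (Complex.hasStrictDerivAt_exp (q z))
    (Complex.exp_ne_zero _) hqz
  have h1 : ∀ᶠ x in 𝓝 z, q x = g (m x) := by
    filter_upwards [hqg, hUo.mem_nhds hz] with x hx hxU
    rw [hx]; exact congrArg g (hq hxU)
  have h2 : HasDerivAt g (Complex.exp (q z))⁻¹ (m z) := by
    have : Complex.exp (q z) = m z := hq hz
    rw [this] at hg ⊢; exact hg
  exact (h2.differentiableAt.comp z (hm z hz)).congr_of_eventuallyEq h1

theorem hasDerivAt_inverse_of_injOn {U : Set ℂ} (hUo : IsOpen U) {f g : ℂ → ℂ} {R : ℝ}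
    (hf : ∀ z ∈ U, deriv f z ≠ 0) (hfi : InjOn f U) (hg : ∀ w, ‖w‖ < R → g w ∈ U ∧ f (g w) = w)
    {w : ℂ} (hw : ‖w‖ < R) : HasDerivAt g (deriv f (g w))⁻¹ w := by
  obtain ⟨hgU, hfg⟩ := hg w hw
  have han : AnalyticAt ℂ f (g w) := DifferentiableOn.analyticAt
    (fun z hz => (differentiableAt_of_deriv_ne_zero (hf z hz)).differentiableWithinAt)
    (hUo.mem_nhds hgU)
  obtain ⟨k, hk1, hk2, -, hk4⟩ := exists_local_inverse han.hasStrictDerivAt (hf _ hgU)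
  rw [hfg] at hk1 hk2 hk4
  refine hk2.hasDerivAt.congr_of_eventuallyEq ?_
  have h1 : ∀ᶠ y in 𝓝 w, k y ∈ U := by
    have : Tendsto k (𝓝 w) (𝓝 (g w)) := by
      have := hk2.hasDerivAt.continuousAt.tendsto
      rwa [hk1] at this
    exact this.eventually (hUo.mem_nhds hgU)
  have h2 : ∀ᶠ y in 𝓝 w, ‖y‖ < R := continuousAt_id.norm.eventually (gt_mem_nhds hw)
  filter_upwards [h1, h2, hk4] with y e1 e2 e3
  exact hfi (hg y e2).1 e1 (by rw [(hg y e2).2, e3])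

/-- In the universal cover of a punctured simply connected set `U ∖ {0}`, a path `y` with ends in a
small disk `‖y‖ < η` can be replaced by one staying over that disk. With `f` a conformal coordinate
of `U`, the covering map is `q w = f⁻¹ (exp w)`, on a convex set `V` of bounded logarithms; `v` is a
lift of `y`, and `vh` is a path over the small disk with the same ends as `v`. -/
theorem exists_covering_coordinate {U : Set ℂ} (hUo : IsOpen U) (hUc : IsSimplyConnected U)
    {η : ℝ} (hη : 0 < η) (hηU : Metric.closedBall 0 η ⊆ U) {y : ℝ → ℂ} (hy : Continuous y)
    (hyU : ∀ t, y t ∈ U ∧ y t ≠ 0) (h0 : ‖y 0‖ < η) (h1 : ‖y 1‖ < η) :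
    ∃ (V : Set ℂ) (f q : ℂ → ℂ) (v vh : ℝ → ℂ) (C : ℝ) (Q : Set ℂ), IsOpen V ∧ Convex ℝ V ∧
      (∀ z ∈ U, DifferentiableAt ℂ f z) ∧ (∀ z ∈ U, z ≠ 0 → f z ≠ 0) ∧
      (∀ w ∈ V, DifferentiableAt ℂ q w ∧ deriv q w ≠ 0 ∧ q w ≠ 0 ∧ ‖deriv q w / q w‖ ≤ C ∧
        ‖w‖ ≤ C ∧ ∀ z ∈ U, Complex.exp w = f z → q w = z) ∧
      IsCompact Q ∧ Q ⊆ U ∧ MapsTo q V Q ∧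
      Continuous v ∧ (∀ t ∈ Icc (0 : ℝ) 1, v t ∈ V) ∧ (∀ t, Complex.exp (v t) = f (y t)) ∧
      (∀ t ∈ Icc (0 : ℝ) 1, DifferentiableAt ℝ vh t ∧ vh t ∈ V ∧ ‖q (vh t)‖ < η) ∧
      vh 0 = v 0 ∧ vh 1 = v 1 := by
  have h0U : (0 : ℂ) ∈ U := hηU (Metric.mem_closedBall_self hη.le)
  set Kc : Set ℂ := y '' Icc 0 1 ∪ Metric.closedBall 0 η with hKc
  obtain ⟨f, g, r, R, hr, hrR, hfd, hfi, hf0, hg, hfr⟩ := exists_conformal_disk hUo hUc h0U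
    (Q := Kc) ((isCompact_Icc.image hy).union (isCompact_closedBall _ _))
    (union_subset (by rintro _ ⟨t, -, rfl⟩; exact (hyU t).1) hηU)
  have hR : 0 < R := hr.trans hrR
  have hfD : ∀ z ∈ U, DifferentiableAt ℂ f z := fun z hz =>
    differentiableAt_of_deriv_ne_zero (hfd z hz)
  have hfne : ∀ z ∈ U, z ≠ 0 → f z ≠ 0 := fun z hz h h' => h (hfi hz h0U (h'.trans hf0.symm))
  have hexpR : ∀ w : ℂ, w.re < Real.log R → ‖Complex.exp w‖ < R := fun w hw => by
    rw [Complex.norm_exp]; exact (Real.lt_log_iff_exp_lt hR).1 hw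
  set q : ℂ → ℂ := fun w => g (Complex.exp w) with hq
  have hqd : ∀ w : ℂ, w.re < Real.log R →
      HasDerivAt q ((deriv f (q w))⁻¹ * Complex.exp w) w := fun w hw =>
    (hasDerivAt_inverse_of_injOn hUo hfd hfi hg (hexpR w hw)).comp w (Complex.hasDerivAt_exp w)
  have hqU : ∀ w : ℂ, w.re < Real.log R → q w ∈ U ∧ f (q w) = Complex.exp w := fun w hw =>
    hg _ (hexpR w hw)
  have hq0 : ∀ w : ℂ, w.re < Real.log R → q w ≠ 0 := fun w hw h => by
    have := (hqU w hw).2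
    rw [h, hf0] at this
    exact Complex.exp_ne_zero w this.symm
  -- lift of `y`
  obtain ⟨v, hvc, hv⟩ := Complex.exists_continuousOn_eqOn_exp_comp (X := ℝ) (U := univ)
    (g := fun t => f (y t)) (by
      have : SimplyConnectedSpace (univ : Set ℝ) :=
        (Homeomorph.Set.univ ℝ).toHomotopyEquiv.simplyConnectedSpace
      exact this) isOpen_univ
    (fun t _ => ((hfD _ (hyU t).1).continuousAt.comp hy.continuousAt).continuousWithinAt)
    (by rintro ⟨t, -, h⟩; exact hfne _ (hyU t).1 (hyU t).2 h)
  have hv' : ∀ t, Complex.exp (v t) = f (y t) := fun t => hv (mem_univ t)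
  -- on the disk of radius `η`, `f z = z * exp (l z)`
  obtain ⟨l, hl⟩ := exists_log_branch (U := Metric.ball 0 η) Metric.isOpen_ball
    (by
      have : ContractibleSpace (Metric.ball (0 : ℂ) η) :=
        (convex_ball 0 η).contractibleSpace ⟨0, Metric.mem_ball_self hη⟩
      exact (inferInstance : SimplyConnectedSpace (Metric.ball (0 : ℂ) η)))
    (m := dslope f 0) (fun z hz => by
      refine DifferentiableOn.differentiableAt (s := U) ?_ (hUo.mem_nhds (hηU (Metric.ball_subset_closedBall hz)))
      exact (Complex.differentiableOn_dslope (hUo.mem_nhds h0U)).2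
        fun z hz => (hfD z hz).differentiableWithinAt)
    (fun z hz => by
      have hzU := hηU (Metric.ball_subset_closedBall hz)
      rcases eq_or_ne z 0 with rfl | hz0
      · rw [dslope_same]; exact hfd _ h0U
      · rw [dslope_of_ne _ hz0, slope_def_field, hf0]
        exact div_ne_zero (by simpa using hfne z hzU hz0) (by simpa using hz0))
  have hfl : ∀ z ∈ Metric.ball (0 : ℂ) η, f z = z * Complex.exp (l z) := fun z hz => by
    rw [(hl z hz).1]
    have := sub_smul_dslope f 0 z
    simpa [hf0] using this.symm
  have hvcont : Continuous v := by rwa [continuousOn_univ] at hvc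
  set u₀ : ℂ := v 0 - l (y 0) with hu₀
  set u₁ : ℂ := v 1 - l (y 1) with hu₁
  have hu : ∀ t z, v t - l (y t) = z → ‖y t‖ < η → Complex.exp z = y t ∧ z.re < Real.log η := by
    rintro t z rfl hlt
    have hmem : y t ∈ Metric.ball (0 : ℂ) η := by simpa using hlt
    have h2 : Complex.exp (v t - l (y t)) = y t := by
      rw [Complex.exp_sub, hv', hfl _ hmem, mul_div_cancel_right₀ _ (Complex.exp_ne_zero _)]
    refine ⟨h2, ?_⟩
    rw [Real.lt_log_iff_exp_lt hη, ← Complex.norm_exp, h2]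
    exact hlt
  obtain ⟨he0, hr0⟩ := hu 0 u₀ rfl h0
  obtain ⟨he1, hr1⟩ := hu 1 u₁ rfl h1
  set uh : ℝ → ℂ := fun t => (1 - t : ℂ) * u₀ + t * u₁ with huh
  have huhη : ∀ t ∈ Icc (0 : ℝ) 1, Complex.exp (uh t) ∈ Metric.ball (0 : ℂ) η := by
    rintro t ⟨ht0, ht1⟩
    rw [mem_ball_zero_iff, Complex.norm_exp, ← Real.lt_log_iff_exp_lt hη]
    have h3 : (uh t).re = (1 - t) * u₀.re + t * u₁.re := by simp [huh]
    rw [h3]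
    rcases ht0.eq_or_lt with h | h
    · rw [← h]; simpa using hr0
    · nlinarith
  set vh : ℝ → ℂ := fun t => uh t + l (Complex.exp (uh t)) with hvh
  have hvhd : ∀ t ∈ Icc (0 : ℝ) 1, DifferentiableAt ℝ vh t := fun t ht => by
    have d1 : DifferentiableAt ℝ uh t := by
      simp only [huh]
      have : DifferentiableAt ℝ (fun t : ℝ => (t : ℂ)) t := Complex.ofRealCLM.differentiableAt
      fun_prop
    have d2 : DifferentiableAt ℝ (fun t => Complex.exp (uh t)) t := d1.cexp
    have d3 : DifferentiableAt ℝ l (Complex.exp (uh t)) :=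
      (hl _ (huhη t ht)).2.restrictScalars ℝ
    exact d1.add (DifferentiableAt.comp (g := l) t d3 d2)
  have hvhe : ∀ t ∈ Icc (0 : ℝ) 1, Complex.exp (vh t) = f (Complex.exp (uh t)) := fun t ht => by
    rw [hfl _ (huhη t ht), hvh, Complex.exp_add]
  have hre : ∀ (w : ℂ) (z : ℂ), z ∈ Kc → Complex.exp w = f z → w.re < Real.log r := by
    intro w z hz hw
    rw [Real.lt_log_iff_exp_lt hr, ← Complex.norm_exp, hw]
    exact hfr z hz
  have hvre : ∀ t ∈ Icc (0 : ℝ) 1, (v t).re < Real.log r := fun t ht =>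
    hre _ (y t) (Or.inl ⟨t, ht, rfl⟩) (hv' t)
  have hvhre : ∀ t ∈ Icc (0 : ℝ) 1, (vh t).re < Real.log r := fun t ht =>
    hre _ _ (Or.inr (Metric.ball_subset_closedBall (huhη t ht))) (hvhe t ht)
  obtain ⟨C₁, hC₁⟩ := (isCompact_Icc.image hvcont (s := Icc (0 : ℝ) 1)).isBounded.exists_norm_le
  obtain ⟨C₂, hC₂⟩ := (isCompact_Icc.image_of_continuousOn (f := vh) (s := Icc (0 : ℝ) 1)
    fun t ht => (hvhd t ht).continuousAt.continuousWithinAt).isBounded.exists_norm_le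
  set C₃ : ℝ := max C₁ C₂ + 1 with hC₃
  have hlog : Real.log r < Real.log R := Real.log_lt_log hr hrR
  set W : Set ℂ := Metric.closedBall 0 C₃ ∩ {w | w.re ≤ Real.log r} with hW
  have hWc : IsCompact W := (isCompact_closedBall _ _).inter_right
    (isClosed_le Complex.continuous_re continuous_const)
  have hWR : ∀ w ∈ W, w.re < Real.log R := fun w hw => lt_of_le_of_lt hw.2 hlog
  have hHo : IsOpen {w : ℂ | w.re < Real.log R} := isOpen_lt Complex.continuous_re continuous_const
  have hqD : DifferentiableOn ℂ q {w : ℂ | w.re < Real.log R} := fun w hw =>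
    (hqd w hw).differentiableAt.differentiableWithinAt
  have hqc : ContinuousOn (fun w => deriv q w / q w) W :=
    ((hqD.deriv hHo).continuousOn.mono hWR).div (hqD.continuousOn.mono hWR)
      fun w hw => hq0 w (hWR w hw)
  obtain ⟨C₄, hC₄⟩ := (hWc.image_of_continuousOn hqc).isBounded.exists_norm_le
  set V : Set ℂ := Metric.ball 0 C₃ ∩ {w | w.re < Real.log r} with hV
  have hVW : V ⊆ W := fun w hw => ⟨Metric.ball_subset_closedBall hw.1,
    show w.re ≤ Real.log r from le_of_lt hw.2⟩
  refine ⟨V, f, q, v, vh, max C₃ C₄, q '' W, Metric.isOpen_ball.inter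
    (isOpen_lt Complex.continuous_re continuous_const), (convex_ball _ _).inter
    (convex_halfSpace_re_lt _), hfD, hfne, ?_, hWc.image_of_continuousOn (hqD.continuousOn.mono hWR),
    ?_, fun w hw => ⟨w, hVW hw, rfl⟩, hvcont, ?_, hv', ?_, ?_, ?_⟩
  · intro w hw
    have hwR := hWR w (hVW hw)
    refine ⟨(hqd w hwR).differentiableAt, ?_, hq0 w hwR, ?_, ?_, fun z hz hwz => ?_⟩
    · rw [(hqd w hwR).deriv]
      exact mul_ne_zero (inv_ne_zero (hfd _ (hqU w hwR).1)) (Complex.exp_ne_zero _)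
    · exact (hC₄ _ ⟨w, hVW hw, rfl⟩).trans (le_max_right _ _)
    · exact (mem_ball_zero_iff.1 hw.1).le.trans (le_max_left _ _)
    · exact hfi (hqU w hwR).1 hz ((hqU w hwR).2.trans hwz)
  · rintro _ ⟨w, hw, rfl⟩
    exact (hqU w (hWR w hw)).1
  · intro t ht
    refine ⟨mem_ball_zero_iff.2 ?_, hvre t ht⟩
    linarith [hC₁ _ ⟨t, ht, rfl⟩, le_max_left C₁ C₂]
  · intro t ht
    refine ⟨hvhd t ht, ⟨mem_ball_zero_iff.2 ?_, hvhre t ht⟩, ?_⟩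
    · linarith [hC₂ _ ⟨t, ht, rfl⟩, le_max_right C₁ C₂]
    · have hR' : (vh t).re < Real.log R := (hvhre t ht).trans hlog
      have : q (vh t) = Complex.exp (uh t) := hfi (hqU _ hR').1
        (hηU (Metric.ball_subset_closedBall (huhη t ht))) ((hqU _ hR').2.trans (hvhe t ht))
      rw [this]
      exact mem_ball_zero_iff.1 (huhη t ht)
  · have e : uh 0 = u₀ := by simp [huh]
    change uh 0 + l (Complex.exp (uh 0)) = v 0
    rw [e, he0, hu₀, sub_add_cancel]
  · have e : uh 1 = u₁ := by simp [huh]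
    change uh 1 + l (Complex.exp (uh 1)) = v 1
    rw [e, he1, hu₁, sub_add_cancel]

/-! ### Holonomy along small paths -/

namespace PreparedSaddle

variable {S : PreparedSaddle}

/-- Holonomy relations between germs with base points in a disk `‖y‖ < η` of `{x = 0}` are
realized by the same holonomy germ along leaf paths staying over this disk. The deformation which
defines the holonomy is written as `v = w x t` in the coordinate of the universal cover of a
punctured part of `{x = 0}`; in the box `V` where the leaves are graphs `x = A (v, a)`, only the
ends of the paths matter. -/
theorem HolRel.exists_small {R₀ R₁ : RegGerm} (h : S.HolRel R₀ R₁) {η : ℝ} (hη : 0 < η)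
    (hηU : ∀ y : ℂ, ‖y‖ ≤ η → ((0 : ℂ), y) ∈ S.U) (h0 : ‖R₀.α 0‖ < η) (h1 : ‖R₁.α 0‖ < η) :
    ∃ (c : ℝ → ℂ × ℂ) (k : ℂ → ℂ), S.IsLeafPath c ∧ c 0 = (0, R₀.α 0) ∧ c 1 = (0, R₁.α 0) ∧
      (∀ t ∈ Icc (0 : ℝ) 1, (c t).1 = 0 ∧ ‖(c t).2‖ < η) ∧
      S.IsHolonomy R₀.α R₁.α 0 c k ∧ ∀ᶠ y in 𝓝 0, R₁.r y = k (R₀.r y) := by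
  obtain ⟨c, hh, hc, hc0, hc1, ⟨N, hN, H, HC, H0, HN⟩, hr⟩ := h
  have hx0 := hc.fst_eq_zero (by rw [hc0])
  set U₀ : Set ℂ := {y | ((0 : ℂ), y) ∈ S.U} with hU₀
  have hU₀o : IsOpen U₀ := S.isOpen_U.preimage (by fun_prop : Continuous fun y : ℂ => ((0 : ℂ), y))
  have h01 : (0 : ℝ) ≤ 1 := zero_le_one
  set π : ℝ → ℝ := fun t => projIcc (0 : ℝ) 1 h01 t with hπ
  have hπc : Continuous π := continuous_subtype_val.comp continuous_projIcc
  have hπI : ∀ t, π t ∈ Icc (0 : ℝ) 1 := fun t => (projIcc (0 : ℝ) 1 h01 t).2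
  have hπt : ∀ t ∈ Icc (0 : ℝ) 1, π t = t := fun t ht => by
    simp only [hπ, projIcc_of_mem h01 ht]
  have hI0 : (0 : ℝ) ∈ Icc (0 : ℝ) 1 := left_mem_Icc.2 h01
  have hI1 : (1 : ℝ) ∈ Icc (0 : ℝ) 1 := right_mem_Icc.2 h01
  set y : ℝ → ℂ := fun t => (c (π t)).2 with hy
  have hct : ∀ t ∈ Icc (0 : ℝ) 1, c t = (0, y t) := fun t ht => by
    simp only [hy, hπt t ht]; exact Prod.ext (hx0 t ht) rfl
  have hyc : Continuous y := continuous_snd.comp (hc.1.comp_continuous hπc hπI)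
  have hyU : ∀ t, y t ∈ U₀ ∧ y t ≠ 0 := fun t => by
    obtain ⟨e1, e2⟩ := hc.2.1 (π t) (hπI t)
    have e3 : c (π t) = (0, y t) := Prod.ext (hx0 _ (hπI t)) rfl
    rw [e3] at e1 e2
    exact ⟨e1, fun e => e2 (by rw [e]; rfl)⟩
  have hy0 : y 0 = R₀.α 0 := by simp only [hy, hπt 0 hI0, hc0]
  have hy1 : y 1 = R₁.α 0 := by simp only [hy, hπt 1 hI1, hc1]
  obtain ⟨V, f, q, v, vh, C, Q, hVo, hVc, hfd, hfne, hqV, hQ, hQU, hqQ, hv, hvV, hve, hvh, hvh0, hvh1⟩ :=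
    exists_covering_coordinate hU₀o S.simplyConnected_vertical hη
      (fun z hz => hηU z (by simpa using hz)) hyc hyU (by rwa [hy0]) (by rwa [hy1])
  have hq : DifferentiableOn ℂ q V := fun w hw => (hqV w hw).1.differentiableWithinAt
  have hfα : f (R₀.α 0) ≠ 0 := by
    rw [← hy0]; exact hfne _ (hyU 0).1 (hyU 0).2
  have hα0U : R₀.α 0 ∈ U₀ := by rw [← hy0]; exact (hyU 0).1
  -- coordinate of the transversal of `R₀`
  set vs : ℂ → ℂ := fun a => v 0 + Complex.log (f (R₀.α a) / f (R₀.α 0)) with hvs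
  have hvsa : AnalyticAt ℂ vs 0 := by
    have h2 : AnalyticAt ℂ f (R₀.α 0) := DifferentiableOn.analyticAt
      (fun z hz => (hfd z hz).differentiableWithinAt) (hU₀o.mem_nhds hα0U)
    have h3 : AnalyticAt ℂ (fun a => f (R₀.α a) / f (R₀.α 0)) 0 :=
      (AnalyticAt.comp (g := f) (f := R₀.α) h2 R₀.analytic_α).div analyticAt_const hfα
    exact analyticAt_const.add (h3.clog (by rw [div_self hfα]; exact Complex.one_mem_slitPlane))
  have hvs0 : vs 0 = v 0 := by simp [hvs, div_self hfα]
  obtain ⟨ρ, hρ, A, hAc, hAvs, hA0, hA⟩ := S.exists_transverse_box hVo hVc hq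
    (fun w hw => (hqV w hw).2.2.1) (fun w hw => (hqV w hw).2.2.2.1)
    (fun w hw => (hqV w hw).2.2.2.2.1) hQ hQU hqQ hvsa (by rw [hvs0]; exact hvV 0 hI0)
  -- curves in the box are leaf paths
  have hbox : ∀ a ∈ Metric.ball (0 : ℂ) ρ, ∀ (w : ℝ → ℂ) (t : ℝ), w t ∈ V → DifferentiableAt ℝ w t →
      ∃ k : ℂ, HasDerivAt (fun t => (A (w t, a), q (w t))) (k • S.X (A (w t, a), q (w t))) t := by
    intro a ha w t hwV hw
    obtain ⟨e1, e2, e3⟩ := hA (w t) hwV a ha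
    have hq0 := (hqV _ hwV).2.2.1
    have d1 := HasDerivAt.scomp t e3 hw.hasDerivAt
    have d2 := HasDerivAt.scomp t (hqV _ hwV).1.hasDerivAt hw.hasDerivAt
    refine ⟨-(deriv w t * (deriv q (w t) / q (w t) / (S.lam * (1 + S.pert (A (w t, a), q (w t)))))),
      (d1.prodMk d2).congr_deriv ?_⟩
    have hl := S.lam_ne
    rw [X_def]
    refine Prod.ext ?_ ?_
    · simp only [smul_eq_mul, Prod.smul_mk]; ring
    · simp only [smul_eq_mul, Prod.smul_mk]; field_simp
  -- coordinate of the moving path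
  set Hp : ℂ → ℝ → ℂ × ℂ := fun x t => H x (π t) with hHp
  set w : ℂ → ℝ → ℂ := fun x t => v t + Complex.log (f (Hp x t).2 / f (y t)) with hw
  have hHp0 : ∀ t, (Hp 0 t).2 = y t := fun t => by simp only [hHp, hy, H0 _ (hπI t)]
  have hw0 : ∀ t, w 0 t = v t := fun t => by
    simp only [hw, hHp0]
    rw [div_self (hfne _ (hyU t).1 (hyU t).2)]; simp
  have hHpc : ContinuousOn (Function.uncurry Hp) (N ×ˢ univ) := by
    have : ContinuousOn (fun p : ℂ × ℝ => (p.1, π p.2)) (N ×ˢ univ) := by fun_prop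
    exact HC.comp this fun p hp => ⟨hp.1, hπI _⟩
  set N' := interior N with hN'
  have hHpc' : ∀ x ∈ N', ∀ t, ContinuousAt (Function.uncurry Hp) (x, t) := fun x hx t =>
    hHpc.continuousAt (prod_mem_nhds (mem_interior_iff_mem_nhds.1 hx) univ_mem)
  have h0N' : (0 : ℂ) ∈ N' := mem_interior_iff_mem_nhds.2 hN
  set good : ℂ → ℝ → Prop := fun x t => (Hp x t).2 ∈ U₀ ∧ f (Hp x t).2 / f (y t) ∈ Complex.slitPlane
    with hgood
  have hratc : ∀ x ∈ N', ∀ t, (Hp x t).2 ∈ U₀ →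
      ContinuousAt (fun p : ℂ × ℝ => f (Hp p.1 p.2).2 / f (y p.2)) (x, t) := by
    intro x hx t hU
    have e1 : ContinuousAt (fun p : ℂ × ℝ => (Hp p.1 p.2).2) (x, t) :=
      continuousAt_snd.comp (hHpc' x hx t)
    have e2 : ContinuousAt (fun p : ℂ × ℝ => f (Hp p.1 p.2).2) (x, t) :=
      ContinuousAt.comp (g := f) (f := fun p : ℂ × ℝ => (Hp p.1 p.2).2) (hfd _ hU).continuousAt e1
    have e3 : ContinuousAt (fun p : ℂ × ℝ => f (y p.2)) (x, t) :=
      ContinuousAt.comp (g := f) (f := fun p : ℂ × ℝ => y p.2) (hfd _ (hyU t).1).continuousAt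
        (by fun_prop)
    exact e2.div e3 (hfne _ (hyU t).1 (hyU t).2)
  have hwc : ∀ x ∈ N', ∀ t, good x t → ContinuousAt (Function.uncurry w) (x, t) := by
    intro x hx t hg
    exact (hv.continuousAt.comp continuousAt_snd).add ((hratc x hx t hg.1).clog hg.2)
  have hgood0 : ∀ t, good 0 t := fun t => by
    refine ⟨by rw [hHp0]; exact (hyU t).1, ?_⟩
    rw [hHp0, div_self (hfne _ (hyU t).1 (hyU t).2)]
    exact Complex.one_mem_slitPlane
  -- a deformation of `vh` with the same ends as `w x`
  set wh : ℂ → ℝ → ℂ := fun x t => vh t + (1 - t) * (w x 0 - v 0) + t * (w x 1 - v 1) with hwh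
  have hwhc : ∀ x ∈ N', good x 0 → good x 1 → ∀ t ∈ Icc (0 : ℝ) 1,
      ContinuousAt (Function.uncurry wh) (x, t) := by
    intro x hx hg0 hg1 t ht
    have e : ∀ s, good x s → ContinuousAt (fun p : ℂ × ℝ => w p.1 s) (x, t) := fun s hs =>
      ContinuousAt.comp (g := Function.uncurry w) (f := fun p : ℂ × ℝ => (p.1, s)) (hwc x hx s hs)
        (by fun_prop)
    have e1 : ContinuousAt (fun p : ℂ × ℝ => vh p.2) (x, t) :=
      (hvh t ht).1.continuousAt.comp continuousAt_snd
    have e2 : ContinuousAt (fun p : ℂ × ℝ => (p.2 : ℂ)) (x, t) := by fun_prop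
    exact (e1.add ((continuousAt_const.sub e2).mul ((e 0 hg0).sub continuousAt_const))).add
      (e2.mul ((e 1 hg1).sub continuousAt_const))
  have hev : ∀ᶠ x in 𝓝 (0 : ℂ), ∀ t ∈ Icc (0 : ℝ) 1, good x t ∧ w x t ∈ V ∧ wh x t ∈ V := by
    refine isCompact_Icc.eventually_forall_of_forall_eventually fun t ht => ?_
    have e1 : ∀ᶠ p : ℂ × ℝ in 𝓝 (0, t), (Hp p.1 p.2).2 ∈ U₀ :=
      (continuousAt_snd.comp (hHpc' 0 h0N' t)).eventually (hU₀o.mem_nhds (hgood0 t).1)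
    have e2 := (hratc 0 h0N' t (hgood0 t).1).eventually
      (Complex.isOpen_slitPlane.mem_nhds (hgood0 t).2)
    have e3 := (hwc 0 h0N' t (hgood0 t)).eventually (hVo.mem_nhds (by
      simp only [Function.uncurry, hw0]; exact hvV t ht))
    have e4 := (hwhc 0 h0N' (hgood0 0) (hgood0 1) t ht).eventually (hVo.mem_nhds (by
      simp only [Function.uncurry, hwh, hw0, sub_self, mul_zero, add_zero]; exact (hvh t ht).2.1))
    filter_upwards [e1, e2, e3, e4] with p a1 a2 a3 a4 using ⟨⟨a1, a2⟩, a3, a4⟩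
  obtain ⟨ρ', hρ', hball⟩ := Metric.eventually_nhds_iff_ball.1
    ((hev.and (isOpen_interior.mem_nhds h0N')).and (Metric.ball_mem_nhds (0 : ℂ) hρ))
  have hgx : ∀ x ∈ Metric.ball (0 : ℂ) ρ', ∀ t ∈ Icc (0 : ℝ) 1,
      good x t ∧ w x t ∈ V ∧ wh x t ∈ V := fun x hx => (hball x hx).1.1
  have hNx : ∀ x ∈ Metric.ball (0 : ℂ) ρ', x ∈ N' := fun x hx => (hball x hx).1.2
  have hρx : ∀ x ∈ Metric.ball (0 : ℂ) ρ', x ∈ Metric.ball (0 : ℂ) ρ := fun x hx => (hball x hx).2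
  have hqw : ∀ x ∈ Metric.ball (0 : ℂ) ρ', ∀ t ∈ Icc (0 : ℝ) 1, q (w x t) = (H x t).2 := by
    intro x hx t ht
    obtain ⟨hg, hV, -⟩ := hgx x hx t ht
    have e : Hp x t = H x t := by simp only [hHp, hπt t ht]
    rw [← e]
    refine (hqV _ hV).2.2.2.2.2 _ hg.1 ?_
    rw [hw, Complex.exp_add, hve, Complex.exp_log (Complex.slitPlane_ne_zero hg.2),
      mul_div_cancel₀ _ (hfne _ (hyU t).1 (hyU t).2)]
  have hwx0 : ∀ x ∈ Metric.ball (0 : ℂ) ρ', w x 0 = vs x := by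
    intro x hx
    have e : (Hp x 0).2 = R₀.α x := by
      simp only [hHp, hπt 0 hI0, (HN x (interior_subset (hNx x hx))).2.1]
    simp only [hw, hvs, e, hy0]
  have hwx : ∀ x ∈ Metric.ball (0 : ℂ) ρ', ∀ t ∈ Icc (0 : ℝ) 1, ContinuousAt (w x) t := by
    intro x hx t ht
    exact ContinuousAt.comp (g := Function.uncurry w) (f := fun t => (x, t))
      (hwc x (hNx x hx) t (hgx x hx t ht).1) (by fun_prop)
  -- the original deformation lies in the box
  have hend : ∀ x ∈ Metric.ball (0 : ℂ) ρ', A (w x 1, x) = hh x ∧ q (w x 1) = R₁.α (hh x) := by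
    intro x hx
    obtain ⟨hl, hl0, hl1⟩ := HN x (interior_subset (hNx x hx))
    have hwI : ContinuousOn (w x) (Icc 0 1) := fun t ht => (hwx x hx t ht).continuousWithinAt
    have hL : S.LeafOn (fun t => (A (w x t, x), q (w x t))) 0 1 := by
      obtain ⟨hl1, hl2, s, hs, hl3⟩ := hl
      refine ⟨?_, fun t ht => (hA _ (hgx x hx t ht).2.1 x (hρx x hx)).1, s, hs, fun t ht => ?_⟩
      · exact (hAc.comp (hwI.prodMk continuousOn_const) fun t ht =>
          ⟨(hgx x hx t ht).2.1, hρx x hx⟩).prodMk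
            (hq.continuousOn.comp hwI fun t ht => (hgx x hx t ht).2.1)
      · have htI := Ioo_subset_Icc_self ht.1
        have hV := (hgx x hx t htI).2.1
        obtain ⟨k, hk⟩ := hl3 t ht
        have hqs : HasStrictDerivAt q (deriv q (w x t)) (w x t) :=
          (hq.analyticAt (hVo.mem_nhds hV)).hasStrictDerivAt
        obtain ⟨g, hg, hge⟩ := exists_eventuallyEq_comp_of_continuousAt hqs (hqV _ hV).2.1
          (hwx x hx t htI)
        refine hbox x (hρx x hx) (w x) t hV ?_
        have e1 : ∀ᶠ u in 𝓝 t, w x u = g (H x u).2 := by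
          filter_upwards [hge, isOpen_Ioo.mem_nhds ht.1] with u a1 a2
          rw [a1, hqw x hx u (Ioo_subset_Icc_self a2)]
        have e2 : DifferentiableAt ℝ (fun u => (H x u).2) t :=
          (HasFDerivAt.comp_hasDerivAt t
            ((ContinuousLinearMap.snd ℝ ℂ ℂ).hasFDerivAt (x := H x t)) hk).differentiableAt
        rw [hqw x hx t htI] at hg
        have e3 : DifferentiableAt ℝ g (H x t).2 := hg.differentiableAt.restrictScalars ℝ
        exact (DifferentiableAt.comp (g := g) t e3 e2).congr_of_eventuallyEq e1
    have := hL.unique hl.leafOn (by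
      simp only [hwx0 x hx, (hAvs x (hρx x hx)).2]
      rw [← hwx0 x hx, hqw x hx 0 hI0, hl0]) (Or.inr fun t ht => ⟨?_, hqw x hx t ht⟩) 1 hI1
    · rw [hl1] at this
      exact ⟨congrArg Prod.fst this, congrArg Prod.snd this⟩
    · rw [X_def]
      exact neg_ne_zero.2 (mul_ne_zero (mul_ne_zero S.lam_ne (hqV _ (hgx x hx t ht).2.1).2.2.1)
        (hA _ (hgx x hx t ht).2.1 x (hρx x hx)).2.1)
  set Hh : ℂ → ℝ → ℂ × ℂ := fun x t => (A (wh x t, x), q (wh x t)) with hHh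
  have h0ρ' : (0 : ℂ) ∈ Metric.ball (0 : ℂ) ρ' := Metric.mem_ball_self hρ'
  have hwhC : ContinuousOn (Function.uncurry wh) (Metric.ball (0 : ℂ) ρ' ×ˢ Icc (0 : ℝ) 1) :=
    fun p hp => (hwhc p.1 (hNx _ hp.1) (hgx _ hp.1 0 hI0).1 (hgx _ hp.1 1 hI1).1 p.2
      hp.2).continuousWithinAt
  have hHhC : ContinuousOn (Function.uncurry Hh) (Metric.ball (0 : ℂ) ρ' ×ˢ Icc (0 : ℝ) 1) :=
    (hAc.comp (hwhC.prodMk continuousOn_fst) fun p hp =>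
      ⟨(hgx _ hp.1 _ hp.2).2.2, hρx _ hp.1⟩).prodMk
      (hq.continuousOn.comp hwhC fun p hp => (hgx _ hp.1 _ hp.2).2.2)
  have hHhL : ∀ x ∈ Metric.ball (0 : ℂ) ρ', S.IsLeafPath (Hh x) := by
    intro x hx
    refine ⟨?_, fun t ht => ⟨(hA _ (hgx x hx t ht).2.2 x (hρx x hx)).1, fun e => ?_⟩, ∅,
      finite_empty, fun t ht => ?_⟩
    · exact hHhC.comp (f := fun t => (x, t)) (by fun_prop) fun t ht => ⟨hx, ht⟩
    · exact (hqV _ (hgx x hx t ht).2.2).2.2.1 (congrArg Prod.snd e)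
    · have htI := Ioo_subset_Icc_self ht.1
      refine hbox x (hρx x hx) (wh x) t (hgx x hx t htI).2.2 ?_
      have e2 : DifferentiableAt ℝ (fun t : ℝ => (t : ℂ)) t := Complex.ofRealCLM.differentiableAt
      have e3 : DifferentiableAt ℝ vh t := (hvh t htI).1
      simp only [hwh]
      fun_prop
  have hHh0 : ∀ x ∈ Metric.ball (0 : ℂ) ρ', Hh x 0 = (x, R₀.α x) := by
    intro x hx
    have e : wh x 0 = vs x := by
      rw [← hwx0 x hx]; simp [hwh, hvh0]
    simp only [hHh, e, (hAvs x (hρx x hx)).2]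
    rw [← hwx0 x hx, hqw x hx 0 hI0, (HN x (interior_subset (hNx x hx))).2.1]
  have hHh1 : ∀ x ∈ Metric.ball (0 : ℂ) ρ', Hh x 1 = (hh x, R₁.α (hh x)) := by
    intro x hx
    have e : wh x 1 = w x 1 := by simp [hwh, hvh1]
    simp only [hHh, e, (hend x hx).1, (hend x hx).2]
  have hh0 : hh 0 = 0 := by
    have e1 := (HN 0 (mem_of_mem_nhds hN)).2.2
    rw [H0 1 hI1, hc1] at e1
    exact (congrArg Prod.fst e1).symm
  have hwh0 : ∀ t, wh 0 t = vh t := fun t => by simp [hwh, hw0]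
  refine ⟨Hh 0, hh, hHhL 0 h0ρ', hHh0 0 h0ρ', by rw [hHh1 0 h0ρ', hh0], fun t ht => ?_,
    ⟨_, Metric.ball_mem_nhds 0 hρ', Hh, hHhC, fun _ _ => rfl, fun x hx =>
      ⟨hHhL x hx, hHh0 x hx, hHh1 x hx⟩⟩, hr⟩
  simp only [hHh, hwh0]
  exact ⟨hA0 _ (hvh t ht).2.1, (hvh t ht).2.2⟩

end PreparedSaddle

/-! ### The holonomy groupoid -/

theorem exists_analytic_inverse {f : ℂ → ℂ} {a : ℂ} (hf : AnalyticAt ℂ f a) (hf' : deriv f a ≠ 0) :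
    ∃ g : ℂ → ℂ, g (f a) = a ∧ AnalyticAt ℂ g (f a) ∧ deriv g (f a) ≠ 0 ∧
      (∀ᶠ x in 𝓝 a, g (f x) = x) ∧ ∀ᶠ y in 𝓝 (f a), f (g y) = y := by
  obtain ⟨g, hg1, hg2, hg3, hg4⟩ := exists_local_inverse hf.hasStrictDerivAt hf'
  refine ⟨g, hg1, ?_, by rw [hg2.hasDerivAt.deriv]; exact inv_ne_zero hf', hg3, hg4⟩
  obtain ⟨C, s, hs, hL⟩ := HasStrictFDerivAt.exists_lipschitzOnWith hg2
  have hgt : Tendsto g (𝓝 (f a)) (𝓝 a) := by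
    have := hg2.hasDerivAt.continuousAt.tendsto
    rwa [hg1] at this
  have h1 : ∀ᶠ y in 𝓝 (f a), AnalyticAt ℂ f (g y) ∧ deriv f (g y) ≠ 0 :=
    hgt.eventually (hf.eventually_analyticAt.and (hf.deriv.continuousAt.eventually_ne hf'))
  rw [Complex.analyticAt_iff_eventually_differentiableAt]
  filter_upwards [h1, hg4.eventually_nhds, eventually_mem_nhds_iff.2 hs] with y e1 e2 e3
  exact (HasStrictDerivAt.of_local_left_inverse (hL.continuousOn.continuousAt e3)
    e1.1.hasStrictDerivAt e1.2 e2).hasDerivAt.differentiableAt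

namespace PreparedSaddle

variable {S : PreparedSaddle}

theorem LeafOn.congr {c c' : ℝ → ℂ × ℂ} {a b : ℝ} (h : S.LeafOn c a b)
    (he : ∀ t ∈ Icc a b, c' t = c t) : S.LeafOn c' a b := by
  obtain ⟨h1, h2, s, hs, h3⟩ := h
  refine ⟨h1.congr he, fun t ht => by rw [he t ht]; exact h2 t ht, s, hs, fun t ht => ?_⟩
  obtain ⟨k, hk⟩ := h3 t ht
  refine ⟨k, ?_⟩
  rw [he t (Ioo_subset_Icc_self ht.1)]
  refine hk.congr_of_eventuallyEq ?_
  filter_upwards [isOpen_Ioo.mem_nhds ht.1] with u hu using he u (Ioo_subset_Icc_self hu)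

theorem LeafOn.append {c : ℝ → ℂ × ℂ} {a b d : ℝ} (hab : a ≤ b) (hbd : b ≤ d)
    (h₁ : S.LeafOn c a b) (h₂ : S.LeafOn c b d) : S.LeafOn c a d := by
  obtain ⟨h1, h2, s, hs, h3⟩ := h₁
  obtain ⟨h1', h2', s', hs', h3'⟩ := h₂
  rw [LeafOn, ← Icc_union_Icc_eq_Icc hab hbd]
  refine ⟨h1.union_of_isClosed h1' isClosed_Icc isClosed_Icc,
    fun t ht => ht.elim (h2 t) (h2' t), s ∪ s' ∪ {b}, (hs.union hs').union (finite_singleton b), ?_⟩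
  rintro t ⟨⟨ha, hd⟩, hns⟩
  simp only [mem_union, mem_singleton_iff, not_or] at hns
  rcases lt_or_gt_of_ne hns.2 with h | h
  · exact h3 t ⟨⟨ha, h⟩, hns.1.1⟩
  · exact h3' t ⟨⟨h, hd⟩, hns.1.2⟩

theorem LeafOn.comp_affine {c : ℝ → ℂ × ℂ} {a b u v m n : ℝ} (h : S.LeafOn c a b) (hm : m ≠ 0)
    (hI : ∀ t ∈ Icc u v, m * t + n ∈ Icc a b) (hI' : ∀ t ∈ Ioo u v, m * t + n ∈ Ioo a b) :
    S.LeafOn (fun t => c (m * t + n)) u v := by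
  obtain ⟨h1, h2, s, hs, h3⟩ := h
  refine ⟨h1.comp (by fun_prop) hI, fun t ht => h2 _ (hI t ht), (fun t => m * t + n) ⁻¹' s,
    hs.preimage (fun x _ y _ hxy => mul_left_cancel₀ hm (add_right_cancel hxy)), fun t ht => ?_⟩
  obtain ⟨k, hk⟩ := h3 _ ⟨hI' t ht.1, ht.2⟩
  have hd : HasDerivAt (fun t : ℝ => m * t + n) m t := by
    simpa using ((hasDerivAt_id t).const_mul m).add_const n
  refine ⟨m * k, (HasDerivAt.scomp t hk hd).congr_deriv ?_⟩
  rw [mul_smul]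
  exact (Complex.coe_smul m _).symm

theorem isLeafPath_iff {c : ℝ → ℂ × ℂ} :
    S.IsLeafPath c ↔ S.LeafOn c 0 1 ∧ ∀ t ∈ Icc (0 : ℝ) 1, c t ≠ 0 :=
  ⟨fun h => ⟨h.leafOn, fun t ht => (h.2.1 t ht).2⟩,
    fun h => ⟨h.1.1, fun t ht => ⟨h.1.2.1 t ht, h.2 t ht⟩, h.1.2.2⟩⟩

theorem IsLeafPath.reverse {c : ℝ → ℂ × ℂ} (h : S.IsLeafPath c) :
    S.IsLeafPath (fun t => c (1 - t)) := by
  have hI : ∀ t ∈ Icc (0 : ℝ) 1, 1 - t ∈ Icc (0 : ℝ) 1 := fun t ht =>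
    ⟨by linarith [ht.2], by linarith [ht.1]⟩
  have e : (fun t => c (1 - t)) = fun t => c (-1 * t + 1) := by
    funext t; congr 1; ring
  rw [isLeafPath_iff] at h ⊢
  refine ⟨?_, fun t ht => h.2 _ (hI t ht)⟩
  rw [e]
  exact h.1.comp_affine (by norm_num) (fun t ht => ⟨by linarith [ht.2], by linarith [ht.1]⟩)
    fun t ht => ⟨by linarith [ht.2], by linarith [ht.1]⟩

/-- Concatenation of two paths parametrized by `[0, 1]`. -/
def concat (c₁ c₂ : ℝ → ℂ × ℂ) (t : ℝ) : ℂ × ℂ :=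
  if t ≤ 1 / 2 then c₁ (2 * t) else c₂ (2 * t - 1)

theorem concat_zero (c₁ c₂ : ℝ → ℂ × ℂ) : concat c₁ c₂ 0 = c₁ 0 := by simp [concat]

theorem concat_one (c₁ c₂ : ℝ → ℂ × ℂ) : concat c₁ c₂ 1 = c₂ 1 := by norm_num [concat]

theorem concat_left {c₁ c₂ : ℝ → ℂ × ℂ} {t : ℝ} (ht : t ≤ 1 / 2) :
    concat c₁ c₂ t = c₁ (2 * t) := by
  simp only [concat, if_pos ht]

theorem concat_right {c₁ c₂ : ℝ → ℂ × ℂ} (h : c₁ 1 = c₂ 0) {t : ℝ} (ht : 1 / 2 ≤ t) :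
    concat c₁ c₂ t = c₂ (2 * t - 1) := by
  rcases ht.eq_or_lt with rfl | ht
  · norm_num [concat, h]
  · simp only [concat, if_neg (not_le.2 ht)]

theorem IsLeafPath.concat {c₁ c₂ : ℝ → ℂ × ℂ} (h₁ : S.IsLeafPath c₁) (h₂ : S.IsLeafPath c₂)
    (h : c₁ 1 = c₂ 0) : S.IsLeafPath (concat c₁ c₂) := by
  rw [isLeafPath_iff] at *
  constructor
  · refine LeafOn.append (b := 1 / 2) (by norm_num) (by norm_num) ?_ ?_
    · refine LeafOn.congr (c := fun t => c₁ (2 * t + 0)) ?_ fun t ht => by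
        rw [concat_left ht.2, add_zero]
      exact h₁.1.comp_affine two_ne_zero (fun t ht => ⟨by linarith [ht.1], by linarith [ht.2]⟩)
        fun t ht => ⟨by linarith [ht.1], by linarith [ht.2]⟩
    · refine LeafOn.congr (c := fun t => c₂ (2 * t + (-1))) ?_ fun t ht => by
        rw [concat_right h ht.1, sub_eq_add_neg]
      exact h₂.1.comp_affine two_ne_zero (fun t ht => ⟨by linarith [ht.1], by linarith [ht.2]⟩)
        fun t ht => ⟨by linarith [ht.1], by linarith [ht.2]⟩
  · intro t ht
    rcases le_total t (1 / 2) with h' | h'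
    · rw [concat_left h']
      exact h₁.2 _ ⟨by linarith [ht.1], by linarith⟩
    · rw [concat_right h h']
      exact h₂.2 _ ⟨by linarith, by linarith [ht.2]⟩

theorem HolRel.symm {R₀ R₁ : RegGerm} (h : S.HolRel R₀ R₁) : S.HolRel R₁ R₀ := by
  obtain ⟨c, k, hc, hc0, hc1, ⟨N, hN, H, HC, H0, HN⟩, hr⟩ := h
  obtain ⟨g, hg1, hg2, -, hg3, hg4⟩ := exists_analytic_inverse R₁.analytic_r R₁.deriv_r
  rw [R₁.r_zero] at hg1 hg2 hg4
  -- the holonomy is inverted by `R₀ R₁⁻¹`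
  set k' : ℂ → ℂ := fun x => R₀.r (g x) with hk'
  have hk0 : k' 0 = 0 := by simp only [hk', hg1, R₀.r_zero]
  have hgt : Tendsto g (𝓝 0) (𝓝 0) := by
    have := hg2.continuousAt.tendsto
    rwa [hg1] at this
  have hk'a : AnalyticAt ℂ k' 0 := AnalyticAt.comp (g := R₀.r) (by rw [hg1]; exact R₀.analytic_r) hg2
  have hev : ∀ᶠ x in 𝓝 0, ContinuousAt k' x ∧ k' x ∈ N ∧ k (k' x) = x := by
    have e1 : ∀ᶠ x in 𝓝 0, k' x ∈ N :=
      hk'a.continuousAt.eventually (by rw [hk0]; exact hN)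
    filter_upwards [hk'a.eventually_analyticAt, e1, hgt.eventually hr, hg4] with x a1 a2 a3 a4
    exact ⟨a1.continuousAt, a2, by simp only [hk']; rw [← a3, a4]⟩
  have hI : ∀ t ∈ Icc (0 : ℝ) 1, 1 - t ∈ Icc (0 : ℝ) 1 := fun t ht =>
    ⟨by linarith [ht.2], by linarith [ht.1]⟩
  refine ⟨fun t => c (1 - t), k', hc.reverse, by simp [hc1], by simp [hc0],
    ⟨_, hev, fun x t => H (k' x) (1 - t), ?_, fun t ht => ?_, fun x hx => ?_⟩, ?_⟩
  · refine HC.comp (f := fun p : ℂ × ℝ => (k' p.1, 1 - p.2)) (fun p hp => ?_)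
      fun p hp => ⟨hp.1.2.1, hI _ hp.2⟩
    have e1 : ContinuousAt (fun p : ℂ × ℝ => k' p.1) p :=
      ContinuousAt.comp (g := k') (f := Prod.fst) hp.1.1 continuousAt_fst
    exact (e1.prodMk (by fun_prop)).continuousWithinAt
  · simp only [hk0, H0 _ (hI t ht)]
  · obtain ⟨-, h2, h3⟩ := hx
    obtain ⟨e1, e2, e3⟩ := HN _ h2
    refine ⟨e1.reverse, ?_, ?_⟩
    · simp only [sub_zero, e3, h3]
    · simp only [sub_self, e2]
  · filter_upwards [hg3] with y hy
    simp only [hk', hy]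

theorem HolRel.trans {R₀ R₁ R₂ : RegGerm} (h : S.HolRel R₀ R₁) (h' : S.HolRel R₁ R₂) :
    S.HolRel R₀ R₂ := by
  obtain ⟨c, k, hc, hc0, hc1, ⟨N, hN, H, HC, H0, HN⟩, hr⟩ := h
  obtain ⟨c', k', hc', hc0', hc1', ⟨N', hN', H', HC', H0', HN'⟩, hr'⟩ := h'
  have hI0 : (0 : ℝ) ∈ Icc (0 : ℝ) 1 := left_mem_Icc.2 zero_le_one
  have hI1 : (1 : ℝ) ∈ Icc (0 : ℝ) 1 := right_mem_Icc.2 zero_le_one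
  have hkx : ∀ x ∈ N, k x = (H x 1).1 := fun x hx => by rw [(HN x hx).2.2]
  have hk0 : k 0 = 0 := by rw [hkx 0 (mem_of_mem_nhds hN), H0 1 hI1, hc1]
  have hkc : ContinuousOn k N := by
    refine ContinuousOn.congr (f := fun x => (H x 1).1) ?_ hkx
    exact continuous_fst.comp_continuousOn
      (HC.comp (f := fun x : ℂ => (x, (1 : ℝ))) (by fun_prop) fun x hx => ⟨hx, hI1⟩)
  set M : Set ℂ := N ∩ k ⁻¹' N' with hM
  have hM0 : M ∈ 𝓝 0 := inter_mem hN ((hkc.continuousAt hN).preimage_mem_nhds (by rwa [hk0]))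
  have hjoin : ∀ x ∈ M, H x 1 = H' (k x) 0 := fun x hx => by
    rw [(HN x hx.1).2.2, (HN' _ hx.2).2.1]
  refine ⟨concat c c', fun x => k' (k x), hc.concat hc' (by rw [hc1, hc0']), by
    rw [concat_zero, hc0], by rw [concat_one, hc1'],
    ⟨M, hM0, fun x => concat (H x) (H' (k x)), ?_, fun t ht => ?_, fun x hx => ⟨?_, ?_, ?_⟩⟩, ?_⟩
  · have hun : M ×ˢ Icc (0 : ℝ) 1 = M ×ˢ Icc (0 : ℝ) (1 / 2) ∪ M ×ˢ Icc (1 / 2 : ℝ) 1 := by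
      rw [← prod_union, Icc_union_Icc_eq_Icc (by norm_num) (by norm_num)]
    have h1 : ContinuousOn (Function.uncurry fun x => concat (H x) (H' (k x)))
        (M ×ˢ Icc (0 : ℝ) (1 / 2)) := by
      refine ContinuousOn.congr (f := fun p : ℂ × ℝ => H p.1 (2 * p.2)) ?_ fun p hp => concat_left hp.2.2
      exact HC.comp (f := fun p : ℂ × ℝ => (p.1, 2 * p.2)) (by fun_prop) fun p hp =>
        ⟨hp.1.1, by linarith [hp.2.1], by linarith [hp.2.2]⟩
    have h2 : ContinuousOn (Function.uncurry fun x => concat (H x) (H' (k x)))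
        (M ×ˢ Icc (1 / 2 : ℝ) 1) := by
      refine ContinuousOn.congr (f := fun p : ℂ × ℝ => H' (k p.1) (2 * p.2 - 1)) ?_
        fun p hp => concat_right (hjoin _ hp.1) hp.2.1
      refine HC'.comp (f := fun p : ℂ × ℝ => (k p.1, 2 * p.2 - 1)) ?_ fun p hp =>
        ⟨hp.1.2, by linarith [hp.2.1], by linarith [hp.2.2]⟩
      exact (hkc.comp continuousOn_fst fun p hp => hp.1.1).prodMk (by fun_prop)
    intro p hp
    have hp2 := hp.2
    rcases lt_trichotomy p.2 (1 / 2) with h | h | h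
    · refine (h1 p ⟨hp.1, hp2.1, h.le⟩).mono_of_mem_nhdsWithin ?_
      have : {p : ℂ × ℝ | p.2 < 1 / 2} ∈ 𝓝 p :=
        (isOpen_lt continuous_snd continuous_const).mem_nhds h
      filter_upwards [self_mem_nhdsWithin, mem_nhdsWithin_of_mem_nhds this] with z hz hz'
      exact ⟨hz.1, hz.2.1, le_of_lt hz'⟩
    · rw [hun]
      exact (h1 p ⟨hp.1, hp2.1, h.le⟩).union (h2 p ⟨hp.1, h.ge, hp2.2⟩)
    · refine (h2 p ⟨hp.1, h.le, hp2.2⟩).mono_of_mem_nhdsWithin ?_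
      have : {p : ℂ × ℝ | 1 / 2 < p.2} ∈ 𝓝 p :=
        (isOpen_lt continuous_const continuous_snd).mem_nhds h
      filter_upwards [self_mem_nhdsWithin, mem_nhdsWithin_of_mem_nhds this] with z hz hz'
      exact ⟨hz.1, le_of_lt hz', hz.2.2⟩
  · dsimp only
    rcases le_total t (1 / 2) with h | h
    · rw [concat_left h, concat_left h, H0 _ ⟨by linarith [ht.1], by linarith⟩]
    · rw [concat_right (hjoin 0 (mem_of_mem_nhds hM0)) h,
        concat_right (by rw [hc1, hc0']) h, hk0, H0' _ ⟨by linarith, by linarith [ht.2]⟩]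
  · exact (HN x hx.1).1.concat (HN' _ hx.2).1 (hjoin x hx)
  · dsimp only
    rw [concat_zero, (HN x hx.1).2.1]
  · dsimp only
    rw [concat_one, (HN' _ hx.2).2.2]
  · filter_upwards [hr, hr'] with y e1 e2
    rw [e2, e1]

end PreparedSaddle

/-! ### Fibered diffeomorphisms -/

namespace FiberedDiffeo

variable (Φ : FiberedDiffeo)

theorem apply_disk {x : ℂ} (hx : ‖x‖ ≤ 1) : Φ.e (x, 0) = (x, 0) := (Φ.disk x hx).2

theorem mem_source_disk {x : ℂ} (hx : ‖x‖ ≤ 1) : (x, (0 : ℂ)) ∈ Φ.e.source := (Φ.disk x hx).1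

/-- The inverse of a fibered diffeomorphism. -/
def symm : FiberedDiffeo where
  e := Φ.e.symm
  holo := Φ.holo_symm
  holo_symm := by simpa using Φ.holo
  disk x hx := by
    have h1 := Φ.disk x hx
    have h2 := Φ.e.map_source h1.1
    have h3 := Φ.e.left_inv h1.1
    rw [h1.2] at h2 h3
    exact ⟨h2, h3⟩
  fibered p hp := by
    have h1 := Φ.fibered _ (Φ.e.map_target hp)
    rw [Φ.e.right_inv hp] at h1
    exact h1.symm

theorem ne_zero {p : ℂ × ℂ} (hp : p ∈ Φ.e.source) (h0 : p ≠ 0) : Φ.e p ≠ 0 := by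
  intro h
  have h1 : (0 : ℂ × ℂ) ∈ Φ.e.source := Φ.mem_source_disk (by simp)
  have h2 : Φ.e 0 = 0 := Φ.apply_disk (by simp)
  exact h0 (Φ.e.injOn hp h1 (h.trans h2.symm))

theorem apply_eq {p : ℂ × ℂ} (hp : p ∈ Φ.e.source) : Φ.e p = (p.1, (Φ.e p).2) :=
  Prod.ext (Φ.fibered p hp) rfl

theorem differentiableAt {p : ℂ × ℂ} (hp : p ∈ Φ.e.source) : DifferentiableAt ℂ Φ.e p :=
  Φ.holo.differentiableAt (Φ.e.open_source.mem_nhds hp)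

theorem snd_ne_zero {p : ℂ × ℂ} (hp : p ∈ Φ.e.source) (hx : ‖p.1‖ ≤ 1) (h0 : p.2 ≠ 0) :
    (Φ.e p).2 ≠ 0 := by
  intro h
  have h1 : Φ.e p = Φ.e (p.1, 0) := by rw [Φ.apply_disk hx, Φ.apply_eq hp, h]
  exact h0 (congrArg Prod.snd (Φ.e.injOn hp (Φ.mem_source_disk hx) h1))

/-- The action on a transversal `{x = const}`. -/
def fiberMap (x y : ℂ) : ℂ := (Φ.e (x, y)).2

theorem fiberMap_zero {x : ℂ} (hx : ‖x‖ ≤ 1) : Φ.fiberMap x 0 = 0 := by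
  rw [fiberMap, Φ.apply_disk hx]

theorem hasDerivAt_fiberMap {x y : ℂ} (h : (x, y) ∈ Φ.e.source) :
    HasDerivAt (Φ.fiberMap x) (fderiv ℂ Φ.e (x, y) (0, 1)).2 y := by
  have h1 : HasDerivAt (fun y : ℂ => (x, y)) ((0 : ℂ), (1 : ℂ)) y :=
    (hasDerivAt_const y x).prodMk (hasDerivAt_id y)
  have h2 := HasFDerivAt.comp_hasDerivAt y (Φ.differentiableAt h).hasFDerivAt h1
  exact HasFDerivAt.comp_hasDerivAt y
    ((ContinuousLinearMap.snd ℂ ℂ ℂ).hasFDerivAt (x := Φ.e (x, y))) h2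

theorem eventually_mem_source {x : ℂ} {y : ℂ} (h : (x, y) ∈ Φ.e.source) :
    ∀ᶠ z in 𝓝 y, (x, z) ∈ Φ.e.source := by
  have : Continuous fun z : ℂ => (x, z) := by fun_prop
  exact (Φ.e.open_source.preimage this).mem_nhds h

theorem analyticAt_fiberMap {x y : ℂ} (h : (x, y) ∈ Φ.e.source) : AnalyticAt ℂ (Φ.fiberMap x) y := by
  rw [Complex.analyticAt_iff_eventually_differentiableAt]
  filter_upwards [Φ.eventually_mem_source h] with z hz using (Φ.hasDerivAt_fiberMap hz).differentiableAt

theorem symm_fiberMap_fiberMap {x y : ℂ} (h : (x, y) ∈ Φ.e.source) :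
    Φ.symm.fiberMap x (Φ.fiberMap x y) = y := by
  have h1 : (x, Φ.fiberMap x y) = Φ.e (x, y) := (Φ.apply_eq h).symm
  change (Φ.e.symm (x, Φ.fiberMap x y)).2 = y
  rw [h1, Φ.e.left_inv h]

theorem fiberMap_mem {x y : ℂ} (h : (x, y) ∈ Φ.e.source) : (x, Φ.fiberMap x y) ∈ Φ.symm.e.source := by
  have h1 : (x, Φ.fiberMap x y) = Φ.e (x, y) := (Φ.apply_eq h).symm
  rw [h1]; exact Φ.e.map_source h

theorem deriv_fiberMap_ne_zero {x y : ℂ} (h : (x, y) ∈ Φ.e.source) : deriv (Φ.fiberMap x) y ≠ 0 := by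
  intro h0
  have h1 := (Φ.analyticAt_fiberMap h).differentiableAt.hasDerivAt
  have h2 := (Φ.symm.analyticAt_fiberMap (Φ.fiberMap_mem h)).differentiableAt.hasDerivAt
  have h3 := h2.comp y h1
  have h4 : HasDerivAt (Φ.symm.fiberMap x ∘ Φ.fiberMap x) 1 y := by
    refine (hasDerivAt_id y).congr_of_eventuallyEq ?_
    filter_upwards [Φ.eventually_mem_source h] with z hz using Φ.symm_fiberMap_fiberMap hz
  have := h3.unique h4
  rw [h0, mul_zero] at this
  exact zero_ne_one this

theorem tendsto_fiberMap_one : Tendsto (Φ.fiberMap 1) (𝓝 0) (𝓝 0) := by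
  have := (Φ.analyticAt_fiberMap (Φ.mem_source_disk (x := 1) (by simp))).continuousAt.tendsto
  rwa [Φ.fiberMap_zero (by simp)] at this

theorem eventually_fiberMap_one : ∀ᶠ y in 𝓝 0, (1, y) ∈ Φ.e.source ∧ (1, y) ∈ Φ.symm.e.source ∧
    Φ.symm.fiberMap 1 (Φ.fiberMap 1 y) = y ∧ Φ.fiberMap 1 (Φ.symm.fiberMap 1 y) = y := by
  filter_upwards [Φ.eventually_mem_source (Φ.mem_source_disk (x := 1) (by simp)),
    Φ.symm.eventually_mem_source (Φ.symm.mem_source_disk (x := 1) (by simp))] with y h1 h2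
  exact ⟨h1, h2, Φ.symm_fiberMap_fiberMap h1, Φ.symm.symm_fiberMap_fiberMap h2⟩

theorem analyticAt_fiberMap_curve {α : ℂ → ℂ} (hα : AnalyticAt ℂ α 0)
    (h : ((0 : ℂ), α 0) ∈ Φ.e.source) :
    AnalyticAt ℂ (fun x => Φ.fiberMap x (α x)) 0 ∧ ∀ᶠ x in 𝓝 0, (x, α x) ∈ Φ.e.source := by
  have h1 : ∀ᶠ x in 𝓝 0, (x, α x) ∈ Φ.e.source :=
    (continuousAt_id.prodMk hα.continuousAt).eventually (Φ.e.open_source.mem_nhds h)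
  refine ⟨?_, h1⟩
  rw [Complex.analyticAt_iff_eventually_differentiableAt]
  filter_upwards [h1, hα.eventually_analyticAt] with x e1 e2
  have e3 : DifferentiableAt ℂ (fun x => (x, α x)) x := differentiableAt_id.prodMk e2.differentiableAt
  exact (DifferentiableAt.comp (g := Φ.e) x (Φ.differentiableAt e1) e3).snd

/-- The image of a regular transition germ. -/
def push (R : RegGerm) (h : ((0 : ℂ), R.α 0) ∈ Φ.e.source) : RegGerm where
  α x := Φ.fiberMap x (R.α x)
  r y := R.r (Φ.symm.fiberMap 1 y)
  analytic_α := (Φ.analyticAt_fiberMap_curve R.analytic_α h).1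
  α_ne := Φ.snd_ne_zero h (by simp) R.α_ne
  analytic_r := by
    refine AnalyticAt.comp (g := R.r) ?_
      (Φ.symm.analyticAt_fiberMap (Φ.symm.mem_source_disk (x := 1) (by simp)))
    rw [Φ.symm.fiberMap_zero (by simp)]
    exact R.analytic_r
  r_zero := by rw [Φ.symm.fiberMap_zero (by simp), R.r_zero]
  deriv_r := by
    have h1 := (Φ.symm.analyticAt_fiberMap
      (Φ.symm.mem_source_disk (x := 1) (by simp))).differentiableAt.hasDerivAt
    have h2 : HasDerivAt R.r (deriv R.r 0) (Φ.symm.fiberMap 1 0) := by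
      rw [Φ.symm.fiberMap_zero (by simp)]
      exact R.analytic_r.differentiableAt.hasDerivAt
    rw [show deriv (fun y => R.r (Φ.symm.fiberMap 1 y)) 0 = _ from (h2.comp 0 h1).deriv]
    exact mul_ne_zero R.deriv_r
      (Φ.symm.deriv_fiberMap_ne_zero (Φ.symm.mem_source_disk (x := 1) (by simp)))

variable {Φ}

theorem regCorresp_iff {R R' : RegGerm} : Φ.RegCorresp R R' ↔ ((0 : ℂ), R.α 0) ∈ Φ.e.source ∧
    (∀ᶠ x in 𝓝 0, R'.α x = Φ.fiberMap x (R.α x)) ∧ ∀ᶠ y in 𝓝 0, R'.r (Φ.fiberMap 1 y) = R.r y := by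
  unfold RegCorresp
  refine and_congr_right fun h => ?_
  have hs := (Φ.analyticAt_fiberMap_curve R.analytic_α h).2
  have hα : (∀ᶠ x in 𝓝 0, Φ.e (x, R.α x) = (x, R'.α x)) ↔
      ∀ᶠ x in 𝓝 0, R'.α x = Φ.fiberMap x (R.α x) := by
    refine eventually_congr ?_
    filter_upwards [hs] with x hx
    rw [Φ.apply_eq hx, Prod.ext_iff]
    simp [fiberMap, eq_comm]
  rw [hα]
  refine and_congr_right fun h2 => ?_
  have hr : Tendsto R.r (𝓝 0) (𝓝 0) := by
    have := R.analytic_r.continuousAt.tendsto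
    rwa [R.r_zero] at this
  refine eventually_congr ?_
  filter_upwards [hr.eventually hs, hr.eventually h2] with y h3 h4
  simp only [RegGerm.toMap]
  rw [Φ.apply_eq h3, Prod.ext_iff]
  refine ⟨fun h5 => h5.1, fun h5 => ⟨h5, ?_⟩⟩
  change R'.α (R'.r (Φ.fiberMap 1 y)) = Φ.fiberMap (R.r y) (R.α (R.r y))
  rw [h5, h4]

theorem RegCorresp.symm {R R' : RegGerm} (h : Φ.RegCorresp R R') : Φ.symm.RegCorresp R' R := by
  rw [regCorresp_iff] at h ⊢
  obtain ⟨h1, h2, h3⟩ := h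
  refine ⟨?_, ?_, ?_⟩
  · rw [h2.self_of_nhds]
    exact Φ.fiberMap_mem h1
  · filter_upwards [h2, (Φ.analyticAt_fiberMap_curve R.analytic_α h1).2] with x e1 e2
    rw [e1, Φ.symm_fiberMap_fiberMap e2]
  · filter_upwards [Φ.symm.tendsto_fiberMap_one.eventually h3, Φ.eventually_fiberMap_one] with y e1 e2
    rw [← e1, e2.2.2.2]

theorem regCorresp_push {R : RegGerm} (h : ((0 : ℂ), R.α 0) ∈ Φ.e.source) :
    Φ.RegCorresp R (Φ.push R h) := by
  rw [regCorresp_iff]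
  refine ⟨h, Eventually.of_forall fun x => rfl, ?_⟩
  filter_upwards [Φ.eventually_fiberMap_one] with y hy
  simp only [push]
  rw [hy.2.2.1]

end FiberedDiffeo

/-! ### Conjugacies of foliations and holonomy -/

theorem PreparedSaddle.differentiableOn_X (S : PreparedSaddle) : DifferentiableOn ℂ S.X S.U := by
  have h : DifferentiableOn ℂ (fun p => -((S.lam : ℂ) * p.2 * (1 + S.pert p))) S.U :=
    (DifferentiableOn.mul (by fun_prop) (S.differentiableOn_pert.const_add 1)).fun_neg
  exact DifferentiableOn.prodMk (by fun_prop) h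

theorem PreparedSaddle.continuousOn_X (S : PreparedSaddle) : ContinuousOn S.X S.U :=
  S.differentiableOn_X.continuousOn

namespace FiberedDiffeo

variable {Φ : FiberedDiffeo} {S S' : PreparedSaddle}

/-- `Φ` maps the foliation of `S` to that of `S'` at the point `p`. -/
def ConjAt (Φ : FiberedDiffeo) (S S' : PreparedSaddle) (p : ℂ × ℂ) : Prop :=
  p ∈ S.U ∧ p ∈ Φ.e.source ∧ Φ.e p ∈ S'.U ∧
    ∃ k : ℂ, k ≠ 0 ∧ fderiv ℂ Φ.e p (S.X p) = k • S'.X (Φ.e p)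

theorem fderiv_fst {p : ℂ × ℂ} (hp : p ∈ Φ.e.source) (v : ℂ × ℂ) : (fderiv ℂ Φ.e p v).1 = v.1 := by
  have h1 : HasFDerivAt (fun q => (Φ.e q).1)
      ((ContinuousLinearMap.fst ℂ ℂ ℂ).comp (fderiv ℂ Φ.e p)) p :=
    (ContinuousLinearMap.fst ℂ ℂ ℂ).hasFDerivAt.comp p (Φ.differentiableAt hp).hasFDerivAt
  have h2 : HasFDerivAt (fun q => (Φ.e q).1) (ContinuousLinearMap.fst ℂ ℂ ℂ) p := by
    refine (ContinuousLinearMap.fst ℂ ℂ ℂ).hasFDerivAt.congr_of_eventuallyEq ?_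
    filter_upwards [Φ.e.open_source.mem_nhds hp] with q hq using Φ.fibered q hq
  exact congrArg (fun L => L v) (h1.unique h2)

theorem ConjAt.eq_of_fst_ne {p : ℂ × ℂ} (h : Φ.ConjAt S S' p) (hp : p.1 ≠ 0) :
    fderiv ℂ Φ.e p (S.X p) = S'.X (Φ.e p) := by
  obtain ⟨-, h2, -, k, -, hk⟩ := h
  have h3 := congrArg Prod.fst hk
  rw [fderiv_fst h2] at h3
  have h4 : k = 1 := by
    have h5 : p.1 = k * p.1 := by
      simpa [PreparedSaddle.X_def, Φ.fibered p h2] using h3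
    exact (mul_left_eq_self₀.1 h5.symm).resolve_right hp
  rw [hk, h4, one_smul]

theorem ConjAt.symm {p : ℂ × ℂ} (h : Φ.ConjAt S S' p) : Φ.symm.ConjAt S' S (Φ.e p) := by
  obtain ⟨h1, h2, h3, k, hk0, hk⟩ := h
  have hs := Φ.e.map_source h2
  have hi : Φ.symm.e (Φ.e p) = p := Φ.e.left_inv h2
  refine ⟨h3, hs, by rw [hi]; exact h1, k⁻¹, inv_ne_zero hk0, ?_⟩
  have d1 := (Φ.symm.differentiableAt hs).hasFDerivAt.comp p (Φ.differentiableAt h2).hasFDerivAt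
  have d2 : HasFDerivAt (Φ.symm.e ∘ Φ.e) (ContinuousLinearMap.id ℂ (ℂ × ℂ)) p := by
    refine (hasFDerivAt_id p).congr_of_eventuallyEq ?_
    filter_upwards [Φ.e.open_source.mem_nhds h2] with q hq using Φ.e.left_inv hq
  have h4 : fderiv ℂ Φ.symm.e (Φ.e p) (fderiv ℂ Φ.e p (S.X p)) = S.X p :=
    congrArg (fun L => L (S.X p)) (d1.unique d2)
  rw [hk, map_smul] at h4
  rw [hi, ← h4, smul_smul, inv_mul_cancel₀ hk0, one_smul]

theorem leafPath_push {c : ℝ → ℂ × ℂ} (hc : S.IsLeafPath c)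
    (h : ∀ t ∈ Icc (0 : ℝ) 1, Φ.ConjAt S S' (c t)) : S'.IsLeafPath (fun t => Φ.e (c t)) := by
  obtain ⟨h1, h2, s, hs, h3⟩ := hc
  refine ⟨Φ.holo.continuousOn.comp h1 fun t ht => (h t ht).2.1,
    fun t ht => ⟨(h t ht).2.2.1, Φ.ne_zero (h t ht).2.1 (h2 t ht).2⟩, s, hs, fun t ht => ?_⟩
  obtain ⟨k, hk⟩ := h3 t ht
  obtain ⟨-, h4, -, k', -, hk'⟩ := h t (Ioo_subset_Icc_self ht.1)
  have d := ((Φ.differentiableAt h4).hasFDerivAt.restrictScalars ℝ).comp_hasDerivAt t hk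
  refine ⟨k * k', d.congr_deriv ?_⟩
  change fderiv ℂ Φ.e (c t) (k • S.X (c t)) = _
  rw [map_smul, hk', smul_smul]

/-- `Φ` conjugates the foliations near the closed disk `{|x| ≤ 1, y = 0}`; their eigenratios then
agree. -/
structure IsConj (Φ : FiberedDiffeo) (S S' : PreparedSaddle) (η : ℝ) : Prop where
  pos : 0 < η
  conjAt : ∀ p : ℂ × ℂ, ‖p.1‖ ≤ 1 → ‖p.2‖ ≤ η → Φ.ConjAt S S' p
  lam_eq : S'.lam = S.lam

/-- On `{x = 0}` the map conjugates the linear fields `λ y ∂y`, `λ' y ∂y`, so `λ = λ'`. -/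
theorem lam_eq_of_conjAt {η : ℝ} (hη : 0 < η)
    (h : ∀ p : ℂ × ℂ, ‖p.1‖ ≤ 1 → ‖p.2‖ ≤ η → Φ.ConjAt S S' p) : S'.lam = S.lam := by
  have hcont : ContinuousOn (fderiv ℂ Φ.e) Φ.e.source := by
    have e1 := (contDiffOn_of_differentiableOn Φ.e.open_source Φ.holo.fst).prodMk
      (contDiffOn_of_differentiableOn Φ.e.open_source Φ.holo.snd)
    exact e1.continuousOn_fderiv_of_isOpen Φ.e.open_source le_rfl
  -- the factor `k` is `1` off `{x = 0}`, hence on `{x = 0}` by continuity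
  have key : ∀ y : ℂ, ‖y‖ ≤ η → S.lam * y * deriv (Φ.fiberMap 0) y = S'.lam * Φ.fiberMap 0 y := by
    intro y hy
    have h0 := h (0, y) (by simp) hy
    have d1 : ContinuousAt (fun x : ℂ => fderiv ℂ Φ.e (x, y) (S.X (x, y))) 0 := by
      have e0 : ContinuousAt (fun x : ℂ => (x, y)) 0 := by fun_prop
      have e1 : ContinuousAt (fun x : ℂ => fderiv ℂ Φ.e (x, y)) 0 :=
        ContinuousAt.comp (g := fderiv ℂ Φ.e) (hcont.continuousAt (Φ.e.open_source.mem_nhds h0.2.1)) e0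
      have e2 : ContinuousAt (fun x : ℂ => S.X (x, y)) 0 :=
        ContinuousAt.comp (g := S.X) (S.continuousOn_X.continuousAt (S.isOpen_U.mem_nhds h0.1)) e0
      exact e1.clm_apply e2
    have d2 : ContinuousAt (fun x : ℂ => S'.X (Φ.e (x, y))) 0 := by
      have e0 : ContinuousAt (fun x : ℂ => (x, y)) 0 := by fun_prop
      have e1 : ContinuousAt (fun x : ℂ => Φ.e (x, y)) 0 :=
        ContinuousAt.comp (g := Φ.e) (Φ.differentiableAt h0.2.1).continuousAt e0
      exact ContinuousAt.comp (g := S'.X)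
        (S'.continuousOn_X.continuousAt (S'.isOpen_U.mem_nhds h0.2.2.1)) e1
    have d3 : fderiv ℂ Φ.e (0, y) (S.X (0, y)) = S'.X (Φ.e (0, y)) := by
      refine tendsto_nhds_unique_of_frequently_eq d1.tendsto d2.tendsto ?_
      have : ∀ᶠ x : ℂ in 𝓝[≠] 0, fderiv ℂ Φ.e (x, y) (S.X (x, y)) = S'.X (Φ.e (x, y)) := by
        filter_upwards [self_mem_nhdsWithin, mem_nhdsWithin_of_mem_nhds
          (Metric.closedBall_mem_nhds (0 : ℂ) one_pos)] with x hx hx1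
        exact (h (x, y) (by simpa using hx1) hy).eq_of_fst_ne hx
      exact this.frequently.filter_mono nhdsWithin_le_nhds
    rw [Φ.apply_eq h0.2.1, PreparedSaddle.X_zero_left, PreparedSaddle.X_zero_left] at d3
    have d4 := congrArg Prod.snd d3
    have d5 : ((0 : ℂ), -(S.lam * y)) = (-(S.lam * y)) • ((0 : ℂ), (1 : ℂ)) := by
      simp
    rw [d5, map_smul, Prod.smul_snd, ← (Φ.hasDerivAt_fiberMap h0.2.1).deriv] at d4
    simp only [smul_eq_mul] at d4
    change _ = -(S'.lam * Φ.fiberMap 0 y) at d4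
    linear_combination -d4
  have h0 : ((0 : ℂ), (0 : ℂ)) ∈ Φ.e.source := Φ.mem_source_disk (by simp)
  have hd := Φ.analyticAt_fiberMap h0
  have hd0 := Φ.deriv_fiberMap_ne_zero h0
  have t1 : HasDerivAt (fun y => (S.lam : ℂ) * y * deriv (Φ.fiberMap 0) y)
      (S.lam * deriv (Φ.fiberMap 0) 0) 0 := by
    refine (((hasDerivAt_id (0 : ℂ)).const_mul (S.lam : ℂ)).mul
      hd.deriv.differentiableAt.hasDerivAt).congr_deriv ?_
    simp
  have t2 := hd.differentiableAt.hasDerivAt.const_mul (S'.lam : ℂ)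
  have t3 := (t2.congr_of_eventuallyEq (f₁ := fun y => (S.lam : ℂ) * y * deriv (Φ.fiberMap 0) y) (by
    filter_upwards [Metric.closedBall_mem_nhds (0 : ℂ) hη] with y hy
    exact key y (by simpa using hy))).unique t1
  exact_mod_cast mul_right_cancel₀ hd0 t3

theorem IsConj.symm {η : ℝ} (h : Φ.IsConj S S' η) : ∃ η', Φ.symm.IsConj S' S η' := by
  set O : Set (ℂ × ℂ) := Φ.symm.e.source ∩ (fun p => (Φ.symm.e p).2) ⁻¹' Metric.ball 0 η with hO
  have hOo : IsOpen O := ContinuousOn.isOpen_inter_preimage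
    (continuous_snd.comp_continuousOn Φ.symm.holo.continuousOn) Φ.symm.e.open_source
    Metric.isOpen_ball
  obtain ⟨d, hd, hdO⟩ := exists_closedBall_prod_subset hOo zero_le_one le_rfl
    (fun x y hx hy => by
      rw [norm_le_zero_iff.1 hy]
      exact ⟨Φ.symm.mem_source_disk hx, by
        simpa [Φ.symm.apply_disk hx] using h.pos⟩)
  refine ⟨d, hd, fun p h1 h2 => ?_, h.lam_eq.symm⟩
  obtain ⟨h3, h4⟩ := hdO p.1 p.2 (by linarith) (by simpa using h2)
  have h5 : Φ.ConjAt S S' (Φ.symm.e p) :=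
    h.conjAt _ (by rw [Φ.symm.fibered _ h3]; exact h1) (mem_ball_zero_iff.1 h4).le
  have h6 := h5.symm
  have h7 : Φ.e (Φ.symm.e p) = p := Φ.e.right_inv h3
  rwa [h7] at h6

/-- A holonomy relation given by a deformation `H` whose leaf paths are mapped to leaf paths. -/
theorem holRel_push {R₀ R₁ R₀' R₁' : RegGerm} (h₀ : Φ.RegCorresp R₀ R₀') (h₁ : Φ.RegCorresp R₁ R₁')
    {N : Set ℂ} (hN : N ∈ 𝓝 0) {H : ℂ → ℝ → ℂ × ℂ} {k : ℂ → ℂ}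
    (HC : ContinuousOn (Function.uncurry H) (N ×ˢ Icc (0 : ℝ) 1)) (hk0 : k 0 = 0)
    (HN : ∀ x ∈ N, H x 0 = (x, R₀.α x) ∧ H x 1 = (k x, R₁.α (k x)))
    (hleaf : ∀ᶠ x in 𝓝 0, (∀ t ∈ Icc (0 : ℝ) 1, H x t ∈ Φ.e.source) ∧
      S'.IsLeafPath (fun t => Φ.e (H x t)))
    (hr : ∀ᶠ y in 𝓝 0, R₁.r y = k (R₀.r y)) : S'.HolRel R₀' R₁' := by
  have hI1 : (1 : ℝ) ∈ Icc (0 : ℝ) 1 := right_mem_Icc.2 zero_le_one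
  obtain ⟨h₀1, h₀2, -⟩ := id h₀
  obtain ⟨h₁1, h₁2, -⟩ := id h₁
  obtain ⟨-, -, h₀3⟩ := regCorresp_iff.1 h₀
  obtain ⟨-, -, h₁3⟩ := regCorresp_iff.1 h₁
  have hkc : ContinuousOn k N := by
    refine ContinuousOn.congr (f := fun x => (H x 1).1) ?_ fun x hx => by
      dsimp only; rw [(HN x hx).2]
    exact continuous_fst.comp_continuousOn
      (HC.comp (f := fun x : ℂ => (x, (1 : ℝ))) (by fun_prop) fun x hx => ⟨hx, hI1⟩)
  have hkt : Tendsto k (𝓝 0) (𝓝 0) := by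
    have := (hkc.continuousAt hN).tendsto
    rwa [hk0] at this
  have hev : ∀ᶠ x in 𝓝 0, ((∀ t ∈ Icc (0 : ℝ) 1, H x t ∈ Φ.e.source) ∧
      S'.IsLeafPath (fun t => Φ.e (H x t))) ∧ x ∈ N ∧ Φ.e (x, R₀.α x) = (x, R₀'.α x) ∧
      Φ.e (k x, R₁.α (k x)) = (k x, R₁'.α (k x)) := by
    filter_upwards [hleaf, hN, h₀2, hkt.eventually h₁2] with x e1 e2 e3 e4 using ⟨e1, e2, e3, e4⟩
  have hmain : ∀ x ∈ {x | ((∀ t ∈ Icc (0 : ℝ) 1, H x t ∈ Φ.e.source) ∧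
      S'.IsLeafPath (fun t => Φ.e (H x t))) ∧ x ∈ N ∧ Φ.e (x, R₀.α x) = (x, R₀'.α x) ∧
      Φ.e (k x, R₁.α (k x)) = (k x, R₁'.α (k x))}, S'.IsLeafPath (fun t => Φ.e (H x t)) ∧
      Φ.e (H x 0) = (x, R₀'.α x) ∧ Φ.e (H x 1) = (k x, R₁'.α (k x)) := by
    rintro x ⟨⟨-, e1⟩, e2, e3, e4⟩
    rw [(HN x e2).1, (HN x e2).2]
    exact ⟨e1, e3, e4⟩
  obtain ⟨m1, m2, m3⟩ := hmain 0 (mem_of_mem_nhds hev)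
  refine ⟨fun t => Φ.e (H 0 t), k, m1, m2, by dsimp only; rw [m3, hk0], ⟨_, hev, fun x t => Φ.e (H x t), ?_,
    fun _ _ => rfl, hmain⟩, ?_⟩
  · exact Φ.holo.continuousOn.comp (HC.mono (prod_mono (fun x hx => hx.2.1) le_rfl))
      fun p hp => hp.1.1.1 _ hp.2
  · filter_upwards [Φ.symm.tendsto_fiberMap_one.eventually (hr.and (h₀3.and h₁3)),
      Φ.eventually_fiberMap_one] with y e1 e2
    have e3 : Φ.fiberMap 1 (Φ.symm.fiberMap 1 y) = y := e2.2.2.2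
    rw [e3] at e1
    rw [e1.2.2, e1.1, e1.2.1]

theorem eventually_forall_mem {H : ℂ → ℝ → ℂ × ℂ} {N : Set ℂ} {x₀ : ℂ} (hN : N ∈ 𝓝 x₀)
    (HC : ContinuousOn (Function.uncurry H) (N ×ˢ Icc (0 : ℝ) 1)) {O : Set (ℂ × ℂ)} (hO : IsOpen O)
    (h : ∀ t ∈ Icc (0 : ℝ) 1, H x₀ t ∈ O) : ∀ᶠ x in 𝓝 x₀, ∀ t ∈ Icc (0 : ℝ) 1, H x t ∈ O := by
  have h01 : (0 : ℝ) ≤ 1 := zero_le_one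
  set π : ℝ → ℝ := fun t => projIcc (0 : ℝ) 1 h01 t with hπ
  have hπc : Continuous π := continuous_subtype_val.comp continuous_projIcc
  have hπI : ∀ t, π t ∈ Icc (0 : ℝ) 1 := fun t => (projIcc (0 : ℝ) 1 h01 t).2
  have hπt : ∀ t ∈ Icc (0 : ℝ) 1, π t = t := fun t ht => by
    simp only [hπ, projIcc_of_mem h01 ht]
  have hc : ContinuousOn (fun p : ℂ × ℝ => H p.1 (π p.2)) (N ×ˢ univ) :=
    HC.comp (f := fun p : ℂ × ℝ => (p.1, π p.2)) (by fun_prop) fun p hp => ⟨hp.1, hπI _⟩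
  have : ∀ᶠ x in 𝓝 x₀, ∀ t ∈ Icc (0 : ℝ) 1, H x (π t) ∈ O := by
    refine isCompact_Icc.eventually_forall_of_forall_eventually fun t ht => ?_
    exact (hc.continuousAt (prod_mem_nhds hN univ_mem)).eventually
      (hO.mem_nhds (h _ (hπI t)))
  filter_upwards [this] with x hx t ht
  have := hx t ht
  rwa [hπt t ht] at this

/-- Conjugacies near `{y = 0}` preserve the holonomy relation of germs with small base points. -/
theorem IsConj.holRel {η : ℝ} (h : Φ.IsConj S S' η) {R₀ R₁ R₀' R₁' : RegGerm}
    (h₀ : Φ.RegCorresp R₀ R₀') (h₁ : Φ.RegCorresp R₁ R₁') (hR₀ : ‖R₀.α 0‖ < η)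
    (hR₁ : ‖R₁.α 0‖ < η) (hrel : S.HolRel R₀ R₁) : S'.HolRel R₀' R₁' := by
  obtain ⟨c, k, -, -, hc1, hc, ⟨N, hN, H, HC, H0, HN⟩, hr⟩ := hrel.exists_small h.pos
    (fun y hy => (h.conjAt (0, y) (by simp) hy).1) hR₀ hR₁
  have hI1 : (1 : ℝ) ∈ Icc (0 : ℝ) 1 := right_mem_Icc.2 zero_le_one
  refine holRel_push h₀ h₁ hN HC ?_ (fun x hx => (HN x hx).2) ?_ hr
  · have e := (HN 0 (mem_of_mem_nhds hN)).2.2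
    rw [H0 1 hI1, hc1] at e
    exact (congrArg Prod.fst e).symm
  · have hO : IsOpen (Metric.ball (0 : ℂ) 1 ×ˢ Metric.ball (0 : ℂ) η) :=
      Metric.isOpen_ball.prod Metric.isOpen_ball
    filter_upwards [hN, eventually_forall_mem hN HC hO fun t ht => by
      rw [H0 t ht]
      exact ⟨by rw [(hc t ht).1]; simp, by simpa using (hc t ht).2⟩] with x hx hx'
    have hcj : ∀ t ∈ Icc (0 : ℝ) 1, Φ.ConjAt S S' (H x t) := fun t ht => by
      obtain ⟨e1, e2⟩ := hx' t ht
      exact h.conjAt _ (mem_ball_zero_iff.1 e1).le (mem_ball_zero_iff.1 e2).le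
    exact ⟨fun t ht => (hcj t ht).2.1, leafPath_push (HN x hx).1 hcj⟩

end FiberedDiffeo

/-! ### Moving a transversal by the flow -/

namespace PreparedSaddle

variable {S : PreparedSaddle}

namespace IsSector

variable {α : ℂ → ℂ} {c : ℝ} {Ω : Set (ℂ × ℂ)} {Y : ℂ × ℂ → ℂ} {ρ B : ℝ}

theorem mem_real (h : S.IsSector α c Ω Y ρ B) (hc : c ≤ 1) {s : ℝ} (hs : 0 ≤ s) {a : ℂ}
    (ha : ‖a‖ < ρ * Real.exp (-s)) : ((s : ℂ), a) ∈ Ω := by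
  have h1 : ‖a‖ * Real.exp s < ρ := by
    calc ‖a‖ * Real.exp s < ρ * Real.exp (-s) * Real.exp s := by gcongr
      _ = ρ := by rw [mul_assoc, ← Real.exp_add]; simp
  have h2 : ‖a‖ ≤ ‖a‖ * Real.exp s := le_mul_of_one_le_right (norm_nonneg _) (Real.one_le_exp hs)
  refine h.mem _ _ (h2.trans_lt h1) ?_ ?_
  · rw [Complex.norm_real, Real.norm_eq_abs, abs_of_nonneg hs, Complex.ofReal_re]
    exact mul_le_of_le_one_left hs hc
  · rw [Complex.ofReal_re]
    exact h1.le.trans h.radius_le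

theorem mem_real_of_le (h : S.IsSector α c Ω Y ρ B) (hc : c ≤ 1) {s τ : ℝ} (hs : 0 ≤ s)
    (hsτ : s ≤ τ) {a : ℂ} (ha : ‖a‖ < ρ * Real.exp (-τ)) : ((s : ℂ), a) ∈ Ω := by
  refine h.mem_real hc hs (ha.trans_le ?_)
  have := h.radius_pos
  gcongr

/-- On `{x = 0}` the flow is linear. -/
theorem apply_zero (h : S.IsSector α c Ω Y ρ B) (hc : c ≤ 1) {s : ℝ} (hs : 0 ≤ s) :
    Y (s, 0) = α 0 * Complex.exp (-(S.lam * s)) := by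
  have hm : ∀ u ∈ Icc (0 : ℝ) s, ((u : ℂ), (0 : ℂ)) ∈ Ω := fun u hu =>
    h.mem_real hc hu.1 (by have := h.radius_pos; simp; positivity)
  have hd : ∀ u ∈ Icc (0 : ℝ) s, HasDerivAt (fun u : ℝ => Y (u, 0) * Complex.exp (S.lam * u)) 0 u := by
    intro u hu
    have h1 := h.hasDerivAt _ (hm u hu)
    have h2 : HasDerivAt (fun s => Y (s, 0)) (-(S.lam * Y (u, 0))) (u : ℂ) := by
      have := HasFDerivAt.comp_hasDerivAt (u : ℂ) ((ContinuousLinearMap.snd ℂ ℂ ℂ).hasFDerivAt) h1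
      refine this.congr_deriv ?_
      simp [X_zero_left]
    have h3 : HasDerivAt (fun s : ℂ => Complex.exp (S.lam * s)) (Complex.exp (S.lam * u) * S.lam) u := by
      simpa using ((hasDerivAt_id (u : ℂ)).const_mul (S.lam : ℂ)).cexp
    refine ((h2.mul h3).comp_ofReal).congr_deriv ?_
    ring
  have := eqOn_of_hasDerivAt_zero_off_finite (a := 0) (b := s)
    (fun u hu => (hd u hu).continuousAt.continuousWithinAt) finite_empty
    (fun u hu => hd u (Ioo_subset_Icc_self hu.1)) s (right_mem_Icc.2 hs)
  have h0 : Y (0, 0) = α 0 := h.init 0 (by simpa using hm 0 (left_mem_Icc.2 hs))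
  simp only [Complex.ofReal_zero, mul_zero, Complex.exp_zero, mul_one, h0] at this
  rw [← this, mul_assoc, ← Complex.exp_add]
  simp

theorem ne_zero (h : S.IsSector α c Ω Y ρ B) {p : ℂ × ℂ} (hp : p ∈ Ω) (hα : α p.2 ≠ 0) : Y p ≠ 0 := by
  obtain ⟨w, hw⟩ := h.eq_mul_exp p hp
  rw [hw]
  exact mul_ne_zero hα (Complex.exp_ne_zero w)

/-- Any path of logarithmic abscissas lifts to a leaf. -/
theorem isLeafPath (h : S.IsSector α c Ω Y ρ B) {a : ℂ} (hα : α a ≠ 0) {s : ℝ → ℂ}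
    (hs : ContinuousOn s (Icc 0 1)) (hm : ∀ t ∈ Icc (0 : ℝ) 1, (s t, a) ∈ Ω) {F : Set ℝ}
    (hF : F.Finite) (hd : ∀ t ∈ Ioo (0 : ℝ) 1 \ F, DifferentiableAt ℝ s t) :
    S.IsLeafPath (fun t => (a * Complex.exp (s t), Y (s t, a))) := by
  refine ⟨?_, fun t ht => ⟨h.mem_U _ (hm t ht), fun e => h.ne_zero (hm t ht) hα
    (congrArg Prod.snd e)⟩, F, hF, fun t ht => ?_⟩
  · exact (continuousOn_const.mul hs.cexp).prodMk
      (h.holo.continuousOn.comp (hs.prodMk continuousOn_const) hm)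
  · have h1 := h.hasDerivAt _ (hm t (Ioo_subset_Icc_self ht.1))
    refine ⟨deriv s t, (HasDerivAt.scomp t h1 (hd t ht).hasDerivAt)⟩

end IsSector

/-- The germ obtained from `R` by following the leaves for the real time `τ`. -/
def flowGerm {R : RegGerm} {c : ℝ} {Ω : Set (ℂ × ℂ)} {Y : ℂ × ℂ → ℂ} {ρ B : ℝ}
    (h : S.IsSector R.α c Ω Y ρ B) (hc : c ≤ 1) {τ : ℝ} (hτ : 0 ≤ τ) : RegGerm where
  α x := Y (τ, Complex.exp (-τ) * x)
  r y := Complex.exp τ * R.r y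
  analytic_α := by
    rw [Complex.analyticAt_iff_eventually_differentiableAt]
    have h1 : ((τ : ℂ), Complex.exp (-τ) * 0) ∈ Ω := by
      rw [mul_zero]
      exact h.mem_real hc hτ (by have := h.radius_pos; simp; positivity)
    have h2 : Continuous fun x : ℂ => ((τ : ℂ), Complex.exp (-τ) * x) := by fun_prop
    filter_upwards [h2.continuousAt.eventually (h.isOpen.mem_nhds h1)] with x hx
    exact DifferentiableAt.comp (g := Y) (f := fun x : ℂ => ((τ : ℂ), Complex.exp (-τ) * x)) x
      (h.holo.differentiableAt (h.isOpen.mem_nhds hx)) (by fun_prop)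
  α_ne := by
    rw [mul_zero, h.apply_zero hc hτ]
    exact mul_ne_zero R.α_ne (Complex.exp_ne_zero _)
  analytic_r := analyticAt_const.mul R.analytic_r
  r_zero := by rw [R.r_zero, mul_zero]
  deriv_r := by
    rw [deriv_const_mul _ R.analytic_r.differentiableAt]
    exact mul_ne_zero (Complex.exp_ne_zero _) R.deriv_r

variable {R : RegGerm} {c : ℝ} {Ω : Set (ℂ × ℂ)} {Y : ℂ × ℂ → ℂ} {ρ B : ℝ}

theorem norm_flowGerm (h : S.IsSector R.α c Ω Y ρ B) (hc : c ≤ 1) {τ : ℝ} (hτ : 0 ≤ τ) :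
    ‖(flowGerm h hc hτ).α 0‖ = ‖R.α 0‖ * Real.exp (-(S.lam * τ)) := by
  simp only [flowGerm]
  rw [mul_zero, h.apply_zero hc hτ, norm_mul, Complex.norm_exp]
  simp

/-- The deformation which defines the holonomy along the flow. -/
def flowPath (Y : ℂ × ℂ → ℂ) (τ : ℝ) (a : ℂ) (t : ℝ) : ℂ × ℂ :=
  (a * Complex.exp ((t * τ : ℝ) : ℂ), Y (((t * τ : ℝ) : ℂ), a))

theorem flowPath_spec (h : S.IsSector R.α c Ω Y ρ B) (hc : c ≤ 1) {τ : ℝ} (hτ : 0 ≤ τ) :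
    ∃ N ∈ 𝓝 (0 : ℂ), (∀ a ∈ N, ‖a‖ < ρ * Real.exp (-τ)) ∧
      ContinuousOn (Function.uncurry (flowPath Y τ)) (N ×ˢ Icc (0 : ℝ) 1) ∧
      ∀ a ∈ N, S.IsLeafPath (flowPath Y τ a) ∧ flowPath Y τ a 0 = (a, R.α a) ∧
        flowPath Y τ a 1 = (Complex.exp τ * a, (flowGerm h hc hτ).α (Complex.exp τ * a)) := by
  have hρ : 0 < ρ * Real.exp (-τ) := mul_pos h.radius_pos (Real.exp_pos _)
  have hev : ∀ᶠ a in 𝓝 (0 : ℂ), ‖a‖ < ρ * Real.exp (-τ) ∧ R.α a ≠ 0 :=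
    (continuous_norm.continuousAt.eventually (gt_mem_nhds (by simpa using hρ))).and
      (R.analytic_α.continuousAt.eventually_ne R.α_ne)
  have hm : ∀ a : ℂ, ‖a‖ < ρ * Real.exp (-τ) → ∀ t ∈ Icc (0 : ℝ) 1, (((t * τ : ℝ) : ℂ), a) ∈ Ω :=
    fun a ha t ht => h.mem_real_of_le hc (mul_nonneg ht.1 hτ) (mul_le_of_le_one_left hτ ht.2) ha
  refine ⟨_, hev, fun a ha => ha.1, ?_, fun a ha => ⟨?_, ?_, ?_⟩⟩
  · have h1 : Continuous fun p : ℂ × ℝ => (((p.2 * τ : ℝ) : ℂ), p.1) :=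
      (Complex.continuous_ofReal.comp (by fun_prop)).prodMk continuous_fst
    have h2 : Continuous fun p : ℂ × ℝ => p.1 * Complex.exp ((p.2 * τ : ℝ) : ℂ) :=
      continuous_fst.mul (Complex.continuous_exp.comp (continuous_fst.comp h1))
    exact h2.continuousOn.prodMk (h.holo.continuousOn.comp h1.continuousOn
      fun p hp => hm _ hp.1.1 _ hp.2)
  · refine h.isLeafPath ha.2 (s := fun t : ℝ => ((t * τ : ℝ) : ℂ))
      (Complex.continuous_ofReal.comp (by fun_prop)).continuousOn (hm a ha.1) finite_empty
      fun t _ => ?_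
    have : HasDerivAt (fun t : ℝ => t * τ) τ t := by simpa using (hasDerivAt_id t).mul_const τ
    exact this.ofReal_comp.differentiableAt
  · have := h.init a (by simpa using hm a ha.1 0 (left_mem_Icc.2 zero_le_one))
    simp [flowPath, this]
  · simp only [flowPath, flowGerm, one_mul]
    rw [← mul_assoc, ← Complex.exp_add]
    simp [mul_comm]

theorem HolRel.flow (h : S.IsSector R.α c Ω Y ρ B) (hc : c ≤ 1) {τ : ℝ} (hτ : 0 ≤ τ) :
    S.HolRel R (flowGerm h hc hτ) := by
  obtain ⟨N, hN, -, HC, HN⟩ := flowPath_spec h hc hτ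
  obtain ⟨e1, e2, e3⟩ := HN 0 (mem_of_mem_nhds hN)
  rw [mul_zero] at e3
  exact ⟨flowPath Y τ 0, fun x => Complex.exp τ * x, e1, e2, e3, ⟨N, hN, flowPath Y τ, HC,
    fun _ _ => rfl, HN⟩, Eventually.of_forall fun y => rfl⟩

end PreparedSaddle

/-! ### Equivalences of loop germs -/

theorem mem_adaptedRegion_of_norm_le {lam A B : ℝ} (hlam : 0 < lam) {p : ℂ × ℂ} (hA : ‖p.2‖ ≤ A)
    (hB : ‖p.2‖ ≤ B) (hx : ‖p.1‖ ≤ 1) : p ∈ adaptedRegion lam A B :=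
  ⟨(mul_le_of_le_one_right (norm_nonneg _)
    (Real.rpow_le_one (norm_nonneg _) hx hlam.le)).trans hA, hx, hB⟩

theorem mem_adaptedRegion_zero {lam A B : ℝ} (hlam : 0 < lam) (hA : 0 < A) {y : ℂ}
    (hB : ‖y‖ ≤ B) : ((0 : ℂ), y) ∈ adaptedRegion lam A B :=
  ⟨by simp [Real.zero_rpow hlam.ne', hA.le], by simp, hB⟩

theorem isOpen_adaptedInterior {lam : ℝ} (hlam : 0 < lam) (A B : ℝ) :
    IsOpen {p : ℂ × ℂ | ‖p.2‖ * ‖p.1‖ ^ lam < A ∧ ‖p.1‖ < 1 ∧ ‖p.2‖ < B} := by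
  have h1 : Continuous fun p : ℂ × ℂ => ‖p.2‖ * ‖p.1‖ ^ lam :=
    (continuous_norm.comp continuous_snd).mul
      ((continuous_norm.comp continuous_fst).rpow_const fun _ => Or.inr hlam.le)
  have o1 : IsOpen {p : ℂ × ℂ | ‖p.2‖ * ‖p.1‖ ^ lam < A} := isOpen_lt h1 continuous_const
  have o2 : IsOpen {p : ℂ × ℂ | ‖p.1‖ < 1} := isOpen_lt (by fun_prop) continuous_const
  have o3 : IsOpen {p : ℂ × ℂ | ‖p.2‖ < B} := isOpen_lt (by fun_prop) continuous_const
  exact o1.inter (o2.inter o3)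

namespace AbstractLoop

theorem mem_cls_of_holRel {L : AbstractLoop} {R R₁ : RegGerm} (hR : R ∈ L.cls)
    (h : L.toPreparedSaddle.HolRel R R₁) : R₁ ∈ L.cls := by
  obtain ⟨R₀, -, hcls⟩ := L.isOrbit
  rw [hcls] at hR ⊢
  exact PreparedSaddle.HolRel.trans hR h

theorem holRel_of_mem_cls {L : AbstractLoop} {R R₁ : RegGerm} (hR : R ∈ L.cls) (hR₁ : R₁ ∈ L.cls) :
    L.toPreparedSaddle.HolRel R R₁ := by
  obtain ⟨R₀, -, hcls⟩ := L.isOrbit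
  rw [hcls] at hR hR₁
  exact (PreparedSaddle.HolRel.symm hR).trans hR₁

end AbstractLoop

namespace FiberedDiffeo

variable {Φ : FiberedDiffeo} {S S' : PreparedSaddle}

open PreparedSaddle in
/-- The flow from a germ whose base point may lie on the boundary of the adapted region where the
foliations are conjugate. Nearby leaf paths may start outside of the region, but end inside it,
hence are mapped to leaf paths by analytic continuation. -/
theorem holRel_flow_push {A B₀ : ℝ} (hA : 0 < A)
    (hreg : ∀ p ∈ adaptedRegion S.lam A B₀, Φ.ConjAt S S' p) {R R' R₁' : RegGerm}
    (hR : Φ.RegCorresp R R') (hRB : ‖R.α 0‖ ≤ B₀) {c : ℝ} {Ω : Set (ℂ × ℂ)} {Y : ℂ × ℂ → ℂ}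
    {ρ B : ℝ} (h : S.IsSector R.α c Ω Y ρ B) (hc : c ≤ 1) {τ : ℝ} (hτ : 0 < τ)
    (hR₁ : Φ.RegCorresp (flowGerm h hc hτ.le) R₁') : S'.HolRel R' R₁' := by
  obtain ⟨N, hN, hNρ, HC, HN⟩ := flowPath_spec h hc hτ.le
  have hI1 : (1 : ℝ) ∈ Icc (0 : ℝ) 1 := right_mem_Icc.2 zero_le_one
  have hlam := S.lam_pos
  set O : Set (ℂ × ℂ) := S.U ∩ (Φ.e.source ∩ Φ.e ⁻¹' S'.U) with hO
  have hOo : IsOpen O := S.isOpen_U.inter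
    (Φ.holo.continuousOn.isOpen_inter_preimage Φ.e.open_source S'.isOpen_U)
  have hzero : ∀ t ∈ Icc (0 : ℝ) 1, flowPath Y τ 0 t = (0, R.α 0 * Complex.exp (-(S.lam * (t * τ)))) := by
    intro t ht
    simp only [flowPath, zero_mul]
    rw [h.apply_zero hc (mul_nonneg ht.1 hτ.le)]
    push_cast
    rfl
  have hexp : ∀ t : ℝ, ‖R.α 0 * Complex.exp (-(S.lam * (t * τ)))‖ =
      ‖R.α 0‖ * Real.exp (-(S.lam * (t * τ))) := fun t => by
    rw [norm_mul, Complex.norm_exp]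
    congr 2
    simp [← Complex.ofReal_mul]
  have hzreg : ∀ t ∈ Icc (0 : ℝ) 1, flowPath Y τ 0 t ∈ adaptedRegion S.lam A B₀ := by
    intro t ht
    rw [hzero t ht]
    refine mem_adaptedRegion_zero hlam hA ?_
    rw [hexp]
    refine (mul_le_of_le_one_right (norm_nonneg _) (Real.exp_le_one_iff.2 ?_)).trans hRB
    have := mul_nonneg hlam.le (mul_nonneg ht.1 hτ.le)
    linarith
  have hE1 : ∀ᶠ a in 𝓝 (0 : ℂ), ∀ t ∈ Icc (0 : ℝ) 1, flowPath Y τ a t ∈ O :=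
    eventually_forall_mem hN HC hOo fun t ht => by
      obtain ⟨e1, e2, e3, -⟩ := hreg _ (hzreg t ht)
      exact ⟨e1, e2, e3⟩
  set T : Set (ℂ × ℂ) := {p | ‖p.2‖ * ‖p.1‖ ^ S.lam < A ∧ ‖p.1‖ < 1 ∧ ‖p.2‖ < B₀} with hT
  have hTo : IsOpen T := isOpen_adaptedInterior hlam A B₀
  have hTreg : ∀ p ∈ T, p ∈ adaptedRegion S.lam A B₀ := fun p hp => ⟨hp.1.le, hp.2.1.le, hp.2.2.le⟩
  have hE2 : ∀ᶠ a in 𝓝 (0 : ℂ), flowPath Y τ a 1 ∈ T := by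
    have h1 : ContinuousOn (fun a => flowPath Y τ a 1) N :=
      HC.comp (f := fun x : ℂ => (x, (1 : ℝ))) (by fun_prop) fun x hx => ⟨hx, hI1⟩
    refine (h1.continuousAt hN).eventually (hTo.mem_nhds ?_)
    simp only [hzero 1 hI1]
    refine ⟨by simp [Real.zero_rpow hlam.ne', hA], by simp, ?_⟩
    simp only [hexp]
    have h2 : 0 < ‖R.α 0‖ := norm_pos_iff.2 R.α_ne
    have h3 : Real.exp (-(S.lam * (1 * τ))) < 1 := by
      rw [Real.exp_lt_one_iff]
      have := mul_pos hlam hτ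
      linarith
    nlinarith
  refine holRel_push (k := fun x => Complex.exp τ * x) hR hR₁ hN HC (by simp)
    (fun x hx => (HN x hx).2) ?_ (Eventually.of_forall fun y => rfl)
  filter_upwards [hE1, hE2, hN] with a h1 h2 h3
  refine ⟨fun t ht => (h1 t ht).2.1, ?_⟩
  rcases eq_or_ne a 0 with rfl | ha
  · exact leafPath_push (HN 0 h3).1 fun t ht => hreg _ (hzreg t ht)
  set p : ℂ → ℂ × ℂ := fun s => (a * Complex.exp s, Y (s, a)) with hp
  set D : Set ℂ := {s | (s, a) ∈ Ω} ∩ p ⁻¹' O with hD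
  have hΩa : IsOpen {s : ℂ | (s, a) ∈ Ω} := h.isOpen.preimage (by fun_prop : Continuous fun s : ℂ => (s, a))
  have hpd : ∀ s, (s, a) ∈ Ω → HasDerivAt p (S.X (p s)) s := fun s hs => h.hasDerivAt _ hs
  have hDo : IsOpen D := ContinuousOn.isOpen_inter_preimage
    (fun s hs => (hpd s hs).continuousAt.continuousWithinAt) hΩa hOo
  have hψ : ∀ s ∈ D, HasDerivAt (fun s => Φ.e (p s)) (fderiv ℂ Φ.e (p s) (S.X (p s))) s :=
    fun s hs => (Φ.differentiableAt hs.2.2.1).hasFDerivAt.comp_hasDerivAt s (hpd s hs.1)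
  have hseg : ∀ s ∈ Icc (0 : ℝ) τ, (s : ℂ) ∈ D := by
    intro s hs
    refine ⟨h.mem_real_of_le hc hs.1 hs.2 (hNρ a h3), ?_⟩
    have := h1 (s / τ) ⟨div_nonneg hs.1 hτ.le, div_le_one_of_le₀ hs.2 hτ.le⟩
    rwa [flowPath, div_mul_cancel₀ _ hτ.ne'] at this
  have hψD : DifferentiableOn ℂ (fun s => Φ.e (p s)) D := fun s hs =>
    (hψ s hs).differentiableAt.differentiableWithinAt
  have hF2 : DifferentiableOn ℂ (fun s => S'.X (Φ.e (p s))) D :=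
    S'.differentiableOn_X.comp hψD fun s hs => hs.2.2.2
  have hconn : IsPreconnected ((fun s : ℝ => (s : ℂ)) '' Icc 0 τ) :=
    isPreconnected_Icc.image _ Complex.continuous_ofReal.continuousOn
  have hsub : (fun s : ℝ => (s : ℂ)) '' Icc 0 τ ⊆ D := by
    rintro _ ⟨s, hs, rfl⟩; exact hseg s hs
  have hτD : (τ : ℂ) ∈ D := hseg τ (right_mem_Icc.2 hτ.le)
  -- `Φ` maps the field to the field along the whole leaf path, since it does so near its end
  have heq := AnalyticOnNhd.eqOn_of_preconnected_of_eventuallyEq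
    (((hψD.deriv hDo).analyticOnNhd hDo).mono hsub) ((hF2.analyticOnNhd hDo).mono hsub) hconn
    (z₀ := (τ : ℂ)) ⟨τ, right_mem_Icc.2 hτ.le, rfl⟩ (by
      have hpT : p τ ∈ T := by
        have := h2
        rwa [flowPath, one_mul] at this
      filter_upwards [hDo.mem_nhds hτD,
        (hpd _ hτD.1).continuousAt.eventually (hTo.mem_nhds hpT)] with s e1 e2
      rw [(hψ s e1).deriv]
      exact (hreg _ (hTreg _ e2)).eq_of_fst_ne (mul_ne_zero ha (Complex.exp_ne_zero _)))
  obtain ⟨l1, l2, -⟩ := (HN a h3).1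
  refine ⟨Φ.holo.continuousOn.comp l1 fun t ht => (h1 t ht).2.1,
    fun t ht => ⟨(h1 t ht).2.2, Φ.ne_zero (h1 t ht).2.1 (l2 t ht).2⟩, ∅, finite_empty, fun t ht => ?_⟩
  have htI := Ioo_subset_Icc_self ht.1
  have hts : t * τ ∈ Icc 0 τ := ⟨mul_nonneg htI.1 hτ.le, mul_le_of_le_one_left hτ.le htI.2⟩
  have d1 : HasDerivAt (fun t : ℝ => ((t * τ : ℝ) : ℂ)) τ t := by
    have : HasDerivAt (fun t : ℝ => t * τ) τ t := by simpa using (hasDerivAt_id t).mul_const τ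
    exact this.ofReal_comp
  have d2 := hψ _ (hseg _ hts)
  have d3 := heq ⟨_, hts, rfl⟩
  simp only [d2.deriv] at d3
  rw [d3] at d2
  have d4 := HasDerivAt.scomp (h := fun t : ℝ => ((t * τ : ℝ) : ℂ)) t d2 d1
  exact ⟨τ, d4⟩

/-- `Φ` conjugates the foliations near `{|x| ≤ 1, y = 0}` and maps an element of the class of `L`,
with small base point, to an element of the class of `L'`. -/
def LoopConj (Φ : FiberedDiffeo) (L L' : AbstractLoop) : Prop :=
  ∃ η, Φ.IsConj L.toPreparedSaddle L'.toPreparedSaddle η ∧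
    ∃ R ∈ L.cls, ∃ R' ∈ L'.cls, Φ.RegCorresp R R' ∧ ‖R.α 0‖ < η

/-- An equivalence of loop germs, and its inverse, are conjugacies near `{y = 0}` which send some
regular germ with small base point to the class. The germs given by the definition may have a
large base point: they are moved by the flow, which contracts `{x = 0}` to the origin. -/
theorem Carries.loopConj {L Lt : AbstractLoop} (h : Φ.Carries Lt L) :
    Φ.LoopConj Lt L ∧ Φ.symm.LoopConj L Lt := by
  obtain ⟨A, B, hA, hB, h1, h2, h3, Rt, hRt, R, hR, hRB, hcor⟩ := h
  have hlam := Lt.lam_pos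
  have hreg : ∀ p ∈ adaptedRegion Lt.lam A B,
      Φ.ConjAt Lt.toPreparedSaddle L.toPreparedSaddle p := fun p hp =>
    ⟨(h1 hp).1, (h1 hp).2, h2 hp, h3 p hp⟩
  have hcj : ∀ p : ℂ × ℂ, ‖p.1‖ ≤ 1 → ‖p.2‖ ≤ min A B →
      Φ.ConjAt Lt.toPreparedSaddle L.toPreparedSaddle p := fun p e1 e2 =>
    hreg p (mem_adaptedRegion_of_norm_le hlam (e2.trans (min_le_left _ _))
      (e2.trans (min_le_right _ _)) e1)
  have hconj : Φ.IsConj Lt.toPreparedSaddle L.toPreparedSaddle (min A B) :=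
    ⟨lt_min hA hB, hcj, lam_eq_of_conjAt (lt_min hA hB) hcj⟩
  obtain ⟨η', hconj'⟩ := hconj.symm
  obtain ⟨Ω, Y, ρ, B', hsec⟩ := Lt.exists_sector Rt.analytic_α
    (fun y hy => (h1 (mem_adaptedRegion_zero hlam hA (hy.trans hRB))).1) one_pos
  have h00 : ((0 : ℂ), (0 : ℂ)) ∈ Φ.e.source := Φ.mem_source_disk (by simp)
  obtain ⟨δ, hδ, hball⟩ : ∃ δ > 0, ∀ y : ℂ, ‖y‖ < δ →
      ((0 : ℂ), y) ∈ Φ.e.source ∧ ‖Φ.fiberMap 0 y‖ < η' := by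
    have e1 : ∀ᶠ y in 𝓝 (0 : ℂ), ‖Φ.fiberMap 0 y‖ < η' := by
      refine (Φ.analyticAt_fiberMap h00).continuousAt.norm.eventually (gt_mem_nhds ?_)
      dsimp only
      rw [Φ.fiberMap_zero (by simp), norm_zero]
      exact hconj'.pos
    obtain ⟨δ, hδ, hb⟩ := Metric.eventually_nhds_iff_ball.1 ((Φ.eventually_mem_source h00).and e1)
    exact ⟨δ, hδ, fun y hy => hb y (by simpa using hy)⟩
  obtain ⟨τ, hτ, hτlt⟩ : ∃ τ : ℝ, 0 < τ ∧
      ‖Rt.α 0‖ * Real.exp (-(Lt.lam * τ)) < min (min A B) δ := by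
    have t1 : Tendsto (fun τ : ℝ => ‖Rt.α 0‖ * Real.exp (-(Lt.lam * τ))) atTop (𝓝 0) := by
      have := (Real.tendsto_exp_neg_atTop_nhds_zero.comp
        (tendsto_id.const_mul_atTop hlam)).const_mul ‖Rt.α 0‖
      simpa using this
    obtain ⟨τ, e1, e2⟩ := ((t1.eventually (gt_mem_nhds (lt_min hconj.pos hδ))).and
      (eventually_gt_atTop 0)).exists
    exact ⟨τ, e2, e1⟩
  set R₀ := PreparedSaddle.flowGerm hsec le_rfl hτ.le with hR₀
  have hn : ‖R₀.α 0‖ < min (min A B) δ := by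
    rw [hR₀, PreparedSaddle.norm_flowGerm]; exact hτlt
  obtain ⟨hs, hf⟩ := hball _ (hn.trans_le (min_le_right _ _))
  have hc₀ : Φ.RegCorresp R₀ (Φ.push R₀ hs) := regCorresp_push hs
  have hm : R₀ ∈ Lt.cls := AbstractLoop.mem_cls_of_holRel hRt (PreparedSaddle.HolRel.flow hsec le_rfl hτ.le)
  have hm' : Φ.push R₀ hs ∈ L.cls :=
    AbstractLoop.mem_cls_of_holRel hR (holRel_flow_push hA hreg hcor hRB hsec le_rfl hτ hc₀)
  exact ⟨⟨_, hconj, R₀, hm, _, hm', hc₀, hn.trans_le (min_le_left _ _)⟩,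
    ⟨η', hconj', _, hm', R₀, hm, hc₀.symm, hf⟩⟩

end FiberedDiffeo

/-! ### Corner transitions under a conjugacy -/

theorem expPath_re (β C t : ℝ) : (expPath β C t).re = t := by
  rw [expPath, Complex.add_re, Complex.ofReal_re, Complex.mul_re, Complex.I_re, Complex.I_im,
    Complex.ofReal_im]
  ring

theorem expPath_im (β C t : ℝ) : (expPath β C t).im = C * (Real.exp (β * t) - 1) := by
  rw [expPath, Complex.add_im, Complex.ofReal_im, Complex.mul_im, Complex.I_re, Complex.I_im,
    Complex.ofReal_re]
  ring

theorem differentiable_expPath (β C : ℝ) : Differentiable ℝ (expPath β C) := by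
  intro t
  have e1 : DifferentiableAt ℝ (fun t : ℝ => (t : ℂ)) t := Complex.ofRealCLM.differentiableAt
  have e2 : DifferentiableAt ℝ (fun t : ℝ => ((C * (Real.exp (β * t) - 1) : ℝ) : ℂ)) t :=
    DifferentiableAt.comp (g := fun t : ℝ => (t : ℂ)) (f := fun t : ℝ => C * (Real.exp (β * t) - 1)) t
      Complex.ofRealCLM.differentiableAt (by fun_prop)
  exact e1.add (e2.const_mul Complex.I)

theorem abs_expPath_im_sub_le {β C lam T u : ℝ} (hβ : 0 ≤ β) (hβl : β ≤ lam) (hC : C = 1 ∨ C = -1)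
    (huT : u ≤ T) (hT : β * T < Real.log (1 + Real.pi)) :
    |(expPath β C T - expPath β C u).im| ≤ (1 + Real.pi) * lam * (T - u) := by
  have hπ : 0 < 1 + Real.pi := by have := Real.pi_pos; linarith
  have hC' : |C| = 1 := by rcases hC with rfl | rfl <;> simp
  have h1 : (expPath β C T - expPath β C u).im = C * (Real.exp (β * T) - Real.exp (β * u)) := by
    rw [Complex.sub_im, expPath_im, expPath_im]; ring
  have h2 : Real.exp (β * u) = Real.exp (β * T) * Real.exp (-(β * (T - u))) := by
    rw [← Real.exp_add]; congr 1; ring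
  have h3 : Real.exp (β * T) ≤ 1 + Real.pi := ((Real.lt_log_iff_exp_lt hπ).1 hT).le
  have h4 := Real.add_one_le_exp (-(β * (T - u)))
  have h5 : Real.exp (β * u) ≤ Real.exp (β * T) := Real.exp_le_exp.2 (by gcongr)
  have h6 : 0 ≤ T - u := sub_nonneg.2 huT
  rw [h1, abs_mul, hC', one_mul, abs_of_nonneg (sub_nonneg.2 h5), h2]
  calc Real.exp (β * T) - Real.exp (β * T) * Real.exp (-(β * (T - u)))
      = Real.exp (β * T) * (1 - Real.exp (-(β * (T - u)))) := by ring
    _ ≤ (1 + Real.pi) * (lam * (T - u)) := by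
        refine mul_le_mul h3 ?_ ?_ hπ.le
        · nlinarith
        · have : Real.exp (-(β * (T - u))) ≤ 1 := Real.exp_le_one_iff.2 (by nlinarith)
          linarith
    _ = _ := by ring

/-- Slope of a cone containing the logarithmic paths which define the `m`-th corner transition. -/
def coneSlope (lam : ℝ) (m : ℤ) : ℝ := (1 + ((1 + Real.pi) * lam + 2 * Real.pi * |(m : ℝ)|))⁻¹

theorem coneSlope_pos {lam : ℝ} (h : 0 < lam) (m : ℤ) : 0 < coneSlope lam m := by
  have := Real.pi_pos
  unfold coneSlope
  positivity

theorem coneSlope_le_one {lam : ℝ} (h : 0 < lam) (m : ℤ) : coneSlope lam m ≤ 1 := by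
  have := Real.pi_pos
  refine inv_le_one_of_one_le₀ ?_
  have : 0 ≤ (1 + Real.pi) * lam + 2 * Real.pi * |(m : ℝ)| := by positivity
  linarith

theorem coneSlope_mul_le {lam : ℝ} (h : 0 < lam) (m : ℤ) {s : ℂ}
    (hs : |s.im| ≤ ((1 + Real.pi) * lam + 2 * Real.pi * |(m : ℝ)|) * s.re) (h0 : 0 ≤ s.re) :
    coneSlope lam m * ‖s‖ ≤ s.re := by
  have hπ := Real.pi_pos
  have h1 : 0 < 1 + ((1 + Real.pi) * lam + 2 * Real.pi * |(m : ℝ)|) := by positivity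
  rw [coneSlope, inv_mul_le_iff₀ h1]
  have h2 := Complex.norm_le_abs_re_add_abs_im s
  rw [abs_of_nonneg h0] at h2
  linarith

namespace PreparedSaddle

variable {S : PreparedSaddle} {α : ℂ → ℂ} {c : ℝ} {Ω : Set (ℂ × ℂ)} {Y : ℂ × ℂ → ℂ} {ρ B : ℝ}

/-- Lifts of paths are given by the sector, since the lift of a path avoiding `0` is unique. -/
theorem IsSector.lift_end (h : S.IsSector α c Ω Y ρ B) {a : ℂ} (ha : a ≠ 0) (hα : α a ≠ 0) {s : ℝ → ℂ}
    (hs : Differentiable ℝ s) (hm : ∀ t ∈ Icc (0 : ℝ) 1, (s t, a) ∈ Ω) {Γ : ℝ → ℂ}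
    (hΓ : ∀ t ∈ Icc (0 : ℝ) 1, Γ t = a * Complex.exp (s t)) {p q : ℂ × ℂ} (hl : S.LiftsTo Γ p q)
    (hp : p.2 = Y (s 0, a)) : q.2 = Y (s 1, a) := by
  obtain ⟨k, hk, hkΓ, hk0, hk1⟩ := hl
  have hI0 : (0 : ℝ) ∈ Icc (0 : ℝ) 1 := left_mem_Icc.2 zero_le_one
  have hI1 : (1 : ℝ) ∈ Icc (0 : ℝ) 1 := right_mem_Icc.2 zero_le_one
  have hlp := h.isLeafPath hα hs.continuous.continuousOn hm finite_empty fun t _ => hs t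
  have := hk.leafOn.unique hlp.leafOn (Prod.ext ((hkΓ 0 hI0).trans (hΓ 0 hI0)) (by rw [hk0, hp]))
    (Or.inl fun t ht => by
      rw [hkΓ t ht, hΓ t ht]
      exact ⟨mul_ne_zero ha (Complex.exp_ne_zero _), rfl⟩) 1 hI1
  rw [hk1] at this
  rw [this]

end PreparedSaddle

namespace FiberedDiffeo

variable {Φ : FiberedDiffeo} {S S' : PreparedSaddle}

theorem IsConj.liftsTo {η : ℝ} (hΦ : Φ.IsConj S S' η) {α : ℂ → ℂ} {c : ℝ} {Ω : Set (ℂ × ℂ)}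
    {Y : ℂ × ℂ → ℂ} {ρ B : ℝ} (h : S.IsSector α c Ω Y ρ B) {a : ℂ} (hα : α a ≠ 0) {s : ℝ → ℂ}
    (hs : Differentiable ℝ s) (hm : ∀ t ∈ Icc (0 : ℝ) 1, (s t, a) ∈ Ω) {τ : ℝ}
    (hτ : B * Real.exp (-(S.lam / 2 * τ)) ≤ η) (hsτ : ∀ t ∈ Icc (0 : ℝ) 1, τ ≤ (s t).re)
    (hs1 : ∀ t ∈ Icc (0 : ℝ) 1, ‖a * Complex.exp (s t)‖ ≤ 1) {Γ : ℝ → ℂ}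
    (hΓ : ∀ t ∈ Icc (0 : ℝ) 1, Γ t = a * Complex.exp (s t)) :
    S'.LiftsTo Γ (Γ 0, Φ.fiberMap (Γ 0) (Y (s 0, a))) (Γ 1, Φ.fiberMap (Γ 1) (Y (s 1, a))) := by
  have hI0 : (0 : ℝ) ∈ Icc (0 : ℝ) 1 := left_mem_Icc.2 zero_le_one
  have hI1 : (1 : ℝ) ∈ Icc (0 : ℝ) 1 := right_mem_Icc.2 zero_le_one
  have hlp := h.isLeafPath hα hs.continuous.continuousOn hm finite_empty fun t _ => hs t
  have hcj : ∀ t ∈ Icc (0 : ℝ) 1, Φ.ConjAt S S' (a * Complex.exp (s t), Y (s t, a)) := by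
    intro t ht
    refine hΦ.conjAt _ (hs1 t ht) ((h.norm_le _ (hm t ht)).trans (le_trans ?_ hτ))
    have h1 := h.bound_pos
    have h2 := S.lam_pos
    have h3 := hsτ t ht
    gcongr
  refine ⟨_, leafPath_push hlp hcj, fun t ht => ?_, ?_, ?_⟩
  · rw [Φ.fibered _ (hcj t ht).2.1, hΓ t ht]
  · rw [Φ.apply_eq (hcj 0 hI0).2.1, hΓ 0 hI0]; rfl
  · rw [Φ.apply_eq (hcj 1 hI1).2.1, hΓ 1 hI1]; rfl

open PreparedSaddle in
/-- The image under a conjugacy of a corner transition, once the transversal has been moved by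
the flow for a time `τ` into the domain of the conjugacy. The transition from the point `x' = e^τ x`
of the new transversal ends at the same point as that from `x`, since both lifts lie in a common
sector over `x`. -/
theorem IsConj.isCornerDet {η : ℝ} (hΦ : Φ.IsConj S S' η) {R : RegGerm} {m : ℤ} {D : ℂ → ℂ}
    (hD : S.IsCornerDet R.α m D) {Ω : Set (ℂ × ℂ)} {Y : ℂ × ℂ → ℂ} {ρ B : ℝ}
    (h : S.IsSector R.α (coneSlope S.lam m) Ω Y ρ B) {τ : ℝ} (hτ : 1 ≤ τ)
    (hτη : B * Real.exp (-(S.lam / 2 * τ)) ≤ η) :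
    S'.IsCornerDet (fun x => Φ.fiberMap x (Y (τ, Complex.exp (-τ) * x))) m
      (fun x => Φ.fiberMap 1 (D (Complex.exp (-τ) * x))) := by
  obtain ⟨ρD, hρD, hD⟩ := hD
  obtain ⟨ρα, hρα, hα⟩ := Metric.eventually_nhds_iff_ball.1
    (R.analytic_α.continuousAt.eventually_ne R.α_ne)
  have hlam := S.lam_pos
  have hπ := Real.pi_pos
  have hτ0 : 0 < τ := by linarith
  refine ⟨min (min ρD ρα) ρ, lt_min (lt_min hρD hρα) h.radius_pos, ?_⟩
  intro β' hβ' C hC T' hT' hβT' x' hx' hx'n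
  rw [hΦ.lam_eq] at hβ'
  -- with `T = T' + τ` and `β T = β' T'` the exponential path through `x` ends at the same height
  set T : ℝ := T' + τ with hT
  have hT0 : 0 < T := by linarith
  set β : ℝ := β' * T' / T with hβdef
  have hβT : β * T = β' * T' := div_mul_cancel₀ _ hT0.ne'
  have hβ0 : 0 ≤ β := div_nonneg (mul_nonneg hβ'.1 hT') hT0.le
  have hββ' : β ≤ β' := by
    rw [hβdef, div_le_iff₀ hT0]
    exact mul_le_mul_of_nonneg_left (by linarith) hβ'.1
  have hβl : β < S.lam := hββ'.trans_lt hβ'.2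
  have hξ : expPath β C T = expPath β' C T' + τ := by
    apply Complex.ext
    · rw [Complex.add_re, expPath_re, expPath_re, Complex.ofReal_re]
    · rw [Complex.add_im, expPath_im, expPath_im, Complex.ofReal_im, hβT, add_zero]
  set x : ℂ := Complex.exp (-τ) * x' with hx
  have hxξ : x = Complex.exp (-expPath β C T) := by
    rw [hx, hx', ← Complex.exp_add, hξ]
    congr 1; ring
  have hxne : x ≠ 0 := by rw [hxξ]; exact Complex.exp_ne_zero _
  have hxnorm : ‖x‖ = Real.exp (-T) := by
    rw [hxξ, Complex.norm_exp, Complex.neg_re, expPath_re]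
  have hx'norm : ‖x'‖ = Real.exp (-T') := by
    rw [hx', Complex.norm_exp, Complex.neg_re, expPath_re]
  have hxx' : ‖x‖ ≤ ‖x'‖ := by
    rw [hxnorm, hx'norm]; exact Real.exp_le_exp.2 (by linarith)
  have hxlt := hxx'.trans_lt hx'n
  have hxD : ‖x‖ < ρD := hxlt.trans_le ((min_le_left _ _).trans (min_le_left _ _))
  have hxα : R.α x ≠ 0 := hα x (by
    simpa using hxlt.trans_le ((min_le_left _ _).trans (min_le_right _ _)))
  have hxρ : ‖x‖ < ρ := hxlt.trans_le (min_le_right _ _)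
  have hβTlog : β * T < Real.log (1 + Real.pi) := by rw [hβT]; exact hβT'
  -- membership in the sector
  have hmem : ∀ s : ℂ, 0 ≤ s.re → s.re ≤ T →
      |s.im| ≤ ((1 + Real.pi) * S.lam + 2 * Real.pi * |(m : ℝ)|) * s.re → (s, x) ∈ Ω := by
    intro s h0 h1 h2
    refine h.mem s x hxρ (coneSlope_mul_le hlam m h2 h0) ?_
    rw [hxnorm, ← Real.exp_add]
    exact Real.exp_le_one_iff.2 (by linarith)
  have hmpos : 0 ≤ 2 * Real.pi * |(m : ℝ)| := by positivity
  have hn1 : ∀ s : ℂ, s.re ≤ T → ‖x * Complex.exp s‖ ≤ 1 := by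
    intro s hs
    rw [norm_mul, hxnorm, Complex.norm_exp, ← Real.exp_add]
    exact Real.exp_le_one_iff.2 (by linarith)
  -- the paths towards `Ω` from `x` and from `x'`, then the circles, in the time from `x`
  set s₁ : ℝ → ℂ := fun t => expPath β C T - expPath β C ((1 - t) * T) with hs₁
  set σ₁ : ℝ → ℂ := fun t => τ + (expPath β' C T' - expPath β' C ((1 - t) * T')) with hσ₁
  set s₂ : ℝ → ℂ := fun t => expPath β C T - 2 * Real.pi * m * t * Complex.I with hs₂
  have hs₁d : Differentiable ℝ s₁ := by
    have := (differentiable_expPath β C).comp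
      (by fun_prop : Differentiable ℝ fun t : ℝ => (1 - t) * T)
    exact (differentiable_const _).sub this
  have hσ₁d : Differentiable ℝ σ₁ := by
    have := (differentiable_expPath β' C).comp
      (by fun_prop : Differentiable ℝ fun t : ℝ => (1 - t) * T')
    exact (differentiable_const _).add ((differentiable_const _).sub this)
  have hs₂d : Differentiable ℝ s₂ := by
    have e1 : Differentiable ℝ (fun t : ℝ => (t : ℂ)) := Complex.ofRealCLM.differentiable
    exact (differentiable_const _).sub ((e1.const_mul _).mul_const _)
  have hs₁re : ∀ t, (s₁ t).re = t * T := fun t => by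
    simp only [hs₁, Complex.sub_re, expPath_re]; ring
  have hσ₁re : ∀ t, (σ₁ t).re = τ + t * T' := fun t => by
    simp only [hσ₁, Complex.add_re, Complex.ofReal_re, Complex.sub_re, expPath_re]; ring
  have hs₂re : ∀ t, (s₂ t).re = T := fun t => by
    have : (2 * Real.pi * m * t * Complex.I : ℂ) = ((2 * Real.pi * m * t : ℝ) : ℂ) * Complex.I := by
      push_cast; ring
    simp only [hs₂, this, Complex.sub_re, expPath_re, Complex.re_ofReal_mul, Complex.I_re, mul_zero,
      sub_zero]
  have hs₁m : ∀ t ∈ Icc (0 : ℝ) 1, (s₁ t, x) ∈ Ω := by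
    intro t ht
    have e1 : 0 ≤ t * T := mul_nonneg ht.1 hT0.le
    refine hmem _ (by rw [hs₁re]; exact e1) (by rw [hs₁re]; nlinarith [ht.2]) ?_
    have e2 := abs_expPath_im_sub_le (u := (1 - t) * T) hβ0 hβl.le hC (by nlinarith) hβTlog
    rw [hs₁re]
    refine e2.trans ?_
    have e3 : T - (1 - t) * T = t * T := by ring
    rw [e3]
    gcongr
    linarith
  have hσ₁m : ∀ t ∈ Icc (0 : ℝ) 1, (σ₁ t, x) ∈ Ω := by
    intro t ht
    have e1 : 0 ≤ t * T' := mul_nonneg ht.1 hT'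
    refine hmem _ (by rw [hσ₁re]; linarith) (by rw [hσ₁re]; nlinarith [ht.2]) ?_
    have e2 := abs_expPath_im_sub_le (u := (1 - t) * T') hβ'.1 hβ'.2.le hC (by nlinarith [ht.1]) hβT'
    have e4 : (σ₁ t).im = (expPath β' C T' - expPath β' C ((1 - t) * T')).im := by
      simp only [hσ₁, Complex.add_im, Complex.ofReal_im, zero_add]
    rw [hσ₁re, e4]
    refine e2.trans ?_
    have e3 : T' - (1 - t) * T' = t * T' := by ring
    rw [e3]
    have e5 : 0 ≤ (1 + Real.pi) * S.lam := by positivity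
    nlinarith
  have hs₂m : ∀ t ∈ Icc (0 : ℝ) 1, (s₂ t, x) ∈ Ω := by
    intro t ht
    refine hmem _ (by rw [hs₂re]; exact hT0.le) (by rw [hs₂re]) ?_
    have e2 := abs_expPath_im_sub_le (u := 0) hβ0 hβl.le hC hT0.le hβTlog
    have e3 : (s₂ t).im = (expPath β C T - expPath β C 0).im - 2 * Real.pi * m * t := by
      have : (2 * Real.pi * m * t * Complex.I : ℂ) = ((2 * Real.pi * m * t : ℝ) : ℂ) * Complex.I := by
        push_cast; ring
      simp only [hs₂, this, Complex.sub_im, expPath_im, Complex.im_ofReal_mul, Complex.I_im, mul_one]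
      simp
    rw [hs₂re, e3]
    refine (abs_sub _ _).trans ?_
    have e4 : |2 * Real.pi * m * t| ≤ 2 * Real.pi * |(m : ℝ)| * T := by
      rw [abs_mul, abs_mul, abs_of_pos (by positivity : 0 < 2 * Real.pi), abs_of_nonneg ht.1]
      have : t ≤ T := by linarith [ht.2]
      gcongr
    rw [sub_zero] at e2
    linarith
  -- the original lifts
  obtain ⟨q, hl1, hl2⟩ := hD β ⟨hβ0, hβl⟩ C hC T hT0.le hβTlog x hxξ hxD
  have hxs₁ : ∀ t, Complex.exp (-expPath β C ((1 - t) * T)) = x * Complex.exp (s₁ t) := fun t => by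
    rw [hxξ, ← Complex.exp_add]; congr 1; simp only [hs₁]; ring
  have hxs₂ : ∀ t : ℝ, Complex.exp (-(2 * Real.pi * m * t * Complex.I)) = x * Complex.exp (s₂ t) :=
    fun t => by
      rw [hxξ, ← Complex.exp_add]; congr 1; simp only [hs₂]; ring
  have hx'σ₁ : ∀ t, Complex.exp (-expPath β' C ((1 - t) * T')) = x * Complex.exp (σ₁ t) := fun t => by
    rw [hxξ, ← Complex.exp_add]; congr 1; simp only [hσ₁, hξ]; ring
  have hξ0 : ∀ b, expPath b C 0 = 0 := fun b => by simp [expPath]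
  have hq : q = Y (expPath β C T, x) := by
    have e1 : s₁ 0 = 0 := by simp [hs₁]
    have e2 : s₁ 1 = expPath β C T := by simp [hs₁, hξ0]
    have := h.lift_end hxne hxα hs₁d hs₁m (fun t _ => hxs₁ t) hl1 (by
      rw [e1]
      exact (h.init x (by rw [← e1]; exact hs₁m 0 (left_mem_Icc.2 zero_le_one))).symm)
    rwa [e2] at this
  have hs₂0 : s₂ 0 = expPath β C T := by simp [hs₂]
  have hDx : D x = Y (s₂ 1, x) :=
    h.lift_end hxne hxα hs₂d hs₂m (fun t _ => hxs₂ t) hl2 (by rw [hs₂0]; exact hq)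
  refine ⟨Φ.fiberMap 1 q, ?_, ?_⟩
  · have := hΦ.liftsTo h hxα hσ₁d hσ₁m hτη (fun t ht => by
      rw [hσ₁re]; nlinarith [ht.1]) (fun t ht => hn1 _ (by rw [hσ₁re]; nlinarith [ht.2]))
      (fun t _ => hx'σ₁ t)
    have e1 : σ₁ 0 = τ := by simp [hσ₁]
    have e2 : σ₁ 1 = expPath β C T := by simp [hσ₁, hξ0, hξ, add_comm]
    have e3 : Complex.exp (-expPath β' C ((1 - 0) * T')) = x' := by
      rw [hx', sub_zero, one_mul]
    have e4 : Complex.exp (-expPath β' C ((1 - 1) * T')) = 1 := by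
      rw [sub_self, zero_mul, hξ0]; simp
    rw [e1, e2, ← hq, e3, e4] at this
    exact this
  · have := hΦ.liftsTo h hxα hs₂d hs₂m hτη (fun t ht => by
      rw [hs₂re]; linarith) (fun t ht => hn1 _ (by rw [hs₂re])) (fun t _ => hxs₂ t)
    have e3 : Complex.exp (-(2 * Real.pi * m * ((0 : ℝ) : ℂ) * Complex.I)) = 1 := by simp
    have e4 : Complex.exp (-(2 * Real.pi * m * ((1 : ℝ) : ℂ) * Complex.I)) = 1 := by
      rw [Complex.exp_neg, Complex.ofReal_one, mul_one, mul_comm (2 * (Real.pi : ℂ)) m, mul_assoc,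
        Complex.exp_int_mul_two_pi_mul_I, inv_one]
    rw [e3, e4, hs₂0, ← hq, ← hDx] at this
    exact this

end FiberedDiffeo

/-! ### Conjugate first return germs -/

theorem eventually_eventually_nhds_of_nhdsWithin {s : Set ℂ} (hs : IsOpen s) {a : ℂ} {p : ℂ → Prop}
    (h : ∀ᶠ x in 𝓝[s] a, p x) : ∀ᶠ x in 𝓝[s] a, ∀ᶠ w in 𝓝 x, p w := by
  filter_upwards [eventually_eventually_nhdsWithin.2 h, self_mem_nhdsWithin] with x h1 h2
  rwa [hs.nhdsWithin_eq h2] at h1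

theorem zero_mem_closure_slitPlane : (0 : ℂ) ∈ closure Complex.slitPlane := by
  rw [Metric.mem_closure_iff]
  intro ε hε
  refine ⟨((ε / 2 : ℝ) : ℂ), Or.inl (by rw [Complex.ofReal_re]; positivity), ?_⟩
  rw [dist_zero_left, Complex.norm_real, Real.norm_eq_abs, abs_of_pos (by positivity)]
  linarith

theorem exp_mul_mem_slitPlane (τ : ℝ) {x : ℂ} (hx : x ∈ Complex.slitPlane) :
    Complex.exp τ * x ∈ Complex.slitPlane := by
  have h := Real.exp_pos τ
  rw [← Complex.ofReal_exp, Complex.mem_slitPlane_iff, Complex.re_ofReal_mul,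
    Complex.im_ofReal_mul]
  rcases hx with h1 | h1
  · exact Or.inl (mul_pos h h1)
  · exact Or.inr (mul_ne_zero h.ne' h1)

theorem tendsto_exp_mul_slitPlane (τ : ℝ) :
    Tendsto (fun x : ℂ => Complex.exp τ * x) (𝓝[Complex.slitPlane] 0) (𝓝[Complex.slitPlane] 0) := by
  refine tendsto_nhdsWithin_iff.2 ⟨?_, eventually_nhdsWithin_of_forall fun x hx =>
    exp_mul_mem_slitPlane τ hx⟩
  have : Tendsto (fun x : ℂ => Complex.exp τ * x) (𝓝 0) (𝓝 (Complex.exp τ * 0)) :=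
    (continuous_const.mul continuous_id).tendsto 0
  rw [mul_zero] at this
  exact this.mono_left nhdsWithin_le_nhds

namespace FiberedDiffeo

variable {Φ : FiberedDiffeo}

open PreparedSaddle in
/-- The transversal is moved by the flow for a large time `τ` into the domain of `Φ`, then mapped by
`Φ`. In the parameters of the transversals, the resulting conjugacy is the homothety `x ↦ e^τ x`,
which preserves the cut. -/
theorem LoopConj.exists_conjugate {L L' : AbstractLoop} (hΦ : Φ.LoopConj L L') {P : ℂ → ℂ}
    (hP : P ∈ L.Poinc) : ∃ P' ∈ L'.Poinc, AnalyticallyConjugate P P' := by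
  obtain ⟨R, D, hR, ⟨hα, hα0, ⟨A, B₀, hA, hB₀, hreg, hαB⟩, hDt, hDd, m, hDm⟩, hPRD⟩ := hP
  obtain ⟨η, hconj, R₀, hR₀, R₀', hR₀', hcor, hR₀η⟩ := hΦ
  have hlam := L.lam_pos
  have hlam' := L'.lam_pos
  obtain ⟨A', B', -, hA', hB', -, hreg', -, -⟩ := L'.adapted
  obtain ⟨Ω, Y, ρ, B, hsec⟩ := L.exists_sector hα
    (fun y hy => hreg (mem_adaptedRegion_zero hlam hA (hy.trans hαB))) (coneSlope_pos hlam m)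
  have hc := coneSlope_le_one hlam m
  have h00 : ((0 : ℂ), (0 : ℂ)) ∈ Φ.e.source := Φ.mem_source_disk (by simp)
  obtain ⟨δ, hδ, hball⟩ : ∃ δ > 0, ∀ y : ℂ, ‖y‖ < δ →
      ((0 : ℂ), y) ∈ Φ.e.source ∧ ‖Φ.fiberMap 0 y‖ < B' := by
    have e1 : ∀ᶠ y in 𝓝 (0 : ℂ), ‖Φ.fiberMap 0 y‖ < B' := by
      refine (Φ.analyticAt_fiberMap h00).continuousAt.norm.eventually (gt_mem_nhds ?_)
      dsimp only
      rw [Φ.fiberMap_zero (by simp), norm_zero]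
      exact hB'
    obtain ⟨δ, hδ, hb⟩ := Metric.eventually_nhds_iff_ball.1 ((Φ.eventually_mem_source h00).and e1)
    exact ⟨δ, hδ, fun y hy => hb y (by simpa using hy)⟩
  obtain ⟨τ, hτ, hτ1, hτ2⟩ : ∃ τ : ℝ, 1 ≤ τ ∧
      ‖R.α 0‖ * Real.exp (-(L.lam * τ)) < min η δ ∧ B * Real.exp (-(L.lam / 2 * τ)) < η := by
    have t0 : ∀ a b : ℝ, 0 < a → Tendsto (fun τ : ℝ => b * Real.exp (-(a * τ))) atTop (𝓝 0) := by
      intro a b ha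
      have := (Real.tendsto_exp_neg_atTop_nhds_zero.comp
        (tendsto_id.const_mul_atTop ha)).const_mul b
      simpa using this
    obtain ⟨τ, e1, e2, e3⟩ := ((eventually_ge_atTop (1 : ℝ)).and
      (((t0 _ ‖R.α 0‖ hlam).eventually (gt_mem_nhds (lt_min hconj.pos hδ))).and
      ((t0 _ B (half_pos hlam)).eventually (gt_mem_nhds hconj.pos)))).exists
    exact ⟨τ, e1, e2, e3⟩
  have hτ0 : 0 ≤ τ := zero_le_one.trans hτ
  set Rτ := flowGerm hsec hc hτ0 with hRτ
  have hn : ‖Rτ.α 0‖ < min η δ := by rw [hRτ, norm_flowGerm]; exact hτ1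
  obtain ⟨hs, hf⟩ := hball _ (hn.trans_le (min_le_right _ _))
  have hmτ : Rτ ∈ L.cls := AbstractLoop.mem_cls_of_holRel hR (HolRel.flow hsec hc hτ0)
  set R' := Φ.push Rτ hs with hR'
  have hm' : R' ∈ L'.cls := AbstractLoop.mem_cls_of_holRel hR₀' (hconj.holRel hcor (regCorresp_push hs) hR₀η
    (hn.trans_le (min_le_left _ _)) (AbstractLoop.holRel_of_mem_cls hR₀ hmτ))
  set D' : ℂ → ℂ := fun x => Φ.fiberMap 1 (D (Complex.exp (-τ) * x)) with hD'
  have hmul : Tendsto (fun x : ℂ => Complex.exp (-τ) * x) (𝓝[Complex.slitPlane] 0)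
      (𝓝[Complex.slitPlane] 0) := by
    have := tendsto_exp_mul_slitPlane (-τ)
    rwa [Complex.ofReal_neg] at this
  have hcorner : L'.IsCorner R'.α D' := by
    refine ⟨R'.analytic_α, R'.α_ne, ⟨A', B', hA', hB', hreg', hf.le⟩,
      Φ.tendsto_fiberMap_one.comp (hDt.comp hmul), ?_, m,
      hconj.isCornerDet hDm hsec hτ hτ2.le⟩
    filter_upwards [hmul.eventually hDd,
      (hDt.comp hmul).eventually Φ.eventually_fiberMap_one] with x e1 e2
    exact (Φ.analyticAt_fiberMap e2.1).differentiableAt.comp x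
      (e1.comp x (by fun_prop))
  refine ⟨fun x => R'.r (D' x), ⟨R', D', hm', hcorner, Eventually.of_forall fun x => rfl⟩,
    fun x => Complex.exp τ * x, by fun_prop, mul_zero _, ?_, ?_⟩
  · rw [((hasDerivAt_id' (0 : ℂ)).const_mul (Complex.exp τ)).deriv, mul_one]
    exact Complex.exp_ne_zero _
  · have hne : (𝓝[Complex.slitPlane] (0 : ℂ)).NeBot :=
      mem_closure_iff_nhdsWithin_neBot.1 zero_mem_closure_slitPlane
    refine Eventually.frequently ?_
    filter_upwards [self_mem_nhdsWithin,
      eventually_eventually_nhds_of_nhdsWithin Complex.isOpen_slitPlane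
        (hPRD.and (hDt.eventually Φ.eventually_fiberMap_one))] with x h1 h2
    refine ⟨exp_mul_mem_slitPlane τ h1, ?_⟩
    filter_upwards [h2] with w hw
    have e1 : Complex.exp (-τ) * (Complex.exp τ * w) = w := by
      rw [← mul_assoc, ← Complex.exp_add, neg_add_cancel, Complex.exp_zero, one_mul]
    have e2 : D' (Complex.exp τ * w) = Φ.fiberMap 1 (D w) := by rw [hD']; dsimp only; rw [e1]
    rw [e2, hw.1]
    show Complex.exp τ * R.r (Φ.symm.fiberMap 1 (Φ.fiberMap 1 (D w))) = _
    rw [hw.2.2.2.1]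

end FiberedDiffeo

/-! ### First return germs related by a transporting path -/

/-- The regular and corner transitions compose to the same map `D₁ R₁ = D₂ R₂` along `G`, by
analytic continuation from `y₀`, where the holonomies cancel. -/
theorem PreparedSaddle.RelatedBy.exists_eqOn {S : PreparedSaddle} {R₁ R₂ : RegGerm} {D₁ D₂ : ℂ → ℂ}
    {Υ : ℝ → ℂ} (h : S.RelatedBy R₁ R₂ D₁ D₂ Υ) : ∃ G : Set ℂ, IsOpen G ∧ (0 : ℂ) ∈ closure G ∧
      MapsTo R₁.r G Complex.slitPlane ∧ MapsTo R₂.r G Complex.slitPlane ∧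
      ∀ y ∈ G, D₁ (R₁.r y) = D₂ (R₂.r y) := by
  obtain ⟨-, N₁, N₂, W, G, y₀, c, k, -, -, ⟨hWo, -, -, hd1, -, -, hd2, -, -⟩,
    ⟨hGo, hGc, hGW, hy₀, hG0, hm1, hD1, hm2, hD2⟩, -, hR, hD⟩ := h
  refine ⟨G, hGo, hG0, hm1, hm2, ?_⟩
  have a1 : DifferentiableOn ℂ (fun y => D₁ (R₁.r y)) G :=
    hD1.comp (hd1.mono hGW) (mapsTo_image _ _)
  have a2 : DifferentiableOn ℂ (fun y => D₂ (R₂.r y)) G :=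
    hD2.comp (hd2.mono hGW) (mapsTo_image _ _)
  refine (a1.analyticOnNhd hGo).eqOn_of_preconnected_of_eventuallyEq (a2.analyticOnNhd hGo)
    hGc.isPreconnected hy₀ ?_
  have hcont : ContinuousAt R₁.r y₀ := (hd1.differentiableAt (hWo.mem_nhds (hGW hy₀))).continuousAt
  filter_upwards [hcont.eventually hD, hR] with y e1 e2
  rw [e1, e2]

/-- With `D₁ R₁ = D₂ R₂` along `G`, the germ `R₂ R₁⁻¹` conjugates `R₁ D₁` to `R₂ D₂`, which is
`Pt` since `Φ` cancels between the regular and the corner transitions. -/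
theorem analyticallyConjugate_of_relatedBy {L Lt : AbstractLoop} {Φ : FiberedDiffeo}
    {P Pt : ℂ → ℂ} {R Rt R₂ : RegGerm} {D Dt D₂ : ℂ → ℂ} (hP : L.IsDecomposition P R D)
    (hPt : Lt.IsDecomposition Pt Rt Dt) (hR : Φ.RegCorresp Rt R₂)
    (hD : Φ.CornerCorresp Rt.α Dt R₂.α D₂) {Υ : ℝ → ℂ} (h : L.RelatedBy R R₂ D D₂ Υ) :
    AnalyticallyConjugate P Pt := by
  obtain ⟨G, hGo, hG0, hm1, hm2, hG⟩ := h.exists_eqOn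
  obtain ⟨-, ⟨-, -, -, hDt, -⟩, hPRD⟩ := hP
  obtain ⟨-, ⟨-, -, -, hDtt, -⟩, hPtRD⟩ := hPt
  obtain ⟨hs, -, hRr⟩ := FiberedDiffeo.regCorresp_iff.1 hR
  obtain ⟨g, hg0, hga, hgd, hgl, hgr⟩ := exists_analytic_inverse R.analytic_r R.deriv_r
  rw [R.r_zero] at hg0 hga hgd hgr
  -- in terms of the corresponding germs, `Pt = R₂ D₂`
  have hPt2 : ∀ᶠ x in 𝓝[Complex.slitPlane] 0, Pt x = R₂.r (D₂ x) := by
    filter_upwards [hPtRD, hD.2.2, nhdsWithin_le_nhds (Φ.analyticAt_fiberMap_curve Rt.analytic_α hs).2,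
      hDtt.eventually hRr] with x e1 e2 e3 e4
    rw [Φ.fibered _ e3] at e2
    have e5 : D₂ x = Φ.fiberMap 1 (Dt x) := congrArg Prod.snd e2
    rw [e1, e5, e4]
  have hne : (𝓝[G] (0 : ℂ)).NeBot := mem_closure_iff_nhdsWithin_neBot.1 hG0
  have htend : ∀ Q : RegGerm, MapsTo Q.r G Complex.slitPlane →
      Tendsto Q.r (𝓝[G] 0) (𝓝[Complex.slitPlane] 0) := by
    intro Q hQ
    refine tendsto_nhdsWithin_iff.2 ⟨?_, eventually_nhdsWithin_of_forall hQ⟩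
    have := Q.analytic_r.continuousAt.tendsto
    rw [Q.r_zero] at this
    exact this.mono_left nhdsWithin_le_nhds
  have hsl := Complex.isOpen_slitPlane
  have hφa : AnalyticAt ℂ (fun x => R₂.r (g x)) 0 :=
    AnalyticAt.comp_of_eq R₂.analytic_r hga hg0
  refine ⟨fun x => R₂.r (g x), hφa, by dsimp only; rw [hg0, R₂.r_zero], ?_, ?_⟩
  · have h2 : HasDerivAt R₂.r (deriv R₂.r 0) (g 0) := by
      rw [hg0]; exact R₂.analytic_r.differentiableAt.hasDerivAt
    have h3 : HasDerivAt (fun x => R₂.r (g x)) (deriv R₂.r 0 * deriv g 0) 0 :=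
      h2.comp (0 : ℂ) hga.differentiableAt.hasDerivAt
    rw [h3.deriv]
    exact mul_ne_zero R₂.deriv_r hgd
  refine (htend R hm1).frequently (Eventually.frequently ?_)
  -- the identity `φ (P w) = R₂ (D w)` near the base point
  have hφP : ∀ᶠ x in 𝓝[Complex.slitPlane] 0, R₂.r (g (P x)) = R₂.r (D x) := by
    filter_upwards [hPRD, hDt.eventually hgl] with x e1 e2
    rw [e1, e2]
  filter_upwards [self_mem_nhdsWithin, nhdsWithin_le_nhds hgl,
    (htend R hm1).eventually (nhdsWithin_le_nhds hga.eventually_analyticAt),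
    (htend R hm1).eventually (nhdsWithin_le_nhds hφa.eventually_analyticAt),
    (htend R hm1).eventually (nhdsWithin_le_nhds (eventually_eventually_nhds.2 hgr)),
    (htend R hm1).eventually (eventually_eventually_nhds_of_nhdsWithin hsl hφP),
    (htend R₂ hm2).eventually (eventually_eventually_nhds_of_nhdsWithin hsl hPt2)]
    with y hy e1 e2 e3 e4 e5 e6
  refine ⟨by rw [e1]; exact hm2 hy, ?_⟩
  have e7 : ∀ᶠ w in 𝓝 (R.r y), g w ∈ G :=
    e2.continuousAt.eventually (by rw [e1]; exact hGo.mem_nhds hy)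
  have e8 : ∀ᶠ w in 𝓝 (R.r y), Pt (R₂.r (g w)) = R₂.r (D₂ (R₂.r (g w))) :=
    e3.continuousAt.eventually (by dsimp only; rw [e1]; exact e6)
  filter_upwards [e4, e5, e7, e8] with w f1 f2 f3 f4
  have f5 := hG _ f3
  rw [f1] at f5
  rw [f4, f2, f5]

end SaddleLoop

end

theorem theoremA (L Lt : SaddleLoop.AbstractLoop) (Φ : SaddleLoop.FiberedDiffeo)
    (hΦ : Φ.Carries Lt L) :
    (∀ (P Pt : ℂ → ℂ) (R Rt R₂ : SaddleLoop.RegGerm) (D Dt D₂ : ℂ → ℂ),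
      L.IsDecomposition P R D → Lt.IsDecomposition Pt Rt Dt →
      Φ.RegCorresp Rt R₂ → Φ.CornerCorresp Rt.α Dt R₂.α D₂ →
      (∃ Υ : ℝ → ℂ, L.RelatedBy R R₂ D D₂ Υ) →
      SaddleLoop.AnalyticallyConjugate P Pt) ∧
    (∀ P ∈ L.Poinc, ∃ Pt ∈ Lt.Poinc, SaddleLoop.AnalyticallyConjugate P Pt) ∧
    (∀ Pt ∈ Lt.Poinc, ∃ P ∈ L.Poinc, SaddleLoop.AnalyticallyConjugate Pt P) := by
  refine ⟨?_, fun P hP => hΦ.loopConj.2.exists_conjugate hP,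
    fun Pt hPt => hΦ.loopConj.1.exists_conjugate hPt⟩
  rintro P Pt R Rt R₂ D Dt D₂ hP hPt hR hD ⟨Υ, hΥ⟩
  exact SaddleLoop.analyticallyConjugate_of_relatedBy hP hPt hR hD hΥ
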